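/- **Theorem.** Let $n\ge 1$ and let $(M,\omega,\theta)$ be a $2n$-dimensional locally conformally symplectic manifold: $M$ is a smooth (Hausdorff, second countable) manifold, $\omega$ a smooth nondegenerate 2-form and $\theta$ a smooth closed 1-form with $d\omega=\theta\wedge\omega$. Let $\Lambda^\sharp:T^*M\to TM$ be the inverse of $v\mapsto v\lrcorner\omega=\omega(v,\cdot)$, let $\Lambda(\alpha,\beta)=\beta(\Lambda^\sharp\alpha)$, let $E$ be the vector field with $E\lrcorner\omega=-\theta$, and for smooth functions put $$X_f=\Lambda^\sharp(df)+fE\quad(\text{so } X_f\lrcorner\omega=df-f\theta),\qquad \{f,g\}=\Lambda(df,dg)+fE(g)-gE(f).$$ Let $H=f_0\in C^\infty(M)$, and let $(f_1,\dots,f_{2n-2})$ be smooth functions forming a Jacobi $C^\infty$-structure for $H$, i.e. there is an open dense set $U\subseteq M$ such that 1. $X_{f_0},\dots,X_{f_{2n-2}}$ are linearly independent at every point of $U$; 2. for all $0\le i<j\le 2n-2$ there is $F_{ji}\in C^\infty(\mathbb R^{j+1})$ with $\{f_j,f_i\}=F_{ji}(f_0,\dots,f_j)$ on $M$, and 3.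 for these $F_{ji}$ the vector field $\bigl(F_{ji}(f_0,\dots,f_j)-\sum_{k=0}^{j}f_k\,\tfrac{\partial F_{ji}}{\partial u_k}(f_0,\dots,f_j)\bigr)E$ is, near every point of $U$, a combination of $X_{f_0},\dots,X_{f_j}$ with smooth coefficients. Then the Hamiltonian system of $H$ is integrated on $U$ by a sequence of $2n-1$ completely integrable Pfaffian equations built from $H$, the $2n-2$ functions $f_1,\dots,f_{2n-2}$, a vector field $R$ and a volume form $\Omega$, in the following sense. Every point of $U$ has an open neighbourhood $V\subseteq U$ carrying a smooth vector field $R$ with $R(x)\notin\operatorname{span}(X_{f_0}(x),\dots,X_{f_{2n-2}}(x))$ for all $x\in V$ and a nowhere vanishing smooth $2n$-form $\Omega$. For every open $V\subseteq U$ and every such $R$ on $V$: (a) $(X_{f_1},\dots,X_{f_{2n-2}},R)$ is a $C^\infty$-structure on $V$ for the distribution $\mathcal D_H=\langle X_H\rangle$: writing it $(Z_1,\dots,Z_{2n-1})$, each $Z_j$ is pointwise transverse to $\mathcal D_{j-1}=\langle X_H,Z_1,\dots,Z_{j-1}\rangle$ and $[Z_j,\mathcal D_{j-1}]\subseteq\mathcal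 D_{j-1}\oplus\langle Z_j\rangle$ (modules over $C^\infty(V)$). Moreover, for every nowhere vanishing smooth $2n$-form $\Omega$ on $V$, the $2n-1$ one-forms $$\omega_i=\Omega(X_H,Z_1,\dots,\widehat{Z_i},\dots,Z_{2n-1},\,\cdot\,),\qquad 1\le i\le 2n-1,$$ have the following properties. (b) They are smooth on $V$ and pointwise linearly independent, their common kernel is spanned by $X_H$, and $d\omega_i\equiv 0 \bmod \langle\omega_i,\omega_{i+1},\dots,\omega_{2n-1}\rangle$ for each $i$. (c) On an open set $W\subseteq V$, say that a smooth function $I_i$ solves the $i$-th equation, given $I_{i+1},\dots,I_{2n-1}$, if at every $x\in W$, on the common kernel of $dI_{i+1},\dots,dI_{2n-1}$ (the tangent space of the common level set $\Sigma$ of $I_{i+1},\dots,I_{2n-1}$), one has $\omega_i\wedge dI_i=0$ and $dI_i\neq0$. For every $i$, if $I_{2n-1},\dots,I_{i+1}$ on $W$ solve the equations with numbers $2n-1,\dots,i+1$ successively, then every point of $W$ has an open neighbourhood on which a solution $I_i$ of the $i$-th equation exists. (d) If $I_1,\dots,I_{2n-1}$ solve all $2n-1$ equations on an open set $W\subseteq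 V$, then their differentials are linearly independent at each point of $W$, $X_H(I_i)=0$ for all $i$, and every point of $W$ has an open neighbourhood $W'\subseteq W$ in which the common level set of $I_1,\dots,I_{2n-1}$ through any $q\in W'$ is exactly the image of an integral curve $\gamma:(a,b)\to W'$ of $X_H$, with $a<0<b$ and $\gamma(0)=q$. -/

import Mathlib

open scoped Manifold ContDiff Topology

noncomputable section

namespace LCSInt

/-! ### Vector fields, differential forms and the exterior derivative

`M` is a manifold without boundary modelled on a real normed space `E`.  Vector fields and forms
are total functions on `M`; only their values on the open set under consideration matter. -/

section Fields

variable (E : Type*) [NormedAddCommGroup E] [NormedSpace ℝ E]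
  (M : Type*) [TopologicalSpace M] [ChartedSpace E M]

/-- Vector fields on `M`. -/
abbrev VField : Type _ := ∀ x : M, TangentSpace 𝓘(ℝ, E) x

/-- Differential `k`-forms on `M`. -/
abbrev DForm (k : ℕ) : Type _ := ∀ x : M, (TangentSpace 𝓘(ℝ, E) x) [⋀^Fin k]→L[ℝ] ℝ

end Fields

section Calculus

variable {E : Type*} [NormedAddCommGroup E] [NormedSpace ℝ E]
  {M : Type*} [TopologicalSpace M] [ChartedSpace E M]

/-- The vector field `X` is smooth on the set `V`. -/
def SmoothVFOn [IsManifold 𝓘(ℝ, E) ∞ M] (V : Set M) (X : VField E M) : Prop :=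
  ContMDiffOn 𝓘(ℝ, E) (𝓘(ℝ, E).prod 𝓘(ℝ, E)) ∞
    (fun x => (⟨x, X x⟩ : TangentBundle 𝓘(ℝ, E) M)) V

/-- The real function `f` is smooth on the set `V`. -/
def SmoothFunOn (V : Set M) (f : M → ℝ) : Prop :=
  ContMDiffOn 𝓘(ℝ, E) 𝓘(ℝ, ℝ) ∞ f V

/-- The differential of a real function, as a covector at `x`. -/
def dfun (f : M → ℝ) (x : M) : TangentSpace 𝓘(ℝ, E) x →L[ℝ] ℝ :=
  mfderiv 𝓘(ℝ, E) 𝓘(ℝ, ℝ) f x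

/-- Coordinate expression of the form `η` in the preferred chart at `x₀`: the pullback of `η` by
the inverse of the chart. -/
def formInChart {k : ℕ} (η : DForm E M k) (x₀ : M) (y : E) : E [⋀^Fin k]→L[ℝ] ℝ :=
  (η ((extChartAt 𝓘(ℝ, E) x₀).symm y)).compContinuousLinearMap
    (mfderiv 𝓘(ℝ, E) 𝓘(ℝ, E) (extChartAt 𝓘(ℝ, E) x₀).symm y)

/-- The form `η` is smooth on the set `V`: its coordinate expressions are. -/
def SmoothFormOn {k : ℕ} (V : Set M) (η : DForm E M k) : Prop :=
  ∀ x₀ : M, ContDiffOn ℝ ∞ (formInChart η x₀)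
    ((extChartAt 𝓘(ℝ, E) x₀).target ∩ (extChartAt 𝓘(ℝ, E) x₀).symm ⁻¹' V)

/-- Exterior derivative: `(dη)_x` is the exterior derivative of the expression of `η` in the
preferred chart at `x`, pulled back by that chart. -/
def dForm {k : ℕ} (η : DForm E M k) : DForm E M (k + 1) := fun x =>
  (extDeriv (formInChart η x) (extChartAt 𝓘(ℝ, E) x x)).compContinuousLinearMap
    (mfderiv 𝓘(ℝ, E) 𝓘(ℝ, E) (extChartAt 𝓘(ℝ, E) x) x)

end Calculus

/-! ### Locally conformally symplectic manifolds and their Jacobi structure -/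

section Jacobi

variable (E : Type*) [NormedAddCommGroup E] [NormedSpace ℝ E]
  (M : Type*) [TopologicalSpace M] [ChartedSpace E M]

/-- A locally conformally symplectic structure on `M`: a smooth nondegenerate two-form
`ω = form` and a smooth closed one-form `θ = lee` with `dω = θ ∧ ω`. -/
structure LCS where
  form : DForm E M 2
  lee : DForm E M 1
  smooth_form : SmoothFormOn Set.univ form
  smooth_lee : SmoothFormOn Set.univ lee
  nondegenerate : ∀ (x : M) (v : TangentSpace 𝓘(ℝ, E) x),
    (∀ w : TangentSpace 𝓘(ℝ, E) x, form x ![v, w] = 0) → v = 0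
  closed_lee : ∀ x : M, dForm lee x = 0
  d_form : ∀ (x : M) (u v w : TangentSpace 𝓘(ℝ, E) x),
    dForm form x ![u, v, w] =
      lee x ![u] * form x ![v, w] - lee x ![v] * form x ![u, w] + lee x ![w] * form x ![u, v]

/-- A bivector field `Λ`, given by `Λ♯ : T*M → TM`, together with a vector field `E`: the data of
a Jacobi structure. -/
structure BivectorPair where
  sharp : ∀ x : M, (TangentSpace 𝓘(ℝ, E) x →L[ℝ] ℝ) →ₗ[ℝ] TangentSpace 𝓘(ℝ, E) x
  reeb : VField E M

variable {E M}

namespace BivectorPair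

/-- `Λ(α, β) = β (Λ♯ α)`. -/
def bivector (J : BivectorPair E M) (x : M) (α β : TangentSpace 𝓘(ℝ, E) x →L[ℝ] ℝ) : ℝ :=
  β (J.sharp x α)

/-- Hamiltonian vector field `X_f = Λ♯(df) + f E`. -/
def ham (J : BivectorPair E M) (f : M → ℝ) : VField E M := fun x =>
  J.sharp x (dfun f x) + f x • J.reeb x

/-- Jacobi bracket `{f, g} = Λ(df, dg) + f E(g) - g E(f)`. -/
def bracket (J : BivectorPair E M) (f g : M → ℝ) : M → ℝ := fun x =>
  J.bivector x (dfun f x) (dfun g x)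
    + f x * dfun g x (J.reeb x) - g x * dfun f x (J.reeb x)

end BivectorPair

namespace LCS

/-- `v ↦ v ⌟ ω` as a linear map. -/
def flatMap (S : LCS E M) (x : M) :
    TangentSpace 𝓘(ℝ, E) x →ₗ[ℝ] (TangentSpace 𝓘(ℝ, E) x →L[ℝ] ℝ) where
  toFun v := (S.form x).toContinuousLinearMap ![v, 0] 1
  map_add' v v' := by
    ext w
    change S.form x (Function.update ![v + v', 0] 1 w) =
      S.form x (Function.update ![v, 0] 1 w) + S.form x (Function.update ![v', 0] 1 w)
    have h : ∀ z, Function.update ![z, 0] 1 w = Function.update ![v, w] 0 z := by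
      intro z; ext i; fin_cases i <;> rfl
    rw [h, h, h]
    exact (S.form x).map_update_add ![v, w] 0 v v'
  map_smul' c v := by
    ext w
    change S.form x (Function.update ![c • v, 0] 1 w) =
      c • S.form x (Function.update ![v, 0] 1 w)
    have h : ∀ z, Function.update ![z, 0] 1 w = Function.update ![v, w] 0 z := by
      intro z; ext i; fin_cases i <;> rfl
    rw [h, h]
    exact (S.form x).map_update_smul ![v, w] 0 c v

theorem flatMap_apply (S : LCS E M) (x : M) (v w : TangentSpace 𝓘(ℝ, E) x) :
    S.flatMap x v w = S.form x ![v, w] := by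
  have h : Function.update ![v, 0] 1 w = ![v, w] := by
    ext i; fin_cases i <;> rfl
  change (S.form x) (Function.update ![v, 0] 1 w) = _
  rw [h]

variable [FiniteDimensional ℝ E]

theorem flatMap_bijective (S : LCS E M) (x : M) : Function.Bijective (S.flatMap x) := by
  have : FiniteDimensional ℝ (TangentSpace 𝓘(ℝ, E) x) := ‹FiniteDimensional ℝ E›
  have hinj : Function.Injective (S.flatMap x) := by
    rw [injective_iff_map_eq_zero]
    intro v hv
    refine S.nondegenerate x v fun w => ?_
    rw [← flatMap_apply, hv]
    rfl
  refine ⟨hinj, ?_⟩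
  let e : (TangentSpace 𝓘(ℝ, E) x →ₗ[ℝ] ℝ) ≃ₗ[ℝ] (TangentSpace 𝓘(ℝ, E) x →L[ℝ] ℝ) :=
    LinearMap.toContinuousLinearMap (𝕜 := ℝ) (E := E) (F' := ℝ)
  have : FiniteDimensional ℝ (TangentSpace 𝓘(ℝ, E) x →L[ℝ] ℝ) := e.finiteDimensional
  refine (LinearMap.injective_iff_surjective_of_finrank_eq_finrank ?_).1 hinj
  rw [← e.finrank_eq]
  exact (Subspace.dual_finrank_eq (K := ℝ) (V := TangentSpace 𝓘(ℝ, E) x)).symm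

/-- The isomorphism `TM ≃ T*M`, `v ↦ v ⌟ ω`. -/
def flat (S : LCS E M) (x : M) :
    TangentSpace 𝓘(ℝ, E) x ≃ₗ[ℝ] (TangentSpace 𝓘(ℝ, E) x →L[ℝ] ℝ) :=
  LinearEquiv.ofBijective (S.flatMap x) (S.flatMap_bijective x)

/-- The Jacobi structure of a locally conformally symplectic manifold: `Λ♯ = ω♯` is the inverse of
`v ↦ v ⌟ ω`, and `E = Z_θ` is the vector field with `Z_θ ⌟ ω = -θ`. -/
def jacobi (S : LCS E M) : BivectorPair E M where
  sharp x := ((S.flat x).symm : _ →ₗ[ℝ] _)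
  reeb x := (S.flat x).symm
    (-(ContinuousAlternatingMap.ofSubsingleton ℝ _ ℝ (0 : Fin 1)).symm (S.lee x))

/-- The Hamiltonian vector field is characterized by `X_f ⌟ ω = df - f θ`. -/
theorem ham_spec (S : LCS E M) (f : M → ℝ) (x : M) (w : TangentSpace 𝓘(ℝ, E) x) :
    S.form x ![S.jacobi.ham f x, w] = dfun f x w - f x * S.lee x ![w] := by
  have h : S.flat x (S.jacobi.ham f x) = dfun f x +
      f x • (-(ContinuousAlternatingMap.ofSubsingleton ℝ _ ℝ (0 : Fin 1)).symm (S.lee x)) := by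
    simp [BivectorPair.ham, jacobi]
  have h2 := S.flatMap_apply x (S.jacobi.ham f x) w
  change S.flat x (S.jacobi.ham f x) w = _ at h2
  rw [← h2, h]
  have h3 : (ContinuousAlternatingMap.ofSubsingleton ℝ _ ℝ (0 : Fin 1)).symm (S.lee x) w
      = S.lee x ![w] := by
    change S.lee x (fun _ => w) = _
    congr 1
    ext i
    fin_cases i
    rfl
  simp only [smul_neg, add_apply, neg_apply, smul_apply, smul_eq_mul, h3]
  ring

end LCS

/-- `F = (f₁, …, f_N)`, with `N = dim M - 2`, is a Jacobi `C^∞`-structure for the Hamiltonian system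
`(M, H)`, with the open dense set `U` as its set of independence.  Here `f₀ = H`. -/
structure IsJacobiCInfStructure [IsManifold 𝓘(ℝ, E) ∞ M] (J : BivectorPair E M) {N : ℕ}
    (H : M → ℝ) (F : Fin N → M → ℝ) (U : Set M) : Prop where
  card_eq : Module.finrank ℝ E = N + 2
  smooth : ∀ j, SmoothFunOn (E := E) Set.univ (F j)
  isOpen : IsOpen U
  dense : Dense U
  /-- Vector field independence. -/
  independent : ∀ x ∈ U, LinearIndependent ℝ
    (fun k : Fin (N + 1) => J.ham ((Fin.cons H F : Fin (N + 1) → M → ℝ) k) x)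
  /-- Triangular bracket closure `{f_j, f_i} = G (f₀, …, f_j)` and Reeb compatibility: the vector
  field `(G (f₀, …, f_j) - ∑ k ≤ j, f_k ∂G/∂u_k (f₀, …, f_j)) E` belongs locally on `U` to the
  `C^∞`-module generated by `X_{f₀}, …, X_{f_j}`. -/
  closure_reeb : ∀ i j : Fin (N + 1), i < j →
    let f : Fin (N + 1) → M → ℝ := Fin.cons H F
    let f' : Fin (j.val + 1) → M → ℝ := fun k => f (Fin.castLE j.isLt k)
    ∃ G : (Fin (j.val + 1) → ℝ) → ℝ, ContDiff ℝ ∞ G ∧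
      (∀ x, J.bracket (f j) (f i) x = G (fun k => f' k x)) ∧
      ∀ p ∈ U, ∃ W : Set M, IsOpen W ∧ p ∈ W ∧
        ∃ c : Fin (j.val + 1) → M → ℝ, (∀ k, SmoothFunOn (E := E) W (c k)) ∧
          ∀ x ∈ W,
            (G (fun k => f' k x)
              - ∑ k, f' k x * fderiv ℝ G (fun k => f' k x) (Pi.single k 1)) • J.reeb x
            = ∑ k, c k x • J.ham (f' k) x

end Jacobi

/-! ### `C^∞`-structures of distributions and Pfaffian equations -/

section Pfaff

variable {E : Type*} [NormedAddCommGroup E] [NormedSpace ℝ E]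
  {M : Type*} [TopologicalSpace M] [ChartedSpace E M]

/-- On `V`, the vector field `Z` belongs to the `C^∞(V)`-module generated by the family `Y`. -/
def InModuleOn {ι : Type*} [Fintype ι] (V : Set M) (Y : ι → VField E M) (Z : VField E M) : Prop :=
  ∃ c : ι → M → ℝ, (∀ i, SmoothFunOn (E := E) V (c i)) ∧ ∀ x ∈ V, Z x = ∑ i, c i x • Y i x

/-- On `V`, the vector field `X` is a `C^∞`-symmetry of the distribution `D` generated by `Y`:
it is pointwise transverse to `D`, and `[X, D] ⊆ D ⊕ ⟨X⟩`. -/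
def IsCInfSymmetryOn {ι : Type*} [Fintype ι] (V : Set M) (Y : ι → VField E M)
    (X : VField E M) : Prop :=
  (∀ x ∈ V, X x ∉ Submodule.span ℝ (Set.range fun i => Y i x)) ∧
  ∀ Z : VField E M, InModuleOn V Y Z →
    InModuleOn V (Sum.elim Y fun _ : Unit => X) (VectorField.mlieBracket 𝓘(ℝ, E) X Z)

/-- On `V`, the ordered family `X = (X₁, …, X_r)` is a `C^∞`-structure for the distribution `D` of
rank `k` generated by the (pointwise independent) family `Y = (Y₁, …, Y_k)`, where `k + r = dim M`:
each `X_j` is a `C^∞`-symmetry of `D ⊕ ⟨X₁, …, X_{j-1}⟩`. -/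
structure IsCInfStructureOn [IsManifold 𝓘(ℝ, E) ∞ M] {k r : ℕ} (V : Set M)
    (Y : Fin k → VField E M) (X : Fin r → VField E M) : Prop where
  dim_eq : k + r = Module.finrank ℝ E
  smooth_Y : ∀ i, SmoothVFOn V (Y i)
  smooth_X : ∀ j, SmoothVFOn V (X j)
  independent : ∀ x ∈ V, LinearIndependent ℝ (fun i => Y i x)
  symmetry : ∀ j : Fin r,
    IsCInfSymmetryOn V (Sum.elim Y fun i : {i : Fin r // i < j} => X i) (X j)

/-- The one-form `Z ↦ Ω (Y₀, …, Ŷ_i, …, Y_{m-1}, Z)` obtained by contracting the `m`-form `Ω` with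
all members of the frame `Y` but `Y_i`. -/
def pfaffForm {N : ℕ} (Ω : DForm E M (N + 1)) (Y : Fin (N + 1) → VField E M) (i : Fin (N + 1)) :
    DForm E M 1 := fun x =>
  ContinuousAlternatingMap.ofSubsingleton ℝ _ ℝ (0 : Fin 1)
    ((Ω x).toContinuousLinearMap
      (Fin.snoc (α := fun _ => TangentSpace 𝓘(ℝ, E) x) (fun j : Fin N => Y (i.succAbove j) x) 0)
      (Fin.last N))

/-- For the ordered sequence `η₁, …, η_r` of one-forms, `v` is annihilated at `x` by all `η_j` with
`j > i`. -/
def KerAbove {r : ℕ} (η : Fin r → DForm E M 1) (i : Fin r) (x : M)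
    (v : TangentSpace 𝓘(ℝ, E) x) : Prop :=
  ∀ j, i < j → η j x ![v] = 0

/-- The sequence of Pfaffian equations `η_r ≡ 0, …, η₁ ≡ 0` is completely integrable on `V`: the
smooth one-forms `η_i` are pointwise linearly independent and
`dη_i ≡ 0 mod ⟨η_i, η_{i+1}, …, η_r⟩`. -/
structure CompletelyIntegrableOn {r : ℕ} (V : Set M) (η : Fin r → DForm E M 1) : Prop where
  smooth : ∀ i, SmoothFormOn V (η i)
  independent : ∀ x ∈ V, LinearIndependent ℝ (fun i => η i x)
  d_eq_zero_mod : ∀ i, ∀ x ∈ V, ∀ u v : TangentSpace 𝓘(ℝ, E) x,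
    KerAbove η i x u → η i x ![u] = 0 → KerAbove η i x v → η i x ![v] = 0 →
    dForm (η i) x ![u, v] = 0

/-- On the open set `W`, the function `I i` solves the `i`-th Pfaffian equation restricted to the
common level sets `Σ` of the previously found functions `I j`, `j > i`:
`η_i|_Σ ∧ d(I_i|_Σ) = 0`, and `d(I_i|_Σ)` vanishes nowhere.  The tangent space of `Σ` at `x` is the
common kernel of the differentials of the `I j`, `j > i`. -/
structure SolvesPfaffOn {r : ℕ} (W : Set M) (η : Fin r → DForm E M 1) (I : Fin r → M → ℝ)
    (i : Fin r) : Prop where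
  smooth : SmoothFunOn (E := E) W (I i)
  wedge_eq_zero : ∀ x ∈ W, ∀ u v : TangentSpace 𝓘(ℝ, E) x,
    (∀ j, i < j → dfun (I j) x u = 0) → (∀ j, i < j → dfun (I j) x v = 0) →
    η i x ![u] * dfun (I i) x v - η i x ![v] * dfun (I i) x u = 0
  regular : ∀ x ∈ W, ∃ u : TangentSpace 𝓘(ℝ, E) x,
    (∀ j, i < j → dfun (I j) x u = 0) ∧ dfun (I i) x u ≠ 0

/-- The dynamics of the vector field `X` is integrated on `V` by solving successively the Pfaffian
equations `η_r ≡ 0, …, η₁ ≡ 0`. -/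
structure IntegratedByPfaff [IsManifold 𝓘(ℝ, E) ∞ M] {r : ℕ} (V : Set M) (X : VField E M)
    (η : Fin r → DForm E M 1) : Prop where
  /-- The equations define the distribution generated by `X`. -/
  annihilator : ∀ x ∈ V, ∀ v : TangentSpace 𝓘(ℝ, E) x,
    (∀ i, η i x ![v] = 0) ↔ v ∈ Submodule.span ℝ {X x}
  integrable : CompletelyIntegrableOn V η
  /-- Each equation in turn can be solved locally, whatever solutions of the preceding equations
  have been chosen. -/
  step : ∀ (i : Fin r) (W : Set M), IsOpen W → W ⊆ V → ∀ I : Fin r → M → ℝ,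
    (∀ j, i < j → SolvesPfaffOn W η I j) → ∀ p ∈ W,
      ∃ W' : Set M, IsOpen W' ∧ W' ⊆ W ∧ p ∈ W' ∧
        ∃ g : M → ℝ, SolvesPfaffOn W' η (Function.update I i g) i
  /-- Any full sequence of solutions consists of functionally independent first integrals of `X`,
  whose common level sets are locally the orbits of `X`. -/
  orbits : ∀ W : Set M, IsOpen W → W ⊆ V → ∀ I : Fin r → M → ℝ,
    (∀ i, SolvesPfaffOn W η I i) →
      (∀ x ∈ W, LinearIndependent ℝ (fun i => dfun (E := E) (I i) x)) ∧
      (∀ x ∈ W, ∀ i, dfun (I i) x (X x) = 0) ∧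
      ∀ p ∈ W, ∃ W' : Set M, IsOpen W' ∧ W' ⊆ W ∧ p ∈ W' ∧
        ∀ q ∈ W', ∃ (γ : ℝ → M) (a b : ℝ), a < 0 ∧ 0 < b ∧ γ 0 = q ∧
          IsMIntegralCurveOn (I := 𝓘(ℝ, E)) γ X (Set.Ioo a b) ∧
          γ '' Set.Ioo a b = {x ∈ W' | ∀ i, I i x = I i q}

end Pfaff

end LCSInt

end

/-!
The condition `{f_j, f_i} = F_{ji}(f₀, …, f_j)` gives `[X_{f_j}, X_{f_i}] = X_G` with
`G = F_{ji}(f₀, …, f_j)`, and `X_G` is a combination of `X_{f₀}, …, X_{f_j}` and of a multiple of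
the Reeb field `E`, which Reeb compatibility places in the same span. Hence the initial segments of
`(X_{f₀}, …, X_{f_{2n-2}}, R)` span involutive distributions. Contracting `Ω` with all members of
this frame but one gives, up to nonvanishing factors, the dual coframe: `ω_i` vanishes on all
members of the frame except `Z_i`, so that `dI_i` solves the `i`-th equation exactly when it
vanishes on `X_H, Z₁, …, Z_{i-1}` and not on `Z_i`, given the later equations.

Such an `I_i` is a first integral of an involutive distribution, provided by the Frobenius theorem
after correcting the frame by multiples of the `Z_l`, `l > i`, so as to be tangent to the level sets
of `I_{i+1}, …, I_{2n-1}`. The differentials of a full set of solutions form an echelon system whose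
common kernel is spanned by `X_H`, and a flow box for `X_H` identifies their level sets with orbits.

The Frobenius theorem is reduced to commuting frames, whose joint flow is smooth in time and initial
value together because it solves the integral equation `y = z + ∫ B(y) x`, to which the inverse
function theorem applies in the Banach space of continuous curves.
-/

noncomputable section

namespace LCSInt

/-! ### Smooth flows of linear families of vector fields -/

section Curves

open ContinuousMap unitInterval

universe u v

section Postcomposition

variable {K : Type*} [TopologicalSpace K] [CompactSpace K]

/-- The pairing `(A, v) ↦ (t ↦ A t (v t))` of continuous curves of operators with continuous curves
of vectors, as a continuous bilinear map. -/
def pointwiseApply (K : Type*) [TopologicalSpace K] [CompactSpace K] (G G' : Type*)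
    [NormedAddCommGroup G] [NormedSpace ℝ G] [NormedAddCommGroup G'] [NormedSpace ℝ G'] :
    C(K, G →L[ℝ] G') →L[ℝ] C(K, G) →L[ℝ] C(K, G') :=
  LinearMap.mkContinuous₂
    (LinearMap.mk₂ ℝ (fun (A : C(K, G →L[ℝ] G')) (v : C(K, G)) =>
        (⟨fun t => A t (v t), by fun_prop⟩ : C(K, G')))
      (fun _ _ _ => by ext; simp) (fun _ _ _ => by ext; simp)
      (fun _ _ _ => by ext; simp) (fun _ _ _ => by ext; simp)) 1
    (fun A v => by
      refine (norm_le _ (by positivity)).2 fun t => ?_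
      rw [one_mul]
      exact ((A t).le_opNorm _).trans
        (mul_le_mul (A.norm_coe_le_norm t) (v.norm_coe_le_norm t) (norm_nonneg _)
          ((norm_nonneg (A t)).trans (A.norm_coe_le_norm t))))

theorem hasFDerivAt_postcomp {G G' : Type*} [NormedAddCommGroup G] [NormedSpace ℝ G]
    [NormedAddCommGroup G'] [NormedSpace ℝ G'] {f : C(G, G')} {f' : C(G, G →L[ℝ] G')}
    (hf : ∀ x, HasFDerivAt f (f' x) x) (y : C(K, G)) :
    HasFDerivAt (fun y : C(K, G) => f.comp y) (pointwiseApply K G G' (f'.comp y)) y := by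
  rw [hasFDerivAt_iff_isLittleO_nhds_zero, Asymptotics.isLittleO_iff]
  intro ε hε
  obtain ⟨δ, hδ, hball⟩ := (Metric.continuousAt_iff (f := fun y : C(K, G) => f'.comp y) (a := y)).1
    f'.continuous_postcomp.continuousAt ε hε
  filter_upwards [Metric.ball_mem_nhds (0 : C(K, G)) hδ] with v hv
  rw [mem_ball_zero_iff] at hv
  refine (norm_le _ (by positivity)).2 fun t => ?_
  have mean_value : ‖f (y t + v t) - f (y t) - f' (y t) (y t + v t - y t)‖
      ≤ ε * ‖y t + v t - y t‖ := by
    refine (convex_segment (𝕜 := ℝ) (y t) (y t + v t)).norm_image_sub_le_of_norm_hasFDerivWithin_le'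
      (fun x _ => (hf x).hasFDerivWithinAt) (fun x hx => ?_)
      (left_mem_segment ℝ _ _) (right_mem_segment ℝ _ _)
    rw [segment_eq_image'] at hx
    obtain ⟨s, hs, rfl⟩ := hx
    have hclose : dist (y + s • v) y < δ := by
      rw [dist_eq_norm, add_sub_cancel_left, norm_smul, Real.norm_of_nonneg hs.1]
      exact (mul_le_of_le_one_left (norm_nonneg _) hs.2).trans_lt hv
    have hclose' := (dist_apply_le_dist t).trans (hball hclose).le
    rw [dist_eq_norm] at hclose'
    simpa only [coe_comp, Function.comp_apply, coe_add, Pi.add_apply, coe_smul, Pi.smul_apply,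
      add_sub_cancel_left] using hclose'
  simp only [add_sub_cancel_left] at mean_value
  exact mean_value.trans (mul_le_mul_of_nonneg_left (v.norm_coe_le_norm t) hε.le)

theorem hasFDerivAt_pointwiseApply_postcomp {G X Z : Type*} [NormedAddCommGroup G]
    [NormedSpace ℝ G] [NormedAddCommGroup X] [NormedSpace ℝ X] [NormedAddCommGroup Z]
    [NormedSpace ℝ Z] {B : C(G, X →L[ℝ] Z)} {B' : C(G, G →L[ℝ] X →L[ℝ] Z)}
    (hB : ∀ x, HasFDerivAt B (B' x) x) (y : C(K, G)) (u : C(K, X)) :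
    HasFDerivAt (fun r : C(K, G) × C(K, X) => pointwiseApply K X Z (B.comp r.1) r.2)
      (pointwiseApply K X Z (B.comp y) ∘L .snd ℝ _ _ + (pointwiseApply K X Z).flip u ∘L
        pointwiseApply K G (X →L[ℝ] Z) (B'.comp y) ∘L .fst ℝ _ _) (y, u) := by
  have hcomp : HasFDerivAt (fun r : C(K, G) × C(K, X) => B.comp r.1)
      (pointwiseApply K G (X →L[ℝ] Z) (B'.comp y) ∘L .fst ℝ _ _) (y, u) :=
    HasFDerivAt.comp (f := Prod.fst) (y, u) (hasFDerivAt_postcomp hB y) hasFDerivAt_fst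
  have happly := ((pointwiseApply K X Z).hasFDerivAt (x := B.comp y)).comp
    (f := fun r : C(K, G) × C(K, X) => B.comp r.1) (y, u) hcomp
  exact happly.clm_apply (hasFDerivAt_snd (𝕜 := ℝ))

theorem contDiff_postcomp_nat {G : Type u} [NormedAddCommGroup G] [NormedSpace ℝ G] (n : ℕ) :
    ∀ {G' : Type max u v} [NormedAddCommGroup G'] [NormedSpace ℝ G'] {f : C(G, G')},
      ContDiff ℝ n f → ContDiff ℝ n (fun y : C(K, G) => f.comp y) := by
  induction n with
  | zero => exact fun {_ _ _ f} _ => contDiff_zero.2 f.continuous_postcomp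
  | succ n ih =>
    intro G' _ _ f hf
    push_cast at hf ⊢
    obtain ⟨hdiff, -, hf'⟩ := contDiff_succ_iff_fderiv.1 hf
    let f' : C(G, G →L[ℝ] G') := ⟨fderiv ℝ f, hf'.continuous⟩
    exact contDiff_succ_iff_hasFDerivAt.2 ⟨fun y => pointwiseApply K G G' (f'.comp y),
      (ih (f := f') hf').continuousLinearMap_comp (pointwiseApply K G G'),
      hasFDerivAt_postcomp (f' := f') fun x => (hdiff x).hasFDerivAt⟩

theorem contDiff_postcomp {G : Type u} [NormedAddCommGroup G] [NormedSpace ℝ G]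
    {G' : Type max u v} [NormedAddCommGroup G'] [NormedSpace ℝ G'] {f : C(G, G')}
    (hf : ContDiff ℝ ∞ f) : ContDiff ℝ ∞ (fun y : C(K, G) => f.comp y) :=
  contDiff_infty.2 fun n => contDiff_postcomp_nat.{u, v} n (contDiff_infty.1 hf n)

end Postcomposition

section Integration

variable {G : Type*} [NormedAddCommGroup G] [NormedSpace ℝ G] [CompleteSpace G]

/-- The operator sending a curve `y` over the unit interval to the curve `t ↦ ∫ s in 0..t, y s`. -/
def curveIntegral (G : Type*) [NormedAddCommGroup G] [NormedSpace ℝ G] [CompleteSpace G] :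
    C(I, G) →L[ℝ] C(I, G) :=
  LinearMap.mkContinuous
    { toFun := fun y => ⟨fun t => ∫ s in (0 : ℝ)..t, IccExtend zero_le_one y s,
        (intervalIntegral.continuous_primitive
          (fun _ _ => (IccExtend zero_le_one y).continuous.intervalIntegrable _ _) 0).comp
          continuous_subtype_val⟩
      map_add' := fun y z => by
        ext t
        exact intervalIntegral.integral_add
          ((IccExtend zero_le_one y).continuous.intervalIntegrable _ _)
          ((IccExtend zero_le_one z).continuous.intervalIntegrable _ _)
      map_smul' := fun c y => by
        ext t
        exact intervalIntegral.integral_smul c _ } 1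
    (fun y => by
      refine (norm_le _ (by positivity)).2 fun t => ?_
      have h := intervalIntegral.norm_integral_le_of_norm_le_const (a := (0 : ℝ)) (b := t)
        (f := IccExtend zero_le_one y) (C := ‖y‖) (fun s _ => y.norm_coe_le_norm _)
      refine h.trans ?_
      rw [sub_zero, abs_of_nonneg t.2.1, one_mul]
      exact mul_le_of_le_one_right (norm_nonneg _) t.2.2)

theorem curveIntegral_apply (y : C(I, G)) (t : I) :
    curveIntegral G y t = ∫ s in (0 : ℝ)..t, IccExtend zero_le_one y s := rfl

theorem curveIntegral_zero (y : C(I, G)) : curveIntegral G y 0 = 0 := by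
  rw [curveIntegral_apply, Set.Icc.coe_zero, intervalIntegral.integral_same]

theorem hasDerivWithinAt_IccExtend_of_eq_curveIntegral {y z : C(I, G)} {v : G}
    (h : y = const _ v + curveIntegral G z) {t : ℝ} (ht : t ∈ Set.Ico (0 : ℝ) 1) :
    HasDerivWithinAt (IccExtend zero_le_one y) (IccExtend zero_le_one z t) (Set.Ici t) t := by
  have hprimitive : HasDerivAt (fun u => v + ∫ s in (0 : ℝ)..u, IccExtend zero_le_one z s)
      (IccExtend zero_le_one z t) t :=
    (intervalIntegral.integral_hasDerivAt_right
      ((IccExtend zero_le_one z).continuous.intervalIntegrable _ _)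
      (IccExtend zero_le_one z).continuous.stronglyMeasurable.stronglyMeasurableAtFilter
      (IccExtend zero_le_one z).continuous.continuousAt).const_add v
  have heq : ∀ s ∈ Set.Icc t 1, IccExtend zero_le_one y s =
      v + ∫ s in (0 : ℝ)..s, IccExtend zero_le_one z s := by
    intro s hs
    rw [coe_IccExtend, Set.IccExtend_of_mem zero_le_one y ⟨ht.1.trans hs.1, hs.2⟩, h]
    rfl
  refine hprimitive.hasDerivWithinAt.congr_of_eventuallyEq ?_ (heq t ⟨le_rfl, ht.2.le⟩)
  filter_upwards [Icc_mem_nhdsGE ht.2] with s hs using heq s hs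

end Integration

theorem exists_smooth_openPartialHomeomorph {G G' : Type*} [NormedAddCommGroup G] [NormedSpace ℝ G]
    [CompleteSpace G] [NormedAddCommGroup G'] [NormedSpace ℝ G'] {f : G → G'} {a : G}
    {s : Set G} (hs : s ∈ 𝓝 a) (hf : ∀ x ∈ s, ContDiffAt ℝ ∞ f x) (f' : G ≃L[ℝ] G')
    (hf' : HasFDerivAt f (f' : G →L[ℝ] G') a) :
    ∃ e : OpenPartialHomeomorph G G', a ∈ e.source ∧ (e : G → G') = f ∧ e.source ⊆ s ∧
      ∀ z ∈ e.target, ContDiffAt ℝ ∞ e.symm z := by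
  have hfa : ContDiffAt ℝ ∞ f a := hf a (mem_of_mem_nhds hs)
  have hne : (∞ : WithTop ℕ∞) ≠ 0 := by simp
  have hinv : ∀ᶠ x in 𝓝 a, fderiv ℝ f x ∈ Set.range ((↑) : (G ≃L[ℝ] G') → G →L[ℝ] G') :=
    (hfa.fderiv_right (m := 0) (by simp)).continuousAt.eventually
      (by rw [hf'.fderiv]; exact ContinuousLinearEquiv.nhds f')
  obtain ⟨O, hO, hOo, haO⟩ := eventually_nhds_iff.1 ((Filter.eventually_mem_set.2 hs).and hinv)
  let e := (hfa.toOpenPartialHomeomorph f hf' hne).restrOpen O hOo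
  refine ⟨e, ⟨hfa.mem_toOpenPartialHomeomorph_source hf' hne, haO⟩, rfl,
    fun x hx => (hO x hx.2).1, fun z hz => ?_⟩
  obtain ⟨hmem, A, hA⟩ := hO _ (e.map_target hz).2
  have hsmooth := hf _ hmem
  exact e.contDiffAt_symm hz (hA ▸ (hsmooth.differentiableAt hne).hasFDerivAt) hsmooth

section LinearFamily

variable {X : Type v} [NormedAddCommGroup X] [NormedSpace ℝ X]
  {Z : Type u} [NormedAddCommGroup Z] [NormedSpace ℝ Z] [CompleteSpace Z]

/-- The integral operator whose fixed points `y` are the curves over the unit interval starting at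
`z` and tangent to the vector field `B · x`. -/
def picardOperator (B : C(Z, X →L[ℝ] Z)) (q : X × Z) (y : C(I, Z)) : C(I, Z) :=
  const I q.2 + curveIntegral Z (pointwiseApply I X Z (B.comp y) (const I q.1))

theorem hasFDerivAt_picardOperator {B : C(Z, X →L[ℝ] Z)} {B' : C(Z, Z →L[ℝ] X →L[ℝ] Z)}
    (hB : ∀ z, HasFDerivAt B (B' z) z) (q : X × Z) (y : C(I, Z)) :
    ∃ L : (X × Z) × C(I, Z) →L[ℝ] C(I, Z),
      HasFDerivAt (fun r : (X × Z) × C(I, Z) => picardOperator B r.1 r.2) L (q, y) ∧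
      ∀ k m v, L ((k, m), v) = const I m + curveIntegral Z
        (pointwiseApply I X Z (B.comp y) (const I k) +
          pointwiseApply I X Z (pointwiseApply I Z (X →L[ℝ] Z) (B'.comp y) v) (const I q.1)) := by
  let start : (X × Z) × C(I, Z) →L[ℝ] C(I, Z) :=
    ContinuousLinearMap.const ℝ I ∘L .snd ℝ X Z ∘L .fst ℝ (X × Z) C(I, Z)
  let velocity : (X × Z) × C(I, Z) →L[ℝ] C(I, X) :=
    ContinuousLinearMap.const ℝ I ∘L .fst ℝ X Z ∘L .fst ℝ (X × Z) C(I, Z)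
  have happly := (hasFDerivAt_pointwiseApply_postcomp hB y (const I q.1)).comp
    (f := fun r : (X × Z) × C(I, Z) => (r.2, velocity r)) (q, y)
    (hasFDerivAt_snd.prodMk velocity.hasFDerivAt)
  exact ⟨_, start.hasFDerivAt.add ((curveIntegral Z).hasFDerivAt.comp (q, y) happly),
    fun k m v => rfl⟩

theorem contDiff_picardOperator {B : C(Z, X →L[ℝ] Z)} (hB : ContDiff ℝ ∞ B) :
    ContDiff ℝ ∞ fun r : (X × Z) × C(I, Z) => picardOperator B r.1 r.2 := by
  have hcomp : ContDiff ℝ ∞ fun r : (X × Z) × C(I, Z) => B.comp r.2 :=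
    (contDiff_postcomp.{u, v} hB).comp contDiff_snd
  have hfst : ContDiff ℝ ∞ fun r : (X × Z) × C(I, Z) => const I r.1.1 :=
    (ContinuousLinearMap.const ℝ I ∘L .fst ℝ X Z ∘L .fst ℝ (X × Z) C(I, Z)).contDiff
  have hsnd : ContDiff ℝ ∞ fun r : (X × Z) × C(I, Z) => const I r.1.2 :=
    (ContinuousLinearMap.const ℝ I ∘L .snd ℝ X Z ∘L .fst ℝ (X × Z) C(I, Z)).contDiff
  have hpair : ContDiff ℝ ∞ fun r : (X × Z) × C(I, Z) => pointwiseApply I X Z (B.comp r.2) :=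
    hcomp.continuousLinearMap_comp (G := C(I, X) →L[ℝ] C(I, Z)) (pointwiseApply I X Z)
  exact hsnd.add ((hpair.clm_apply hfst).continuousLinearMap_comp (curveIntegral Z))

/-- At `x = 0` the Picard operator does not depend on the curve to first order, so the derivative of
`(q, y) ↦ (q, y - picardOperator B q y)` is unipotent. -/
theorem exists_hasFDerivAt_sub_picardOperator {B : C(Z, X →L[ℝ] Z)} {B' : C(Z, Z →L[ℝ] X →L[ℝ] Z)}
    (hB : ∀ z, HasFDerivAt B (B' z) z) (p : Z) :
    ∃ f' : ((X × Z) × C(I, Z)) ≃L[ℝ] (X × Z) × C(I, Z),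
      HasFDerivAt (fun r : (X × Z) × C(I, Z) => (r.1, r.2 - picardOperator B r.1 r.2))
        (f' : _ →L[ℝ] _) ((0, p), const I p) := by
  obtain ⟨L, hL, hLapply⟩ := hasFDerivAt_picardOperator hB (0, p) (const I p)
  have hL0 : ∀ r, L r = L (r.1, 0) := fun ⟨⟨k, m⟩, v⟩ => by
    simp only [hLapply]
    congr 3
    ext t
    simp
  let S : X × Z →L[ℝ] C(I, Z) := L ∘L .inl ℝ _ _
  refine ⟨ContinuousLinearEquiv.equivOfInverse
    ((ContinuousLinearMap.fst ℝ _ _).prod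
      (ContinuousLinearMap.snd ℝ _ _ - S ∘L ContinuousLinearMap.fst ℝ _ _))
    ((ContinuousLinearMap.fst ℝ _ _).prod
      (ContinuousLinearMap.snd ℝ _ _ + S ∘L ContinuousLinearMap.fst ℝ _ _))
    (fun q => by simp) (fun q => by simp), ?_⟩
  refine (hasFDerivAt_fst.prodMk (hasFDerivAt_snd.sub hL)).congr_fderiv ?_
  exact ContinuousLinearMap.ext fun r => Prod.ext rfl (congrArg (r.2 - ·) (hL0 r))

theorem exists_smooth_flow_family [CompleteSpace X] (B : C(Z, X →L[ℝ] Z)) (hB : ContDiff ℝ ∞ B)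
    (p : Z) :
    ∃ Φ : X × Z → C(I, Z), Φ (0, p) = const I p ∧
      ∀ᶠ q in 𝓝 (0, p), ContDiffAt ℝ ∞ Φ q ∧ Φ q = picardOperator B q (Φ q) := by
  let f : (X × Z) × C(I, Z) → (X × Z) × C(I, Z) := fun r => (r.1, r.2 - picardOperator B r.1 r.2)
  have hf : ContDiff ℝ ∞ f :=
    contDiff_fst.prodMk (contDiff_snd.sub (contDiff_picardOperator hB))
  obtain ⟨f', hf'⟩ := exists_hasFDerivAt_sub_picardOperator
    (B' := ⟨fderiv ℝ B, hB.continuous_fderiv (by simp)⟩)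
    (fun z => (hB.differentiable (by simp) z).hasFDerivAt) p
  obtain ⟨e, he, hef, -, hsymm⟩ := exists_smooth_openPartialHomeomorph
    Filter.univ_mem (fun _ _ => hf.contDiffAt) f' hf'
  have hconst : f ((0, p), const I p) = ((0, p), 0) := by
    refine Prod.ext rfl (sub_eq_zero.2 ?_)
    ext t
    simp [picardOperator]
  have hmem : ((0, p), 0) ∈ e.target := by
    have := e.map_source he
    rwa [hef, hconst] at this
  refine ⟨fun q => (e.symm (q, 0)).2, ?_, ?_⟩
  · have := e.left_inv he
    rw [hef, hconst] at this
    exact congrArg Prod.snd this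
  · filter_upwards [(Continuous.prodMk_left (0 : C(I, Z))).continuousAt.eventually
      (e.open_target.mem_nhds hmem)] with q hq
    refine ⟨contDiffAt_snd.comp q ((hsymm _ hq).comp q (contDiffAt_id.prodMk contDiffAt_const)), ?_⟩
    have hright := e.right_inv hq
    rw [hef] at hright
    have hfst : (e.symm (q, 0)).1 = q := congrArg Prod.fst hright
    have hsnd := congrArg Prod.snd hright
    simp only [f, hfst] at hsnd
    exact sub_eq_zero.1 hsnd

/-- Both `v` and `t ↦ t • B (y t) k` solve the equation of first variation in the direction `k`, so
their difference solves the homogeneous equation. -/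
theorem hasDerivWithinAt_variation_sub_smul {B : C(Z, X →L[ℝ] Z)} {B' : C(Z, Z →L[ℝ] X →L[ℝ] Z)}
    (hB : ∀ z, HasFDerivAt B (B' z) z) {q : X × Z} {y v : C(I, Z)} {k : X}
    (hcomm : ∀ t, B' (y t) (B (y t) q.1) k = B' (y t) (B (y t) k) q.1)
    (hy : y = picardOperator B q y)
    (hv : v = curveIntegral Z (pointwiseApply I X Z (B.comp y) (const I k) +
      pointwiseApply I X Z (pointwiseApply I Z (X →L[ℝ] Z) (B'.comp y) v) (const I q.1)))
    {t : ℝ} (ht : t ∈ Set.Ico (0 : ℝ) 1) :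
    let y' := IccExtend zero_le_one y
    let u := fun s => IccExtend zero_le_one v s - s • B (y' s) k
    HasDerivWithinAt u (B' (y' t) (u t) q.1) (Set.Ici t) t := by
  intro y' u
  have hy' : HasDerivWithinAt y' (B (y' t) q.1) (Set.Ici t) t :=
    hasDerivWithinAt_IccExtend_of_eq_curveIntegral hy ht
  have hv' : HasDerivWithinAt (IccExtend zero_le_one v)
      (B (y' t) k + B' (y' t) (IccExtend zero_le_one v t) q.1) (Set.Ici t) t :=
    hasDerivWithinAt_IccExtend_of_eq_curveIntegral (v := 0) (hv.trans (zero_add _).symm) ht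
  have hBk : HasDerivWithinAt (fun s => B (y' s) k) (B' (y' t) (B (y' t) k) q.1) (Set.Ici t) t := by
    have h := ((hB (y' t)).comp_hasDerivWithinAt t hy').clm_apply
      (hasDerivWithinAt_const t (Set.Ici t) k)
    have hcomm_t : B' (y' t) (B (y' t) q.1) k = B' (y' t) (B (y' t) k) q.1 := hcomm _
    rwa [map_zero, add_zero, hcomm_t] at h
  refine (hv'.sub ((hasDerivWithinAt_id t _).smul hBk)).congr_deriv ?_
  simp only [u, id_eq, one_smul, map_sub, map_smul, _root_.sub_apply, _root_.smul_apply]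
  abel

theorem variation_eq_of_commute {B : C(Z, X →L[ℝ] Z)} {B' : C(Z, Z →L[ℝ] X →L[ℝ] Z)}
    (hB : ∀ z, HasFDerivAt B (B' z) z) {q : X × Z} {y v : C(I, Z)} {k : X}
    (hcomm : ∀ t, B' (y t) (B (y t) q.1) k = B' (y t) (B (y t) k) q.1)
    (hy : y = picardOperator B q y)
    (hv : v = curveIntegral Z (pointwiseApply I X Z (B.comp y) (const I k) +
      pointwiseApply I X Z (pointwiseApply I Z (X →L[ℝ] Z) (B'.comp y) v) (const I q.1))) :
    v 1 = B (y 1) k := by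
  let ext (w : C(I, Z)) : ℝ → Z := IccExtend zero_le_one w
  let u : ℝ → Z := fun t => ext v t - t • B (ext y t) k
  have hu_cont : ContinuousOn u (Set.Icc 0 1) := by
    have hcont (w : C(I, Z)) : Continuous (ext w) := (IccExtend zero_le_one w).continuous
    exact ((hcont v).sub
      (continuous_id.smul ((B.continuous.comp (hcont y)).clm_apply continuous_const))).continuousOn
  have hu_zero : u 0 = 0 := by
    have h0 (w : C(I, Z)) : ext w 0 = w 0 := congrArg w (Set.projIcc_left _)
    simp only [u, h0, zero_smul, sub_zero]
    rw [hv, curveIntegral_zero]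
  have hu_deriv (t : ℝ) (ht : t ∈ Set.Ico (0 : ℝ) 1) :
      HasDerivWithinAt u (B' (ext y t) (u t) q.1) (Set.Ici t) t :=
    hasDerivWithinAt_variation_sub_smul hB hcomm hy hv ht
  obtain ⟨C, hC⟩ := (isCompact_range (Continuous.norm (E := Z →L[ℝ] X →L[ℝ] Z)
    (B'.continuous.comp y.continuous))).bddAbove
  have hu_bound (t : ℝ) (_ : t ∈ Set.Ico (0 : ℝ) 1) :
      ‖B' (ext y t) (u t) q.1‖ ≤ C * ‖q.1‖ * ‖u t‖ :=
    calc ‖B' (ext y t) (u t) q.1‖ ≤ ‖B' (ext y t)‖ * ‖u t‖ * ‖q.1‖ :=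
          (B' (ext y t)).le_opNorm₂ _ _
      _ ≤ C * ‖u t‖ * ‖q.1‖ := by
          gcongr
          exact hC (Set.mem_range_self _)
      _ = C * ‖q.1‖ * ‖u t‖ := by ring
  have hu1 : u 1 = 0 := eq_zero_of_abs_deriv_le_mul_abs_self_of_eq_zero_right hu_cont hu_deriv
    hu_zero hu_bound 1 ⟨zero_le_one, le_rfl⟩
  have h1 (w : C(I, Z)) : ext w 1 = w 1 := congrArg w (Set.projIcc_right _)
  simpa only [u, h1, one_smul, sub_eq_zero] using hu1

theorem exists_commuting_flow [CompleteSpace X] {B : C(Z, X →L[ℝ] Z)} (hB : ContDiff ℝ ∞ B) {p : Z}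
    (hcomm : ∀ᶠ z in 𝓝 p, ∀ k l, fderiv ℝ B z (B z k) l = fderiv ℝ B z (B z l) k) :
    ∃ θ : X × Z → Z, (∀ᶠ z in 𝓝 p, θ (0, z) = z) ∧
      ∀ᶠ q in 𝓝 (0, p), ContDiffAt ℝ ∞ θ q ∧ ∀ k, fderiv ℝ θ q (k, 0) = B (θ q) k := by
  let B' : C(Z, Z →L[ℝ] X →L[ℝ] Z) := ⟨fderiv ℝ B, hB.continuous_fderiv (by simp)⟩
  have hB' (z : Z) : HasFDerivAt B (B' z) z := (hB.differentiable (by simp) z).hasFDerivAt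
  obtain ⟨Φ, hΦp, hΦ⟩ := exists_smooth_flow_family B hB p
  have hΦ_comm : ∀ᶠ q in 𝓝 (0, p), ∀ t k l,
      B' (Φ q t) (B (Φ q t) k) l = B' (Φ q t) (B (Φ q t) l) k := by
    obtain ⟨ε, hε, hball⟩ := Metric.eventually_nhds_iff.1 hcomm
    have hcont : ContinuousAt Φ (0, p) := hΦ.self_of_nhds.1.continuousAt
    filter_upwards [Metric.continuousAt_iff'.1 hcont ε hε] with q hq t
    refine hball ((dist_apply_le_dist (f := Φ q) (g := const I p) t).trans_lt ?_)
    rwa [← hΦp]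
  let ev : C(I, Z) →L[ℝ] Z := ContinuousMap.evalCLM ℝ 1
  refine ⟨fun q => Φ q 1, ?_, ?_⟩
  · filter_upwards [(Continuous.prodMk_right (0 : X)).continuousAt.eventually hΦ] with z hz
    have hstationary : pointwiseApply I X Z (B.comp (Φ (0, z))) (const I (0 : X)) = 0 := by
      ext t
      simp
    rw [hz.2, picardOperator, hstationary, map_zero, add_zero, const_apply]
  · filter_upwards [hΦ.eventually_nhds, hΦ_comm] with q hq hq_comm
    have hsmooth := hq.self_of_nhds.1
    have hdiff := hsmooth.differentiableAt (by simp)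
    refine ⟨ev.contDiff.contDiffAt.comp q hsmooth, fun k => ?_⟩
    obtain ⟨L, hL, hLapply⟩ := hasFDerivAt_picardOperator hB' q (Φ q)
    have hfix : fderiv ℝ Φ q (k, 0) = L ((k, 0), fderiv ℝ Φ q (k, 0)) := by
      have hderiv := hL.comp (f := fun q => (q, Φ q)) q
        ((hasFDerivAt_id q).prodMk hdiff.hasFDerivAt)
      have heq : Φ =ᶠ[𝓝 q] fun q => picardOperator B q (Φ q) := hq.mono fun _ h => h.2
      exact congrArg (· (k, 0)) (heq.fderiv_eq.trans hderiv.fderiv)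
    refine (congrArg (· (k, 0)) (ev.hasFDerivAt.comp q hdiff.hasFDerivAt).fderiv).trans ?_
    refine variation_eq_of_commute hB' (fun t => hq_comm t _ _) hq.self_of_nhds.2 ?_
    exact hfix.trans ((hLapply _ _ _).trans (zero_add _))

theorem exists_contDiff_eventuallyEq {G G' : Type*} [NormedAddCommGroup G] [NormedSpace ℝ G]
    [FiniteDimensional ℝ G] [NormedAddCommGroup G'] [NormedSpace ℝ G'] {f : G → G'} {p : G}
    (hf : ∀ᶠ x in 𝓝 p, ContDiffAt ℝ ∞ f x) :
    ∃ g : G → G', ContDiff ℝ ∞ g ∧ g =ᶠ[𝓝 p] f := by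
  obtain ⟨r, hr, hball⟩ := Metric.eventually_nhds_iff_ball.1 hf
  let χ : ContDiffBump p := ⟨r / 4, r / 2, by positivity, by linarith⟩
  refine ⟨fun x => χ x • f x, contDiff_iff_contDiffAt.2 fun x => ?_, ?_⟩
  · by_cases hx : x ∈ Metric.ball p r
    · exact χ.contDiff.contDiffAt.smul (hball x hx)
    · have hfar : x ∈ (Metric.closedBall p (r / 2))ᶜ := by
        simp only [Set.mem_compl_iff, Metric.mem_closedBall, Metric.mem_ball] at hx ⊢
        linarith
      refine contDiffAt_const (c := 0) |>.congr_of_eventuallyEq ?_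
      filter_upwards [Metric.isClosed_closedBall.isOpen_compl.mem_nhds hfar] with z hz
      simp only [Set.mem_compl_iff, Metric.mem_closedBall, not_le] at hz
      rw [χ.zero_of_le_dist hz.le, zero_smul]
  · filter_upwards [χ.eventuallyEq_one] with x hx
    rw [hx, Pi.one_apply, one_smul]

theorem exists_flow_from_slice [CompleteSpace X] [FiniteDimensional ℝ Z] {K : Type*}
    [NormedAddCommGroup K] [NormedSpace ℝ K] {B : Z → X →L[ℝ] Z} {p : Z}
    (hB : ∀ᶠ z in 𝓝 p, ContDiffAt ℝ ∞ B z)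
    (hcomm : ∀ᶠ z in 𝓝 p, ∀ k l, fderiv ℝ B z (B z k) l = fderiv ℝ B z (B z l) k)
    (T : K →L[ℝ] Z) :
    ∃ f : X × K → Z, (∀ᶠ s in 𝓝 0, f (0, s) = p + T s) ∧
      ∀ᶠ q in 𝓝 0, ContDiffAt ℝ ∞ f q ∧ ∀ k, fderiv ℝ f q (k, 0) = B (f q) k := by
  obtain ⟨B₁, hB₁, heq⟩ := exists_contDiff_eventuallyEq hB
  have hcomm₁ : ∀ᶠ z in 𝓝 p, ∀ k l, fderiv ℝ B₁ z (B₁ z k) l = fderiv ℝ B₁ z (B₁ z l) k := by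
    filter_upwards [hcomm, heq.eventuallyEq_nhds] with z hz heqz
    rwa [heqz.fderiv_eq, heqz.eq_of_nhds]
  obtain ⟨θ, hθ0, hθ⟩ := exists_commuting_flow (B := ⟨B₁, hB₁.continuous⟩) hB₁ hcomm₁
  let A : X × K →L[ℝ] X × Z := (ContinuousLinearMap.fst ℝ X K).prod (T ∘L .snd ℝ X K)
  let a : X × K → X × Z := fun q => (0, p) + A q
  have ha (q : X × K) : HasFDerivAt a A q := A.hasFDerivAt.const_add _
  have ha0 : a 0 = (0, p) := by simp [a]
  have hlim : Filter.Tendsto a (𝓝 0) (𝓝 (0, p)) := ha0 ▸ (ha 0).continuousAt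
  have hθlim : Filter.Tendsto (θ ∘ a) (𝓝 0) (𝓝 p) := by
    have h := hθ.self_of_nhds.1.continuousAt.tendsto.comp hlim
    rwa [hθ0.self_of_nhds] at h
  refine ⟨θ ∘ a, ?_, ?_⟩
  · have hslice : Filter.Tendsto (fun s => p + T s) (𝓝 0) (𝓝 p) := by
      have hcont : Continuous fun s => p + T s := by fun_prop
      exact hcont.tendsto' 0 p (by simp)
    filter_upwards [hslice.eventually hθ0] with s hs
    simpa [a, A] using hs
  · filter_upwards [hlim.eventually hθ, hθlim.eventually heq] with q hq hBq
    refine ⟨hq.1.comp q (contDiffAt_const.add A.contDiff.contDiffAt), fun k => ?_⟩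
    have hA : A (k, 0) = (k, 0) := by simp [A]
    rw [((hq.1.differentiableAt (by simp)).hasFDerivAt.comp q (ha q)).fderiv, ← hBq]
    exact (congrArg (fderiv ℝ θ (a q)) hA).trans (hq.2 k)

theorem exists_flow_box [CompleteSpace X] [FiniteDimensional ℝ Z] {K : Type*}
    [NormedAddCommGroup K] [NormedSpace ℝ K] [CompleteSpace K] {B : Z → X →L[ℝ] Z} {p : Z}
    (hB : ∀ᶠ z in 𝓝 p, ContDiffAt ℝ ∞ B z)
    (hcomm : ∀ᶠ z in 𝓝 p, ∀ k l, fderiv ℝ B z (B z k) l = fderiv ℝ B z (B z l) k)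
    (L : (X × K) ≃L[ℝ] Z) (hL : ∀ k, L (k, 0) = B p k) :
    ∃ e : OpenPartialHomeomorph (X × K) Z, 0 ∈ e.source ∧ e 0 = p ∧
      HasFDerivAt e (L : X × K →L[ℝ] Z) 0 ∧
      (∀ q ∈ e.source, ContDiffAt ℝ ∞ e q ∧ ∀ k, fderiv ℝ e q (k, 0) = B (e q) k) ∧
      ∀ z ∈ e.target, ContDiffAt ℝ ∞ e.symm z := by
  obtain ⟨f, hslice, hf⟩ := exists_flow_from_slice hB hcomm
    ((L : X × K →L[ℝ] Z) ∘L .inr ℝ X K)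
  have hf0 : f 0 = p := hslice.self_of_nhds.trans (by simp)
  have hdiff := (hf.self_of_nhds.1.differentiableAt (by simp)).hasFDerivAt
  have hderiv : HasFDerivAt f (L : X × K →L[ℝ] Z) 0 := by
    refine hdiff.congr_fderiv
      (ContinuousLinearMap.prod_ext (ContinuousLinearMap.ext fun k => ?_) ?_)
    · exact (hf.self_of_nhds.2 k).trans ((congrArg (B · k) hf0).trans (hL k).symm)
    · have hinr : HasFDerivAt (fun s : K => f (0, s)) (fderiv ℝ f 0 ∘L .inr ℝ X K) 0 :=
        HasFDerivAt.comp (f := fun s : K => ((0, s) : X × K)) 0 hdiff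
          (ContinuousLinearMap.inr ℝ X K).hasFDerivAt
      exact hinr.unique ((((L : X × K →L[ℝ] Z) ∘L .inr ℝ X K).hasFDerivAt.const_add
        p).congr_of_eventuallyEq hslice)
  obtain ⟨e, he0, rfl, hsource, hsymm⟩ := exists_smooth_openPartialHomeomorph hf
    (fun q hq => hq.1) L hderiv
  exact ⟨e, he0, hf0, hderiv, hsource, hsymm⟩

end LinearFamily

end Curves

/-! ### Involutive families of vector fields -/

section Involutive

theorem fderiv_symm_apply_fderiv {G G' : Type*} [NormedAddCommGroup G] [NormedSpace ℝ G]
    [NormedAddCommGroup G'] [NormedSpace ℝ G'] (e : OpenPartialHomeomorph G G') {q : G}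
    (hq : q ∈ e.source) (he : DifferentiableAt ℝ e q) (hsymm : DifferentiableAt ℝ e.symm (e q))
    (h : G) : fderiv ℝ e.symm (e q) (fderiv ℝ e q h) = h := by
  have hid : e.symm ∘ e =ᶠ[𝓝 q] id := e.eventually_left_inverse hq
  have hcomp := (hsymm.hasFDerivAt.comp q he.hasFDerivAt).fderiv
  rw [hid.fderiv_eq, fderiv_id] at hcomp
  exact congrArg (· h) hcomp.symm

variable {X : Type*} [NormedAddCommGroup X] [NormedSpace ℝ X]
  {Z : Type*} [NormedAddCommGroup Z] [NormedSpace ℝ Z]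

theorem fderiv_comm_of_involutive {B : Z → X →L[ℝ] Z} {π : Z →L[ℝ] X} {z : Z}
    (hB : DifferentiableAt ℝ B z) (hπB : ∀ᶠ y in 𝓝 z, ∀ k, π (B y k) = k) {k l m : X}
    (hm : fderiv ℝ B z (B z k) l - fderiv ℝ B z (B z l) k = B z m) :
    fderiv ℝ B z (B z k) l = fderiv ℝ B z (B z l) k := by
  have hπDB (h : Z) (c : X) : π (fderiv ℝ B z h c) = 0 := by
    have hconst : (fun y => π (B y c)) =ᶠ[𝓝 z] fun _ => c := hπB.mono fun y hy => hy c
    have hcomp := π.hasFDerivAt.comp z (hB.hasFDerivAt.clm_apply (hasFDerivAt_const c z))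
    have hzero := hcomp.fderiv.symm.trans (hconst.fderiv_eq.trans (fderiv_const_apply c))
    simpa using congrArg (· h) hzero
  have hm0 : m = 0 := by
    rw [← hπB.self_of_nhds m, ← hm, map_sub, hπDB, hπDB, sub_zero]
  rwa [hm0, map_zero, sub_eq_zero] at hm

variable [CompleteSpace X] {A : Z → X →L[ℝ] Z} {p : Z}

/-- The new frame is normalised by `π ∘L B z = id`, so the bracket of two of its members, which
lies in their span, is annihilated by `π` and hence vanishes. -/
theorem exists_commuting_frame (hA : ∀ᶠ z in 𝓝 p, ContDiffAt ℝ ∞ A z) {π : Z →L[ℝ] X}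
    (hπ : π ∘L A p = .id ℝ X)
    (hinv : ∀ᶠ z in 𝓝 p, ∀ k l,
      ∃ m, fderiv ℝ A z (A z k) l - fderiv ℝ A z (A z l) k = A z m) :
    ∃ B : Z → X →L[ℝ] Z, B p = A p ∧ ∀ᶠ z in 𝓝 p, ContDiffAt ℝ ∞ B z ∧
      (∀ k, ∃ m, A z k = B z m) ∧
      ∀ k l, fderiv ℝ B z (B z k) l = fderiv ℝ B z (B z l) k := by
  let C : Z → X →L[ℝ] X := fun z => π ∘L A z
  have hC : ∀ᶠ z in 𝓝 p, (C z).IsInvertible := by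
    have hcont : ContinuousAt C p := continuousAt_const.clm_comp hA.self_of_nhds.continuousAt
    have hCp : C p = ((.refl ℝ X : X ≃L[ℝ] X) : X →L[ℝ] X) := hπ
    exact hcont.eventually (by rw [hCp]; exact ContinuousLinearEquiv.nhds _)
  let N : Z → X →L[ℝ] X := fun z => (C z).inverse
  let B : Z → X →L[ℝ] Z := fun z => A z ∘L N z
  have hN : ∀ᶠ z in 𝓝 p, ContDiffAt ℝ ∞ N z := by
    filter_upwards [hA, hC] with z hz ⟨T, hT⟩
    have hinverse := contDiffAt_map_inverse (n := ∞) T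
    rw [hT] at hinverse
    exact hinverse.comp z (contDiffAt_const.clm_comp hz)
  have hπB : ∀ᶠ z in 𝓝 p, ∀ k, π (B z k) = k :=
    hC.mono fun z hz k => hz.self_apply_inverse k
  refine ⟨B, ?_, ?_⟩
  · have hNp : N p = .id ℝ X := by simp only [N, C, hπ, ContinuousLinearMap.inverse_id]
    simp only [B, hNp, ContinuousLinearMap.comp_id]
  filter_upwards [hA, hN, hC, hinv, hπB.eventually_nhds] with z hAz hNz hCz hinvz hπBz
  have hBz : ContDiffAt ℝ ∞ B z := hAz.clm_comp hNz
  refine ⟨hBz, fun k => ⟨C z k, congrArg (A z) (hCz.inverse_apply_self k).symm⟩, fun k l => ?_⟩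
  have hDB (h : Z) (c : X) :
      fderiv ℝ B z h c = fderiv ℝ A z h (N z c) + A z (fderiv ℝ N z h c) := by
    have hcomp := (hAz.differentiableAt (by simp)).hasFDerivAt.clm_comp
      (hNz.differentiableAt (by simp)).hasFDerivAt
    exact (congrArg (fun T : Z →L[ℝ] X →L[ℝ] Z => T h c) hcomp.fderiv).trans (add_comm _ _)
  obtain ⟨m, hm⟩ := hinvz (N z k) (N z l)
  refine fderiv_comm_of_involutive (hBz.differentiableAt (by simp)) hπBz
    (m := C z (m + (fderiv ℝ N z (B z k) l - fderiv ℝ N z (B z l) k))) ?_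
  have hBC (c : X) : B z (C z c) = A z c := congrArg (A z) (hCz.inverse_apply_self c)
  rw [hBC, hDB, hDB, map_add, map_sub, ← hm]
  simp only [B, ContinuousLinearMap.comp_apply]
  abel

theorem exists_first_integral_of_involutive [FiniteDimensional ℝ Z]
    (hA : ∀ᶠ z in 𝓝 p, ContDiffAt ℝ ∞ A z) {π : Z →L[ℝ] X} (hπ : π ∘L A p = .id ℝ X)
    (hinv : ∀ᶠ z in 𝓝 p, ∀ k l,
      ∃ m, fderiv ℝ A z (A z k) l - fderiv ℝ A z (A z l) k = A z m)
    {v : Z} (hv : ∀ k, A p k ≠ v) :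
    ∃ g : Z → ℝ, (∀ᶠ z in 𝓝 p, ContDiffAt ℝ ∞ g z ∧ ∀ k, fderiv ℝ g z (A z k) = 0) ∧
      fderiv ℝ g p v = 1 := by
  obtain ⟨B, hBp, hB⟩ := exists_commuting_frame hA hπ hinv
  let L : (X × π.ker) ≃L[ℝ] Z :=
    (ContinuousLinearEquiv.equivOfRightInverse π (A p) fun k => congrArg (· k) hπ).symm
  have hL (k : X) : L (k, 0) = B p k := by
    rw [hBp]
    exact (ContinuousLinearEquiv.equivOfRightInverse_symm_apply π (A p) _ (k, 0)).trans
      (add_zero _)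
  obtain ⟨e, he0, hep, heL, he, hsymm⟩ := exists_flow_box (hB.mono fun _ h => h.1)
    (hB.mono fun _ h => h.2.2) L hL
  have htransverse : (L.symm v).2 ≠ 0 := by
    intro h0
    refine hv (L.symm v).1 ?_
    rw [← hBp, ← hL, ← h0, Prod.mk.eta, L.apply_symm_apply]
  obtain ⟨μ, hμ⟩ := SeparatingDual.exists_eq_one (R := ℝ) htransverse
  let μ' : X × π.ker →L[ℝ] ℝ := μ ∘L .snd ℝ X π.ker
  have hsymm_apply {q} (hq : q ∈ e.source) (h : X × π.ker) :
      fderiv ℝ (μ' ∘ e.symm) (e q) (fderiv ℝ e q h) = μ' h := by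
    have hd := (hsymm _ (e.map_source hq)).differentiableAt (by simp)
    rw [(μ'.hasFDerivAt.comp (e q) hd.hasFDerivAt).fderiv]
    exact congrArg μ' (fderiv_symm_apply_fderiv e hq ((he q hq).1.differentiableAt (by simp)) hd h)
  refine ⟨μ' ∘ e.symm, ?_, ?_⟩
  · filter_upwards [hep ▸ e.open_target.mem_nhds (e.map_source he0), hB] with z hz hBz
    refine ⟨μ'.contDiff.contDiffAt.comp z (hsymm z hz), fun k => ?_⟩
    obtain ⟨m, hm⟩ := hBz.2.1 k
    have hq := e.map_target hz
    have h := hsymm_apply hq (m, 0)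
    rw [(he _ hq).2 m, e.right_inv hz] at h
    rw [hm, h]
    exact μ.map_zero
  · have h := hsymm_apply he0 (L.symm v)
    rw [hep, heL.fderiv] at h
    exact (congrArg _ (L.apply_symm_apply v).symm).trans (h.trans hμ)

end Involutive

/-- The map `c ↦ ∑ a, c a • Y a` given by a family of vectors, turning a frame into an operator so
that coordinates in the frame are obtained by operator inversion. -/
def frameMap {ι E : Type*} [Fintype ι] [NormedAddCommGroup E] [NormedSpace ℝ E] (Y : ι → E) :
    (ι → ℝ) →L[ℝ] E :=
  ∑ a, (ContinuousLinearMap.proj a).smulRight (Y a)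

section Frame

variable {E : Type*} [NormedAddCommGroup E] [NormedSpace ℝ E] {ι : Type*} [Fintype ι]
  {G : Type*} [NormedAddCommGroup G] [NormedSpace ℝ G]

theorem frameMap_apply (Y : ι → E) (c : ι → ℝ) : frameMap Y c = ∑ a, c a • Y a := by
  simp [frameMap]

theorem frameMap_single [DecidableEq ι] (Y : ι → E) (a : ι) :
    frameMap Y (Pi.single a 1) = Y a := by
  simp [frameMap_apply, Pi.single_apply]

theorem frameMap_mem_span (Y : ι → E) (c : ι → ℝ) :
    frameMap Y c ∈ Submodule.span ℝ (Set.range Y) := by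
  rw [frameMap_apply]
  exact Submodule.sum_mem _ fun a _ => Submodule.smul_mem _ _ (Submodule.subset_span ⟨a, rfl⟩)

theorem exists_frameMap_eq {Y : ι → E} {v : E} (hv : v ∈ Submodule.span ℝ (Set.range Y)) :
    ∃ c, frameMap Y c = v := by
  simpa only [frameMap_apply] using (Submodule.mem_span_range_iff_exists_fun ℝ).1 hv

theorem frameMap_injective {Y : ι → E} (hY : LinearIndependent ℝ Y) :
    Function.Injective (frameMap Y) := by
  rw [injective_iff_map_eq_zero]
  intro c hc
  rw [frameMap_apply] at hc
  exact funext (Fintype.linearIndependent_iff.1 hY c hc)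

theorem frameMap_isInvertible [FiniteDimensional ℝ E] {Y : ι → E} (hY : LinearIndependent ℝ Y)
    (hcard : Fintype.card ι = Module.finrank ℝ E) : (frameMap Y).IsInvertible := by
  let e : (ι → ℝ) ≃ₗ[ℝ] E := LinearEquiv.ofInjectiveOfFinrankEq (frameMap Y : (ι → ℝ) →ₗ[ℝ] E)
    (frameMap_injective hY) (by rw [Module.finrank_fintype_fun_eq_card, hcard])
  exact ⟨e.toContinuousLinearEquiv, rfl⟩

theorem hasFDerivAt_frameMap {Y : ι → G → E} {Y' : ι → G →L[ℝ] E} {x : G}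
    (hY : ∀ a, HasFDerivAt (Y a) (Y' a) x) :
    HasFDerivAt (fun y => frameMap (Y · y))
      (∑ a, ContinuousLinearMap.smulRightL ℝ (ι → ℝ) E (ContinuousLinearMap.proj a) ∘L Y' a) x :=
  HasFDerivAt.fun_sum fun a _ => (ContinuousLinearMap.smulRightL ℝ (ι → ℝ) E
    (ContinuousLinearMap.proj a)).hasFDerivAt.comp x (hY a)

theorem contDiffAt_frameMap {Y : ι → G → E} {n : WithTop ℕ∞} {x : G}
    (hY : ∀ a, ContDiffAt ℝ n (Y a) x) : ContDiffAt ℝ n (fun x => frameMap (Y · x)) x :=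
  ContDiffAt.sum fun a _ => ((ContinuousLinearMap.smulRightL ℝ (ι → ℝ) E
    (ContinuousLinearMap.proj a)).contDiff.contDiffAt).comp x (hY a)

theorem contDiffAt_frameMap_inverse {Y : ι → G → E} {n : WithTop ℕ∞} {x : G}
    (hY : ∀ a, ContDiffAt ℝ n (Y a) x) (hx : (frameMap (Y · x)).IsInvertible) :
    ContDiffAt ℝ n (fun x => (frameMap (Y · x)).inverse) x := by
  obtain ⟨A, hA⟩ := hx
  have hinverse := contDiffAt_map_inverse (n := n) A
  rw [hA] at hinverse
  exact hinverse.comp x (contDiffAt_frameMap hY)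

theorem inverse_frameMap_of_mem_span {Y : ι → E} (hY : (frameMap Y).IsInvertible) {S : Set ι}
    {v : E} (hv : v ∈ Submodule.span ℝ (Y '' S)) {l : ι} (hl : l ∉ S) :
    (frameMap Y).inverse v l = 0 := by
  classical
  induction hv using Submodule.span_induction with
  | mem x hx =>
    obtain ⟨a, ha, rfl⟩ := hx
    rw [← frameMap_single Y a, hY.inverse_apply_self,
      Pi.single_eq_of_ne (ne_of_mem_of_not_mem ha hl).symm]
  | zero => simp
  | add x y _ _ hx hy => simp [hx, hy]
  | smul c x _ hx => simp [hx]

theorem fderiv_frameMap_sub_eq_sum_lieBracket {Y : ι → E → E} {x : E}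
    (hY : ∀ a, DifferentiableAt ℝ (Y a) x) (c d : ι → ℝ) :
    fderiv ℝ (fun y => frameMap (Y · y)) x (frameMap (Y · x) c) d -
        fderiv ℝ (fun y => frameMap (Y · y)) x (frameMap (Y · x) d) c =
      ∑ a, ∑ b, (c a * d b) • VectorField.lieBracket ℝ (Y a) (Y b) x := by
  have hfderiv (c d : ι → ℝ) : fderiv ℝ (fun y => frameMap (Y · y)) x (frameMap (Y · x) c) d =
      ∑ a, ∑ b, (c a * d b) • fderiv ℝ (Y b) x (Y a x) := by
    rw [(hasFDerivAt_frameMap fun a => (hY a).hasFDerivAt).fderiv]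
    simp [frameMap_apply, Finset.smul_sum, smul_smul]
  rw [hfderiv, hfderiv, Finset.sum_comm (s := Finset.univ (α := ι)), ← Finset.sum_sub_distrib]
  conv_rhs => rw [Finset.sum_comm]
  simp [VectorField.lieBracket, smul_sub, mul_comm]

omit [Fintype ι] in
theorem exists_first_integral [FiniteDimensional ℝ E] {Y : ι → E → E} {p v : E}
    (hY : ∀ a, ∀ᶠ x in 𝓝 p, ContDiffAt ℝ ∞ (Y a) x) (hindep : LinearIndependent ℝ (Y · p))
    (hinv : ∀ᶠ x in 𝓝 p, ∀ a b,
      VectorField.lieBracket ℝ (Y a) (Y b) x ∈ Submodule.span ℝ (Set.range (Y · x)))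
    (hv : v ∉ Submodule.span ℝ (Set.range (Y · p))) :
    ∃ g : E → ℝ, (∀ᶠ x in 𝓝 p, ContDiffAt ℝ ∞ g x ∧ ∀ a, fderiv ℝ g x (Y a x) = 0) ∧
      fderiv ℝ g p v = 1 := by
  classical
  have := hindep.finite
  have := Fintype.ofFinite ι
  have hYall : ∀ᶠ x in 𝓝 p, ∀ a, ContDiffAt ℝ ∞ (Y a) x := Filter.eventually_all.2 hY
  obtain ⟨π, hπ⟩ := (frameMap (Y · p) : (ι → ℝ) →ₗ[ℝ] E).exists_leftInverse_of_injective
    (LinearMap.ker_eq_bot.2 (frameMap_injective hindep))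
  obtain ⟨g, hg, hgv⟩ := exists_first_integral_of_involutive (π := π.toContinuousLinearMap)
    (hYall.mono fun x hx => contDiffAt_frameMap hx)
    (ContinuousLinearMap.ext fun c => congrArg (· c) hπ) (by
      filter_upwards [hYall, hinv] with x hYx hx c d
      obtain ⟨m, hm⟩ := exists_frameMap_eq <| Submodule.sum_mem _ fun a (_ : a ∈ Finset.univ) =>
        Submodule.sum_mem _ fun b (_ : b ∈ Finset.univ) =>
          Submodule.smul_mem _ (c a * d b) (hx a b)
      exact ⟨m, (fderiv_frameMap_sub_eq_sum_lieBracket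
        (fun a => (hYx a).differentiableAt (by simp)) c d).trans hm.symm⟩)
    (v := v) fun c hc => hv (hc ▸ frameMap_mem_span _ c)
  refine ⟨g, hg.mono fun x hx => ⟨hx.1, fun a => ?_⟩, hgv⟩
  rw [← frameMap_single (Y · x) a]
  exact hx.2 _

end Frame

section OrbitBox

variable {E : Type*} [NormedAddCommGroup E] [NormedSpace ℝ E]

theorem eq_of_forall_fderiv_flow_eq_zero {X : E → E} {J : E → ℝ} {c : ℝ → E} {S : Set ℝ}
    (hS : IsOpen S) (hconn : IsPreconnected S) (hc : ∀ t ∈ S, HasDerivAt c (X (c t)) t)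
    (hJ : ∀ t ∈ S, DifferentiableAt ℝ J (c t) ∧ fderiv ℝ J (c t) (X (c t)) = 0) {t u : ℝ}
    (ht : t ∈ S) (hu : u ∈ S) : J (c t) = J (c u) := by
  have hderiv {t} (ht : t ∈ S) : HasDerivAt (J ∘ c) 0 t :=
    (hJ t ht).2 ▸ (hJ t ht).1.hasFDerivAt.comp_hasDerivAt t (hc t ht)
  exact hS.is_const_of_deriv_eq_zero hconn
    (fun t ht => (hderiv ht).differentiableAt.differentiableWithinAt)
    (fun t ht => (hderiv ht).deriv) ht hu

theorem exists_injOn_of_injective_strictFDeriv {G : Type*} [NormedAddCommGroup G]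
    [NormedSpace ℝ G] [FiniteDimensional ℝ E] [FiniteDimensional ℝ G] {F : E → G} {F' : E →L[ℝ] G}
    {s : E} (hF : HasStrictFDerivAt F F' s) (hinj : Function.Injective F') :
    ∃ U ∈ 𝓝 s, Set.InjOn F U := by
  obtain ⟨π, hπ⟩ := (F' : E →ₗ[ℝ] G).exists_leftInverse_of_injective (LinearMap.ker_eq_bot.2 hinj)
  have hcomp : HasStrictFDerivAt (π.toContinuousLinearMap ∘ F)
      (ContinuousLinearEquiv.refl ℝ E : E →L[ℝ] E) s := by
    refine (π.toContinuousLinearMap.hasStrictFDerivAt.comp s hF).congr_fderiv ?_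
    exact ContinuousLinearMap.ext fun v => congrArg (· v) hπ
  have hsource := (hcomp.toOpenPartialHomeomorph _).injOn
  rw [hcomp.toOpenPartialHomeomorph_coe] at hsource
  exact ⟨_, (hcomp.toOpenPartialHomeomorph _).open_source.mem_nhds
    hcomp.mem_toOpenPartialHomeomorph_source, hsource.of_comp⟩

theorem exists_injOn_slice {ι K : Type*} [Finite ι] [NormedAddCommGroup K] [NormedSpace ℝ K]
    [FiniteDimensional ℝ K] {J : ι → E → ℝ} {f : ℝ × K → E} {L : (ℝ × K) ≃L[ℝ] E}
    (hf : HasStrictFDerivAt f (L : ℝ × K →L[ℝ] E) 0) (hJ : ∀ i, ContDiffAt ℝ 1 (J i) (f 0))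
    (hker : ∀ v, (∀ i, fderiv ℝ (J i) (f 0) v = 0) → v ∈ Submodule.span ℝ {L (1, 0)}) :
    ∃ U ∈ 𝓝 (0 : K), Set.InjOn (fun s i => J i (f (0, s))) U := by
  have := Fintype.ofFinite ι
  let Lslice : K →L[ℝ] E := (L : ℝ × K →L[ℝ] E) ∘L .inr ℝ ℝ K
  have hslice : HasStrictFDerivAt (fun s : K => f (0, s)) Lslice 0 :=
    HasStrictFDerivAt.comp (f := fun s : K => ((0, s) : ℝ × K)) 0 hf
      (ContinuousLinearMap.inr ℝ ℝ K).hasStrictFDerivAt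
  have hJslice : HasStrictFDerivAt (fun s i => J i (f (0, s)))
      (.pi fun i => fderiv ℝ (J i) (f 0) ∘L Lslice) (0 : K) :=
    hasStrictFDerivAt_pi.2 fun i => HasStrictFDerivAt.comp (g := J i) (f := fun s => f (0, s)) 0
      ((hJ i).hasStrictFDerivAt one_ne_zero) hslice
  refine exists_injOn_of_injective_strictFDeriv hJslice ((injective_iff_map_eq_zero _).2 ?_)
  intro s hs
  obtain ⟨c, hc⟩ := Submodule.mem_span_singleton.1 (hker (L (0, s)) fun i => congrFun hs i)
  rw [← map_smul] at hc
  exact (congrArg Prod.snd (L.injective hc)).symm.trans (smul_zero c)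

variable [FiniteDimensional ℝ E]

theorem exists_vectorField_flow_box {X : E → E} {p : E} (hX : ∀ᶠ x in 𝓝 p, ContDiffAt ℝ ∞ X x)
    (hX0 : X p ≠ 0) :
    ∃ (K : Submodule ℝ E) (L : (ℝ × K) ≃L[ℝ] E) (e : OpenPartialHomeomorph (ℝ × K) E),
      0 ∈ e.source ∧ e 0 = p ∧ L (1, 0) = X p ∧ HasStrictFDerivAt e (L : ℝ × K →L[ℝ] E) 0 ∧
      ∀ q ∈ e.source, DifferentiableAt ℝ e q ∧ fderiv ℝ e q (1, 0) = X (e q) := by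
  let B : E → ℝ →L[ℝ] E := fun x => (1 : ℝ →L[ℝ] ℝ).smulRight (X x)
  have hB {x} (hx : ContDiffAt ℝ ∞ X x) : ContDiffAt ℝ ∞ B x :=
    contDiffAt_const.smulRight hx
  have hBderiv {x} (hx : ContDiffAt ℝ ∞ X x) (v : E) (k : ℝ) :
      fderiv ℝ B x v k = k • fderiv ℝ X x v := by
    have hBk : HasFDerivAt (fun y => B y k) (k • fderiv ℝ X x) x :=
      (hx.differentiableAt (by simp)).hasFDerivAt.const_smul k
    have hBx := (((hB hx).differentiableAt (by simp)).hasFDerivAt.clm_apply (hasFDerivAt_const k x))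
    simpa using congrArg (· v) (hBx.unique hBk)
  obtain ⟨π, hπ⟩ := SeparatingDual.exists_eq_one (R := ℝ) hX0
  let L : (ℝ × π.ker) ≃L[ℝ] E := (ContinuousLinearEquiv.equivOfRightInverse π (B p) fun k => by
    simp [B, hπ]).symm
  have hL (k : ℝ) : L (k, 0) = B p k :=
    (ContinuousLinearEquiv.equivOfRightInverse_symm_apply π (B p) _ (k, 0)).trans (add_zero _)
  obtain ⟨e, he0, hep, heL, he, -⟩ := exists_flow_box (hX.mono fun _ => hB)
    (hX.mono fun x hx k l => by simp [hBderiv hx, B, smul_smul, mul_comm]) L hL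
  refine ⟨π.ker, L, e, he0, hep, by simp [hL, B], ?_, fun q hq =>
    ⟨(he q hq).1.differentiableAt (by simp), by simpa [B] using (he q hq).2 1⟩⟩
  exact heL.fderiv ▸ (he 0 he0).1.hasStrictFDerivAt (by simp)

theorem exists_flow_box_of_first_integrals {ι : Type*} [Finite ι] {X : E → E} {J : ι → E → ℝ}
    {p : E} {O : Set E} (hX : ∀ᶠ x in 𝓝 p, ContDiffAt ℝ ∞ X x) (hX0 : X p ≠ 0)
    (hJ : ∀ i, ContDiffAt ℝ 1 (J i) p) (hJX : ∀ᶠ x in 𝓝 p, ∀ i, fderiv ℝ (J i) x (X x) = 0)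
    (hker : ∀ v, (∀ i, fderiv ℝ (J i) p v = 0) → v ∈ Submodule.span ℝ {X p}) (hO : O ∈ 𝓝 p) :
    ∃ (K : Submodule ℝ E) (e : OpenPartialHomeomorph (ℝ × K) E), ∃ ε > 0, e 0 = p ∧
      ∀ t ∈ Metric.ball (0 : ℝ) ε, ∀ s ∈ Metric.ball (0 : K) ε, (t, s) ∈ e.source ∧ e (t, s) ∈ O ∧
        HasDerivAt (fun t => e (t, s)) (X (e (t, s))) t ∧
        ∀ t' ∈ Metric.ball (0 : ℝ) ε, ∀ s' ∈ Metric.ball (0 : K) ε,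
          (∀ i, J i (e (t, s)) = J i (e (t', s'))) ↔ s = s' := by
  obtain ⟨K, L, e, he0, rfl, hL, heL, he⟩ := exists_vectorField_flow_box hX hX0
  obtain ⟨U, hU, hinj⟩ := exists_injOn_slice heL hJ (hL ▸ hker)
  have hgood : ∀ᶠ x in 𝓝 (e 0), x ∈ O ∧
      ∀ i, DifferentiableAt ℝ (J i) x ∧ fderiv ℝ (J i) x (X x) = 0 := by
    filter_upwards [hO, Filter.eventually_all.2 fun i => (hJ i).eventually (by simp), hJX]
      with x hxO hxJ hxJX
    exact ⟨hxO, fun i => ⟨(hxJ i).differentiableAt one_ne_zero, hxJX i⟩⟩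
  have hbox : ∀ᶠ q : ℝ × K in 𝓝 0, q ∈ e.source ∧ q.2 ∈ U ∧ e q ∈ O ∧
      ∀ i, DifferentiableAt ℝ (J i) (e q) ∧ fderiv ℝ (J i) (e q) (X (e q)) = 0 := by
    filter_upwards [e.open_source.mem_nhds he0, continuous_snd.continuousAt.eventually hU,
      (e.continuousAt he0).eventually hgood] with q hq hqU hqG
    exact ⟨hq, hqU, hqG⟩
  obtain ⟨ε, hε, hball⟩ := Metric.eventually_nhds_iff_ball.1 hbox
  have hbox {t} (ht : t ∈ Metric.ball (0 : ℝ) ε) {s} (hs : s ∈ Metric.ball (0 : K) ε) :=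
    hball (t, s) (by rw [← Prod.mk_zero_zero, ← ball_prod_same]; exact ⟨ht, hs⟩)
  have hderiv {t} (ht : t ∈ Metric.ball (0 : ℝ) ε) {s} (hs : s ∈ Metric.ball (0 : K) ε) :
      HasDerivAt (fun t => e (t, s)) (X (e (t, s))) t := by
    obtain ⟨hdiff, hX⟩ := he _ (hbox ht hs).1
    exact hX ▸ HasFDerivAt.comp_hasDerivAt (l := e) (f := fun t => (t, s)) t hdiff.hasFDerivAt
      ((hasDerivAt_id t).prodMk (hasDerivAt_const t s))
  have hconst {t} (ht : t ∈ Metric.ball (0 : ℝ) ε) {s} (hs : s ∈ Metric.ball (0 : K) ε) (i) :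
      J i (e (t, s)) = J i (e (0, s)) :=
    eq_of_forall_fderiv_flow_eq_zero Metric.isOpen_ball (convex_ball 0 ε).isPreconnected
      (fun u hu => hderiv hu hs) (fun u hu => (hbox hu hs).2.2.2 i) ht (Metric.mem_ball_self hε)
  refine ⟨K, e, ε, hε, rfl, fun t ht s hs => ⟨(hbox ht hs).1, (hbox ht hs).2.2.1, hderiv ht hs,
    fun t' ht' s' hs' => ?_⟩⟩
  simp only [hconst ht hs, hconst ht' hs']
  exact ⟨fun h => hinj (hbox ht hs).2.1 (hbox ht' hs').2.1 (funext h), fun h _ => by rw [h]⟩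

theorem exists_orbit_box {ι : Type*} [Finite ι] {X : E → E} {J : ι → E → ℝ} {p : E} {O : Set E}
    (hX : ∀ᶠ x in 𝓝 p, ContDiffAt ℝ ∞ X x) (hX0 : X p ≠ 0) (hJ : ∀ i, ContDiffAt ℝ 1 (J i) p)
    (hJX : ∀ᶠ x in 𝓝 p, ∀ i, fderiv ℝ (J i) x (X x) = 0)
    (hker : ∀ v, (∀ i, fderiv ℝ (J i) p v = 0) → v ∈ Submodule.span ℝ {X p}) (hO : O ∈ 𝓝 p) :
    ∃ O', IsOpen O' ∧ O' ⊆ O ∧ p ∈ O' ∧ ∀ q ∈ O', ∃ (γ : ℝ → E) (α β : ℝ), α < 0 ∧ 0 < β ∧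
      γ 0 = q ∧ (∀ t ∈ Set.Ioo α β, HasDerivAt γ (X (γ t)) t) ∧
      γ '' Set.Ioo α β = {y ∈ O' | ∀ i, J i y = J i q} := by
  obtain ⟨K, e, ε, hε, rfl, hbox⟩ := exists_flow_box_of_first_integrals hX hX0 hJ hJX hker hO
  have hsource : Metric.ball (0 : ℝ) ε ×ˢ Metric.ball (0 : K) ε ⊆ e.source :=
    fun q hq => (hbox q.1 hq.1 q.2 hq.2).1
  refine ⟨e '' (Metric.ball 0 ε ×ˢ Metric.ball 0 ε),
    e.isOpen_image_of_subset_source (Metric.isOpen_ball.prod Metric.isOpen_ball) hsource, ?_,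
    ⟨0, ⟨Metric.mem_ball_self hε, Metric.mem_ball_self hε⟩, rfl⟩, ?_⟩
  · rintro _ ⟨q, hq, rfl⟩
    exact (hbox q.1 hq.1 q.2 hq.2).2.1
  rintro _ ⟨⟨t₀, s⟩, ⟨ht₀, hs⟩, rfl⟩
  have hshift {τ : ℝ} : τ ∈ Set.Ioo (-ε - t₀) (ε - t₀) ↔ τ + t₀ ∈ Metric.ball (0 : ℝ) ε := by
    rw [Real.ball_zero_eq_Ioo]
    exact ⟨fun h => ⟨by linarith [h.1], by linarith [h.2]⟩,
      fun h => ⟨by linarith [h.1], by linarith [h.2]⟩⟩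
  obtain ⟨hneg, hpos⟩ := hshift.2 ((zero_add t₀).symm ▸ ht₀)
  refine ⟨fun τ => e (τ + t₀, s), -ε - t₀, ε - t₀, hneg, hpos, by simp, fun τ hτ => ?_, ?_⟩
  · exact (hbox _ (hshift.1 hτ) s hs).2.2.1.comp_add_const τ t₀
  ext y
  constructor
  · rintro ⟨τ, hτ, rfl⟩
    exact ⟨⟨(τ + t₀, s), ⟨hshift.1 hτ, hs⟩, rfl⟩,
      ((hbox _ (hshift.1 hτ) s hs).2.2.2 t₀ ht₀ s hs).2 rfl⟩
  · rintro ⟨⟨⟨t, s'⟩, ⟨ht, hs'⟩, rfl⟩, hlevel⟩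
    obtain rfl := ((hbox t ht s' hs').2.2.2 t₀ ht₀ s hs).1 hlevel
    exact ⟨t - t₀, hshift.2 (by simpa using ht), by simp⟩

end OrbitBox

/-! ### Coordinate expressions -/

section Charts

variable {E : Type*} [NormedAddCommGroup E] [NormedSpace ℝ E]
  {M : Type*} [TopologicalSpace M] [ChartedSpace E M]

/-- Coordinate expression of a vector field in the preferred chart at `x₀`. -/
def vfInChart (X : VField E M) (x₀ : M) (y : E) : E :=
  VectorField.mpullback 𝓘(ℝ, E) 𝓘(ℝ, E) (extChartAt 𝓘(ℝ, E) x₀).symm X y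

/-- Coordinate expression of a function in the preferred chart at `x₀`. -/
def funInChart (f : M → ℝ) (x₀ : M) (y : E) : ℝ := f ((extChartAt 𝓘(ℝ, E) x₀).symm y)

/-- Derivative at `x` of the preferred chart at `x₀`. -/
def chartDeriv (x₀ x : M) : TangentSpace 𝓘(ℝ, E) x →L[ℝ] E :=
  mfderiv 𝓘(ℝ, E) 𝓘(ℝ, E) (extChartAt 𝓘(ℝ, E) x₀) x

/-- Derivative of the inverse of the preferred chart at `x₀`. -/
def chartSymmDeriv (x₀ : M) (y : E) :
    E →L[ℝ] TangentSpace 𝓘(ℝ, E) ((extChartAt 𝓘(ℝ, E) x₀).symm y) :=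
  mfderiv 𝓘(ℝ, E) 𝓘(ℝ, E) (extChartAt 𝓘(ℝ, E) x₀).symm y

/-- The vector field with prescribed coordinate expression in the preferred chart at `x₀`; its
values outside the domain of the chart are irrelevant. -/
def vfOfChart (x₀ : M) (Y : E → E) : VField E M := fun x =>
  (chartDeriv x₀ x).inverse (Y (extChartAt 𝓘(ℝ, E) x₀ x))

/-- Smoothness of a real function at a point. -/
def SmoothFunAt (f : M → ℝ) (x : M) : Prop := ContMDiffAt 𝓘(ℝ, E) 𝓘(ℝ, ℝ) ∞ f x

/-- Smoothness of a differential form in a neighbourhood of a point. -/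
def SmoothFormNear {k : ℕ} (η : DForm E M k) (x : M) : Prop :=
  ∃ V : Set M, IsOpen V ∧ x ∈ V ∧ SmoothFormOn V η

theorem formInChart_apply {k : ℕ} (η : DForm E M k) (x₀ : M) (y : E) (v : Fin k → E) :
    formInChart η x₀ y v =
      η ((extChartAt 𝓘(ℝ, E) x₀).symm y) (fun i => chartSymmDeriv x₀ y (v i)) := rfl

theorem smoothFunOn_iff {V : Set M} (hV : IsOpen V) {f : M → ℝ} :
    SmoothFunOn (E := E) V f ↔ ∀ x ∈ V, SmoothFunAt (E := E) f x :=
  ⟨fun h _ hx => ContMDiffOn.contMDiffAt h (hV.mem_nhds hx),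
    fun h x hx => (h x hx).contMDiffWithinAt⟩

section Neighbourhoods

variable {x₀ x : M} (hx : x ∈ (extChartAt 𝓘(ℝ, E) x₀).source)
include hx

theorem eventually_chart_symm {P : M → Prop} (h : ∀ᶠ z in 𝓝 x, P z) :
    ∀ᶠ y in 𝓝 (extChartAt 𝓘(ℝ, E) x₀ x), P ((extChartAt 𝓘(ℝ, E) x₀).symm y) := by
  have hcont := continuousAt_extChartAt_symm' (I := 𝓘(ℝ, E)) hx
  rw [ContinuousAt, (extChartAt 𝓘(ℝ, E) x₀).left_inv hx] at hcont
  exact hcont.eventually h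

theorem eventually_target :
    ∀ᶠ y in 𝓝 (extChartAt 𝓘(ℝ, E) x₀ x), y ∈ (extChartAt 𝓘(ℝ, E) x₀).target :=
  (isOpen_extChartAt_target x₀).mem_nhds ((extChartAt 𝓘(ℝ, E) x₀).map_source hx)

theorem eventually_of_chart {P : E → Prop} (h : ∀ᶠ y in 𝓝 (extChartAt 𝓘(ℝ, E) x₀ x), P y) :
    ∀ᶠ z in 𝓝 x, z ∈ (extChartAt 𝓘(ℝ, E) x₀).source ∧ P (extChartAt 𝓘(ℝ, E) x₀ z) :=
  Filter.Eventually.and ((isOpen_extChartAt_source x₀).mem_nhds hx)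
    ((continuousAt_extChartAt' hx).eventually h)

theorem exists_chart_symm_eq :
    ∃ y ∈ (extChartAt 𝓘(ℝ, E) x₀).target, (extChartAt 𝓘(ℝ, E) x₀).symm y = x :=
  ⟨_, (extChartAt 𝓘(ℝ, E) x₀).map_source hx, (extChartAt 𝓘(ℝ, E) x₀).left_inv hx⟩

end Neighbourhoods

section Forms

variable {k : ℕ} {η : DForm E M k} {V : Set M} {x₀ : M}

theorem SmoothFormOn.contDiffAt (h : SmoothFormOn V η) (hV : IsOpen V) {y : E}
    (hy : y ∈ (extChartAt 𝓘(ℝ, E) x₀).target) (hyV : (extChartAt 𝓘(ℝ, E) x₀).symm y ∈ V) :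
    ContDiffAt ℝ ∞ (formInChart η x₀) y :=
  (h x₀).contDiffAt (Filter.inter_mem ((isOpen_extChartAt_target x₀).mem_nhds hy)
    ((continuousAt_extChartAt_symm'' hy).eventually (hV.mem_nhds hyV)))

theorem smoothFormOn_iff (hV : IsOpen V) :
    SmoothFormOn V η ↔ ∀ x₀ : M, ∀ y ∈ (extChartAt 𝓘(ℝ, E) x₀).target,
      (extChartAt 𝓘(ℝ, E) x₀).symm y ∈ V → ContDiffAt ℝ ∞ (formInChart η x₀) y :=
  ⟨fun h _ _ hy hyV => h.contDiffAt hV hy hyV,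
    fun h x₀ y hy => (h x₀ y hy.1 hy.2).contDiffWithinAt⟩

theorem SmoothFormNear.contDiffAt {x : M} (h : SmoothFormNear η x)
    (hx : x ∈ (extChartAt 𝓘(ℝ, E) x₀).source) :
    ContDiffAt ℝ ∞ (formInChart η x₀) (extChartAt 𝓘(ℝ, E) x₀ x) := by
  obtain ⟨V, hV, hxV, h⟩ := h
  refine h.contDiffAt hV ((extChartAt 𝓘(ℝ, E) x₀).map_source hx) ?_
  rwa [(extChartAt 𝓘(ℝ, E) x₀).left_inv hx]

end Forms

variable [IsManifold 𝓘(ℝ, E) ∞ M]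

/-- Smoothness of a vector field at a point. -/
def SmoothVFAt (X : VField E M) (x : M) : Prop :=
  ContMDiffAt 𝓘(ℝ, E) (𝓘(ℝ, E).prod 𝓘(ℝ, E)) ∞
    (fun x => (⟨x, X x⟩ : TangentBundle 𝓘(ℝ, E) M)) x

theorem smoothVFOn_iff {V : Set M} (hV : IsOpen V) {X : VField E M} :
    SmoothVFOn V X ↔ ∀ x ∈ V, SmoothVFAt X x :=
  ⟨fun h _ hx => ContMDiffOn.contMDiffAt h (hV.mem_nhds hx),
    fun h x hx => ContMDiffAt.contMDiffWithinAt (h x hx)⟩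

variable {x₀ x : M} {y : E}

theorem contMDiffAt_chart_symm (hy : y ∈ (extChartAt 𝓘(ℝ, E) x₀).target) :
    ContMDiffAt 𝓘(ℝ, E) 𝓘(ℝ, E) ∞ (extChartAt 𝓘(ℝ, E) x₀).symm y :=
  (contMDiffOn_extChartAt_symm x₀).contMDiffAt ((isOpen_extChartAt_target x₀).mem_nhds hy)

theorem contMDiffAt_chart (hx : x ∈ (extChartAt 𝓘(ℝ, E) x₀).source) :
    ContMDiffAt 𝓘(ℝ, E) 𝓘(ℝ, E) ∞ (extChartAt 𝓘(ℝ, E) x₀) x :=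
  contMDiffAt_extChartAt' (by rwa [← extChartAt_source 𝓘(ℝ, E)])

section ChartDeriv

theorem chartDeriv_isInvertible (hx : x ∈ (extChartAt 𝓘(ℝ, E) x₀).source) :
    (chartDeriv (E := E) x₀ x).IsInvertible :=
  have : IsManifold 𝓘(ℝ, E) 1 M := .of_le (n := ∞) (by simp)
  isInvertible_mfderiv_extChartAt hx

theorem chartSymmDeriv_isInvertible (hy : y ∈ (extChartAt 𝓘(ℝ, E) x₀).target) :
    (chartSymmDeriv x₀ y).IsInvertible := by
  have : IsManifold 𝓘(ℝ, E) 1 M := .of_le (n := ∞) (by simp)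
  have h := isInvertible_mfderivWithin_extChartAt_symm (I := 𝓘(ℝ, E)) hy
  simp only [modelWithCornersSelf_coe, Set.range_id, mfderivWithin_univ] at h
  exact h

theorem chartDeriv_chartSymmDeriv (hy : y ∈ (extChartAt 𝓘(ℝ, E) x₀).target) (v : E) :
    chartDeriv x₀ ((extChartAt 𝓘(ℝ, E) x₀).symm y) (chartSymmDeriv x₀ y v) = v := by
  have : IsManifold 𝓘(ℝ, E) 1 M := .of_le (n := ∞) (by simp)
  have h := mfderiv_extChartAt_comp_mfderivWithin_extChartAt_symm (I := 𝓘(ℝ, E)) hy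
  simp only [modelWithCornersSelf_coe, Set.range_id, mfderivWithin_univ] at h
  exact congrArg (fun A => A v) h

theorem chartSymmDeriv_chartDeriv (hy : y ∈ (extChartAt 𝓘(ℝ, E) x₀).target)
    (v : TangentSpace 𝓘(ℝ, E) ((extChartAt 𝓘(ℝ, E) x₀).symm y)) :
    chartSymmDeriv x₀ y (chartDeriv x₀ ((extChartAt 𝓘(ℝ, E) x₀).symm y) v) = v :=
  (chartDeriv_isInvertible ((extChartAt 𝓘(ℝ, E) x₀).map_target hy)).injective
    (chartDeriv_chartSymmDeriv hy _)

theorem chartSymmDeriv_vfInChart (hy : y ∈ (extChartAt 𝓘(ℝ, E) x₀).target) (X : VField E M) :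
    chartSymmDeriv x₀ y (vfInChart X x₀ y) = X ((extChartAt 𝓘(ℝ, E) x₀).symm y) :=
  (chartSymmDeriv_isInvertible hy).self_apply_inverse _

theorem chartDeriv_vfield (hx : x ∈ (extChartAt 𝓘(ℝ, E) x₀).source) (X : VField E M) :
    chartDeriv x₀ x (X x) = vfInChart X x₀ (extChartAt 𝓘(ℝ, E) x₀ x) := by
  obtain ⟨y, hy, rfl⟩ := exists_chart_symm_eq hx
  rw [(extChartAt 𝓘(ℝ, E) x₀).right_inv hy, ← chartSymmDeriv_vfInChart hy X,
    chartDeriv_chartSymmDeriv hy]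

theorem vfInChart_vfOfChart (hy : y ∈ (extChartAt 𝓘(ℝ, E) x₀).target) (Y : E → E) :
    vfInChart (vfOfChart x₀ Y) x₀ y = Y y := by
  have hx := (extChartAt 𝓘(ℝ, E) x₀).map_target hy
  have h := chartDeriv_vfield hx (vfOfChart x₀ Y)
  rw [vfOfChart, (chartDeriv_isInvertible hx).self_apply_inverse,
    (extChartAt 𝓘(ℝ, E) x₀).right_inv hy] at h
  exact h.symm

theorem formInChart_chartDeriv (hx : x ∈ (extChartAt 𝓘(ℝ, E) x₀).source) {k : ℕ} (η : DForm E M k)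
    (v : Fin k → TangentSpace 𝓘(ℝ, E) x) :
    formInChart η x₀ (extChartAt 𝓘(ℝ, E) x₀ x) (fun i => chartDeriv x₀ x (v i)) = η x v := by
  obtain ⟨y, hy, rfl⟩ := exists_chart_symm_eq hx
  simp only [(extChartAt 𝓘(ℝ, E) x₀).right_inv hy, formInChart_apply, chartSymmDeriv_chartDeriv hy]

theorem dfun_chartSymmDeriv {f : M → ℝ} (hy : y ∈ (extChartAt 𝓘(ℝ, E) x₀).target)
    (hf : SmoothFunAt (E := E) f ((extChartAt 𝓘(ℝ, E) x₀).symm y)) (v : E) :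
    dfun f ((extChartAt 𝓘(ℝ, E) x₀).symm y) (chartSymmDeriv x₀ y v)
      = fderiv ℝ (funInChart f x₀) y v := by
  have hchain := mfderiv_comp y (ContMDiffAt.mdifferentiableAt hf (by simp))
    ((contMDiffAt_chart_symm hy).mdifferentiableAt (by simp))
  exact (congrArg (fun A : E →L[ℝ] ℝ => A v) (mfderiv_eq_fderiv.symm.trans hchain)).symm

theorem fderiv_funInChart_chartDeriv {f : M → ℝ} (hx : x ∈ (extChartAt 𝓘(ℝ, E) x₀).source)
    (hf : SmoothFunAt (E := E) f x) (v : TangentSpace 𝓘(ℝ, E) x) :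
    fderiv ℝ (funInChart f x₀) (extChartAt 𝓘(ℝ, E) x₀ x) (chartDeriv x₀ x v) = dfun f x v := by
  obtain ⟨y, hy, rfl⟩ := exists_chart_symm_eq hx
  rw [(extChartAt 𝓘(ℝ, E) x₀).right_inv hy, ← dfun_chartSymmDeriv hy hf,
    chartSymmDeriv_chartDeriv hy]

theorem dfun_vfield_eq {f : M → ℝ} (hx : x ∈ (extChartAt 𝓘(ℝ, E) x₀).source)
    (hf : SmoothFunAt (E := E) f x) (X : VField E M) :
    dfun f x (X x) = fderiv ℝ (funInChart f x₀) (extChartAt 𝓘(ℝ, E) x₀ x)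
      (vfInChart X x₀ (extChartAt 𝓘(ℝ, E) x₀ x)) := by
  rw [← chartDeriv_vfield hx, fderiv_funInChart_chartDeriv hx hf]

end ChartDeriv

section Smoothness

theorem smoothFunAt_iff {f : M → ℝ} (hx : x ∈ (extChartAt 𝓘(ℝ, E) x₀).source) :
    SmoothFunAt (E := E) f x ↔
      ContDiffAt ℝ ∞ (funInChart f x₀) (extChartAt 𝓘(ℝ, E) x₀ x) := by
  constructor
  · intro hf
    refine contMDiffAt_iff_contDiffAt.1 (ContMDiffAt.comp (g := f) _ ?_
      (contMDiffAt_chart_symm ((extChartAt 𝓘(ℝ, E) x₀).map_source hx)))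
    rwa [(extChartAt 𝓘(ℝ, E) x₀).left_inv hx]
  · intro hf
    have hcomp := (contMDiffAt_iff_contDiffAt.2 hf).comp x (contMDiffAt_chart hx)
    refine hcomp.congr_of_eventuallyEq ?_
    filter_upwards [(isOpen_extChartAt_source (I := 𝓘(ℝ, E)) x₀).mem_nhds hx] with z hz
    exact congrArg f ((extChartAt 𝓘(ℝ, E) x₀).left_inv hz).symm

variable [CompleteSpace E]

theorem smoothVFAt_vfOfChart {Y : E → E} (hx : x ∈ (extChartAt 𝓘(ℝ, E) x₀).source)
    (hY : ContDiffAt ℝ ∞ Y (extChartAt 𝓘(ℝ, E) x₀ x)) : SmoothVFAt (vfOfChart x₀ Y) x :=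
  ContMDiffAt.mpullback_vectorField_preimage (n := ∞)
    (contMDiffAt_vectorSpace_iff_contDiffAt.2 hY) (contMDiffAt_chart hx)
    (chartDeriv_isInvertible (E := E) hx) (by simp)

theorem smoothVFAt_iff {X : VField E M} (hx : x ∈ (extChartAt 𝓘(ℝ, E) x₀).source) :
    SmoothVFAt X x ↔ ContDiffAt ℝ ∞ (vfInChart X x₀) (extChartAt 𝓘(ℝ, E) x₀ x) := by
  constructor
  · intro hX
    obtain ⟨y, hy, rfl⟩ := exists_chart_symm_eq hx
    rw [(extChartAt 𝓘(ℝ, E) x₀).right_inv hy]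
    exact contMDiffAt_vectorSpace_iff_contDiffAt.1
      (ContMDiffAt.mpullback_vectorField_preimage (I := 𝓘(ℝ, E)) (I' := 𝓘(ℝ, E)) (n := ∞)
        hX (contMDiffAt_chart_symm hy) (chartSymmDeriv_isInvertible (E := E) hy) (by simp))
  · intro hX
    refine (smoothVFAt_vfOfChart hx hX).congr_of_eventuallyEq ?_
    filter_upwards [(isOpen_extChartAt_source (I := 𝓘(ℝ, E)) x₀).mem_nhds hx] with z hz
    rw [vfOfChart, ← chartDeriv_vfield hz, (chartDeriv_isInvertible hz).inverse_apply_self]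

theorem vfInChart_mlieBracket {X Y : VField E M} (hx : x ∈ (extChartAt 𝓘(ℝ, E) x₀).source)
    (hX : SmoothVFAt X x) (hY : SmoothVFAt Y x) :
    vfInChart (VectorField.mlieBracket 𝓘(ℝ, E) X Y) x₀ (extChartAt 𝓘(ℝ, E) x₀ x) =
      VectorField.lieBracket ℝ (vfInChart X x₀) (vfInChart Y x₀) (extChartAt 𝓘(ℝ, E) x₀ x) := by
  have hle : minSmoothness ℝ 3 ≤ ∞ := by
    rw [minSmoothness_of_isRCLikeNormedField]; exact ENat.LEInfty.out
  have : IsManifold 𝓘(ℝ, E) (minSmoothness ℝ 3) M := .of_le (n := ∞) hle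
  obtain ⟨y, hy, rfl⟩ := exists_chart_symm_eq hx
  rw [(extChartAt 𝓘(ℝ, E) x₀).right_inv hy]
  refine (VectorField.mpullback_mlieBracket (x₀ := y) (ContMDiffAt.mdifferentiableAt hX (by simp))
    (ContMDiffAt.mdifferentiableAt hY (by simp)) (contMDiffAt_chart_symm hy)
    ((minSmoothness_monotone (by norm_num)).trans hle)).trans ?_
  have hflat := VectorField.mlieBracketWithin_eq_lieBracketWithin (𝕜 := ℝ) (E := E)
    (s := Set.univ) (V := vfInChart X x₀) (W := vfInChart Y x₀)
  rw [VectorField.lieBracketWithin_univ] at hflat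
  exact congrFun hflat y

end Smoothness

end Charts

/-! ### Alternating forms on a normed space -/

section FormCalculus

theorem vec_one {α : Type*} (a : Fin 1 → α) : a = ![a 0] := (FinVec.etaExpand_eq a).symm

theorem vec_two {α : Type*} (a : Fin 2 → α) : a = ![a 0, a 1] := (FinVec.etaExpand_eq a).symm

theorem vec_three {α : Type*} (a : Fin 3 → α) : a = ![a 0, a 1, a 2] :=
  (FinVec.etaExpand_eq a).symm

theorem update_zero_vec_two {α : Type*} (a b c : α) : Function.update ![a, b] 0 c = ![c, b] :=
  vec_two _

theorem update_one_vec_two {α : Type*} (a b c : α) : Function.update ![a, b] 1 c = ![a, c] :=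
  vec_two _

variable {E : Type*} [NormedAddCommGroup E] [NormedSpace ℝ E]
  {G : Type*} [NormedAddCommGroup G] [NormedSpace ℝ G]

theorem form_two_swap {V : Type*} [AddCommGroup V] [Module ℝ V] [TopologicalSpace V]
    (α : V [⋀^Fin 2]→L[ℝ] ℝ) (u v : V) : α ![u, v] = -α ![v, u] := by
  have h : α (![v, u] ∘ Equiv.swap 0 1) = -α ![v, u] := α.map_swap ![v, u] zero_ne_one
  rw [← h, vec_two (![v, u] ∘ _)]
  rfl

theorem contDiffAt_form_apply {k : ℕ} {β : G → E [⋀^Fin k]→L[ℝ] ℝ} {v : Fin k → G → E} {x : G}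
    {n : WithTop ℕ∞} (hβ : ContDiffAt ℝ n β x) (hv : ∀ i, ContDiffAt ℝ n (v i) x) :
    ContDiffAt ℝ n (fun x => β x (fun i => v i x)) x := by
  let T : (E [⋀^Fin k]→L[ℝ] ℝ) →L[ℝ] ContinuousMultilinearMap ℝ (fun _ : Fin k => E) ℝ :=
    ContinuousAlternatingMap.toContinuousMultilinearMapCLM ℝ
  exact (T.analyticAt_uncurry_of_multilinear (x := (β x, fun i => v i x))).contDiffAt.comp x
    (hβ.prodMk (contDiffAt_pi.2 hv))

theorem contDiffAt_form_of_apply [FiniteDimensional ℝ E] {k : ℕ} {β : G → E [⋀^Fin k]→L[ℝ] ℝ}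
    {x : G} {n : WithTop ℕ∞} (h : ∀ v : Fin k → E, ContDiffAt ℝ n (fun x => β x v) x) :
    ContDiffAt ℝ n β x := by
  let b := Module.finBasis ℝ E
  let T : (E [⋀^Fin k]→L[ℝ] ℝ) →ₗ[ℝ] ((Fin k → Fin (Module.finrank ℝ E)) → ℝ) :=
    { toFun := fun f s => f fun i => b (s i)
      map_add' := fun _ _ => rfl
      map_smul' := fun _ _ => rfl }
  have hT : LinearMap.ker T = ⊥ := LinearMap.ker_eq_bot.2 fun f g hfg =>
    ContinuousAlternatingMap.toAlternatingMap_injective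
      (Module.Basis.ext_alternating b fun s _ => congrFun hfg s)
  obtain ⟨L, hL⟩ := T.exists_leftInverse_of_injective hT
  have hTβ : ContDiffAt ℝ n (fun x => T (β x)) x := contDiffAt_pi.2 fun s => h _
  refine ((LinearMap.toContinuousLinearMap L).contDiff.contDiffAt.comp x hTβ).congr_of_eventuallyEq
    (.of_forall fun z => ?_)
  exact (LinearMap.congr_fun hL (β z)).symm

theorem contDiffAt_clm_of_apply [FiniteDimensional ℝ E] {F : Type*} [NormedAddCommGroup F]
    [NormedSpace ℝ F] {A : G → E →L[ℝ] F} {x : G} {n : WithTop ℕ∞}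
    (h : ∀ v, ContDiffAt ℝ n (fun x => A x v) x) : ContDiffAt ℝ n A x := by
  let b := Module.finBasis ℝ E
  have expand : A = fun x => ∑ i, ContinuousLinearMap.smulRightL ℝ E F
      (LinearMap.toContinuousLinearMap (b.coord i)) (A x (b i)) := by
    ext x v
    calc A x v = A x (∑ i, b.repr v i • b i) := by rw [b.sum_repr]
      _ = ∑ i, b.repr v i • A x (b i) := by simp only [map_sum, map_smul]
      _ = _ := by simp
  rw [expand]
  exact ContDiffAt.sum fun i _ => (ContinuousLinearMap.contDiff _).contDiffAt.comp x (h _)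

theorem contDiffAt_of_clm_apply [CompleteSpace E] {F : Type*} [NormedAddCommGroup F]
    [NormedSpace ℝ F] {A : G → E →L[ℝ] F} {X : G → E} {x : G} {n : WithTop ℕ∞}
    (hA : ContDiffAt ℝ n A x) (hinv : (A x).IsInvertible)
    (hAX : ContDiffAt ℝ n (fun z => A z (X z)) x) : ContDiffAt ℝ n X x := by
  obtain ⟨B, hB⟩ := hinv
  have hinverse : ContDiffAt ℝ n (fun z => (A z).inverse) x := by
    have h : ContDiffAt ℝ n ContinuousLinearMap.inverse (B : E →L[ℝ] F) := contDiffAt_map_inverse B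
    rw [hB] at h
    exact h.comp x hA
  refine (hinverse.clm_apply hAX).congr_of_eventuallyEq ?_
  have hnhds : ∀ᶠ z in 𝓝 x, ∃ C : E ≃L[ℝ] F, (C : E →L[ℝ] F) = A z :=
    hA.continuousAt (hB ▸ B.nhds)
  filter_upwards [hnhds] with z hz
  exact (ContinuousLinearMap.IsInvertible.inverse_apply_self hz _).symm

theorem contDiffAt_of_contraction [FiniteDimensional ℝ E] {β : G → E [⋀^Fin 2]→L[ℝ] ℝ}
    {X : G → E} {x : G} {n : WithTop ℕ∞} (hβ : ContDiffAt ℝ n β x)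
    (hnondeg : ∀ v, (∀ w, β x ![v, w] = 0) → v = 0)
    (hX : ∀ w, ContDiffAt ℝ n (fun z => β z ![X z, w]) x) : ContDiffAt ℝ n X x := by
  let b := Module.finBasis ℝ E
  let A : G → E →L[ℝ] (Fin (Module.finrank ℝ E) → ℝ) := fun z =>
    ContinuousLinearMap.pi fun j => (β z).toContinuousLinearMap ![0, b j] 0
  have hA_apply : ∀ z v j, A z v j = β z ![v, b j] := fun z v j =>
    congrArg (β z) (update_zero_vec_two _ _ _)
  have hinj : Function.Injective (A x) := by
    refine (injective_iff_map_eq_zero _).2 fun v hv => hnondeg v fun w => ?_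
    have hcontract : ((β x).toContinuousLinearMap ![v, 0] 1 : E →ₗ[ℝ] ℝ) = 0 := b.ext fun j =>
      (congrArg (β x) (update_one_vec_two _ _ _)).trans
        ((hA_apply x v j).symm.trans (congrFun hv j))
    rw [← update_one_vec_two v 0 w]
    exact LinearMap.congr_fun hcontract w
  have hinv : (A x).IsInvertible :=
    ⟨(LinearEquiv.ofInjectiveOfFinrankEq (A x : E →ₗ[ℝ] _) hinj
      (Module.finrank_fin_fun ℝ).symm).toContinuousLinearEquiv, rfl⟩
  refine contDiffAt_of_clm_apply (A := A) ?_ hinv (contDiffAt_pi.2 fun j => ?_)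
  · refine contDiffAt_clm_of_apply fun v => contDiffAt_pi.2 fun j => ?_
    simp only [hA_apply]
    exact (ContinuousAlternatingMap.apply ℝ E ℝ ![v, b j]).contDiff.contDiffAt.comp x hβ
  · simp only [hA_apply]
    exact hX _

section Derivatives

theorem fderiv_form_apply_const {k : ℕ} {β : E → E [⋀^Fin k]→L[ℝ] ℝ} {x : E}
    (hβ : DifferentiableAt ℝ β x) (v : Fin k → E) (u : E) :
    fderiv ℝ (fun z => β z v) x u = fderiv ℝ β x u v :=
  congrArg (fun A : E →L[ℝ] ℝ => A u)
    ((ContinuousAlternatingMap.apply ℝ E ℝ v).hasFDerivAt.comp x hβ.hasFDerivAt).fderiv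

theorem fderiv_form_two_apply {β : E → E [⋀^Fin 2]→L[ℝ] ℝ} {X Y : E → E} {x : E}
    (hβ : DifferentiableAt ℝ β x) (hX : DifferentiableAt ℝ X x) (hY : DifferentiableAt ℝ Y x)
    (u : E) : fderiv ℝ (fun x => β x ![X x, Y x]) x u =
      fderiv ℝ β x u ![X x, Y x] + β x ![fderiv ℝ X x u, Y x] + β x ![X x, fderiv ℝ Y x u] := by
  have h := fderiv_continuousAlternatingMap_apply_apply (f := β) (g := ![X, Y]) hβ
    (by intro i; fin_cases i <;> simpa) u
  have hvec : ∀ z, (fun i => (![X, Y] : Fin 2 → E → E) i z) = ![X z, Y z] := fun z => vec_two _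
  simp only [hvec] at h
  rw [h]
  simp [Fin.sum_univ_two, update_zero_vec_two, update_one_vec_two, add_assoc]

theorem extDeriv_form_one_apply_const {η : E → E [⋀^Fin 1]→L[ℝ] ℝ} {x : E}
    (hη : DifferentiableAt ℝ η x) (u v : E) :
    extDeriv η x ![u, v] = fderiv ℝ η x u ![v] - fderiv ℝ η x v ![u] := by
  have hremove₀ : (0 : Fin 2).removeNth ![u, v] = ![v] := vec_one _
  have hremove₁ : (1 : Fin 2).removeNth ![u, v] = ![u] := vec_one _
  rw [extDeriv_apply hη, Fin.sum_univ_two, hremove₀, hremove₁]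
  simp [fderiv_form_apply_const hη]
  ring

theorem extDeriv_form_two_apply_const {β : E → E [⋀^Fin 2]→L[ℝ] ℝ} {x : E}
    (hβ : DifferentiableAt ℝ β x) (u v w : E) : extDeriv β x ![u, v, w] =
      fderiv ℝ β x u ![v, w] - fderiv ℝ β x v ![u, w] + fderiv ℝ β x w ![u, v] := by
  have hremove₀ : (0 : Fin 3).removeNth ![u, v, w] = ![v, w] := vec_two _
  have hremove₁ : (1 : Fin 3).removeNth ![u, v, w] = ![u, w] := vec_two _
  have hremove₂ : (2 : Fin 3).removeNth ![u, v, w] = ![u, v] := vec_two _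
  rw [extDeriv_apply hβ, Fin.sum_univ_three, hremove₀, hremove₁, hremove₂]
  simp [fderiv_form_apply_const hβ]
  ring

open VectorField in
theorem extDeriv_form_one_apply {η : E → E [⋀^Fin 1]→L[ℝ] ℝ} {X Y : E → E} {x : E}
    (hη : DifferentiableAt ℝ η x) (hX : DifferentiableAt ℝ X x) (hY : DifferentiableAt ℝ Y x) :
    extDeriv η x ![X x, Y x] = fderiv ℝ (fun x => η x ![Y x]) x (X x)
      - fderiv ℝ (fun x => η x ![X x]) x (Y x) - η x ![lieBracket ℝ X Y x] := by
  have h := extDeriv_apply_vectorField (V := ![X, Y]) hη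
    (by intro i; fin_cases i <;> simpa)
  have hvec : (fun i => (![X, Y] : Fin 2 → E → E) i x) = ![X x, Y x] := vec_two _
  have hremove₀ : ∀ z, (0 : Fin 2).removeNth (fun i => (![X, Y] : Fin 2 → E → E) i z) = ![Y z] :=
    fun z => vec_one _
  have hremove₁ : ∀ z, (1 : Fin 2).removeNth (fun i => (![X, Y] : Fin 2 → E → E) i z) = ![X z] :=
    fun z => vec_one _
  have hcons : ∀ (v : E) (u : Fin 0 → E), Matrix.vecCons v u = ![v] := fun v u => vec_one _
  rw [hvec] at h
  rw [h, Fin.sum_univ_two]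
  simp only [hremove₀, hremove₁]
  simp [hcons]
  ring

variable {β : E → E [⋀^Fin 2]→L[ℝ] ℝ} {θ : E → E [⋀^Fin 1]→L[ℝ] ℝ} {x : E}

theorem fderiv_contact {f : E → ℝ} {X : E → E}
    (hβ : DifferentiableAt ℝ β x) (hθ : DifferentiableAt ℝ θ x)
    (hf : ContDiffAt ℝ 2 f x) (hX : DifferentiableAt ℝ X x)
    (hXf : ∀ᶠ z in 𝓝 x, ∀ w, β z ![X z, w] = fderiv ℝ f z w - f z * θ z ![w]) (u w : E) :
    fderiv ℝ β x u ![X x, w] + β x ![fderiv ℝ X x u, w] = fderiv ℝ (fderiv ℝ f) x u w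
      - (fderiv ℝ f x u * θ x ![w] + f x * fderiv ℝ θ x u ![w]) := by
  have hleft : fderiv ℝ (fun z => β z ![X z, w]) x u =
      fderiv ℝ β x u ![X x, w] + β x ![fderiv ℝ X x u, w] := by
    have hzero : β x ![X x, (0 : E)] = 0 := (β x).map_coord_zero 1 rfl
    simpa [hzero] using fderiv_form_two_apply hβ hX (differentiableAt_const w) u
  have hdf : HasFDerivAt (fun z => fderiv ℝ f z w)
      ((ContinuousLinearMap.apply ℝ ℝ w) ∘L fderiv ℝ (fderiv ℝ f) x) x :=
    (ContinuousLinearMap.apply ℝ ℝ w).hasFDerivAt.comp x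
      ((hf.fderiv_right (m := 1) (by norm_num)).differentiableAt one_ne_zero).hasFDerivAt
  have hθw : HasFDerivAt (fun z => θ z ![w])
      ((ContinuousAlternatingMap.apply ℝ E ℝ ![w]) ∘L fderiv ℝ θ x) x :=
    (ContinuousAlternatingMap.apply ℝ E ℝ ![w]).hasFDerivAt.comp x hθ.hasFDerivAt
  have hright := (hdf.sub ((hf.differentiableAt two_ne_zero).hasFDerivAt.mul hθw)).fderiv
  rw [← hleft, Filter.EventuallyEq.fderiv_eq (hXf.mono fun z hz => hz w)]
  refine (congrArg (fun A => A u) hright).trans ?_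
  simp only [sub_apply, add_apply, smul_apply, smul_eq_mul, ContinuousLinearMap.comp_apply,
    ContinuousLinearMap.apply_apply, ContinuousAlternatingMap.apply_apply]
  ring

open VectorField in
/-- With `X ⌟ β = df - f θ`, `Y ⌟ β = dg - g θ`, `dθ = 0` and `dβ = θ ∧ β`, the conclusion reads
`[X, Y] ⌟ β = dh - h θ` for `h = β(Y, X)`. -/
theorem lieBracket_contact {f g : E → ℝ} {X Y : E → E}
    (hβ : DifferentiableAt ℝ β x) (hθ : DifferentiableAt ℝ θ x)
    (hf : ContDiffAt ℝ 2 f x) (hg : ContDiffAt ℝ 2 g x)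
    (hX : DifferentiableAt ℝ X x) (hY : DifferentiableAt ℝ Y x)
    (hdθ : extDeriv θ x = 0)
    (hdβ : ∀ u v w, extDeriv β x ![u, v, w] =
      θ x ![u] * β x ![v, w] - θ x ![v] * β x ![u, w] + θ x ![w] * β x ![u, v])
    (hXf : ∀ᶠ z in 𝓝 x, ∀ w, β z ![X z, w] = fderiv ℝ f z w - f z * θ z ![w])
    (hYg : ∀ᶠ z in 𝓝 x, ∀ w, β z ![Y z, w] = fderiv ℝ g z w - g z * θ z ![w]) (w : E) :
    β x ![lieBracket ℝ X Y x, w] = fderiv ℝ (fun z => β z ![Y z, X z]) x w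
      - β x ![Y x, X x] * θ x ![w] := by
  have hsymm : ∀ {f : E → ℝ}, ContDiffAt ℝ 2 f x → ∀ u v,
      fderiv ℝ (fderiv ℝ f) x u v = fderiv ℝ (fderiv ℝ f) x v u := fun hf u v =>
    (hf.isSymmSndFDerivAt (by simp)).eq u v
  have hθsymm : ∀ u v, fderiv ℝ θ x u ![v] = fderiv ℝ θ x v ![u] := fun u v => by
    have h := extDeriv_form_one_apply_const hθ u v
    rw [hdθ] at h
    exact sub_eq_zero.1 h.symm
  have hbracket : β x ![lieBracket ℝ X Y x, w] =
      β x ![fderiv ℝ Y x (X x), w] - β x ![fderiv ℝ X x (Y x), w] := by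
    have h := (β x).map_update_sub ![0, w] 0 (fderiv ℝ Y x (X x)) (fderiv ℝ X x (Y x))
    simp only [update_zero_vec_two] at h
    exact h
  have hdβXY := (hdβ (X x) (Y x) w).symm.trans (extDeriv_form_two_apply_const hβ (X x) (Y x) w)
  have hXY := fderiv_contact hβ hθ hf hX hXf (Y x) w
  have hYX := fderiv_contact hβ hθ hg hY hYg (X x) w
  rw [hXf.self_of_nhds w, hYg.self_of_nhds w] at hdβXY
  rw [hsymm hf (Y x) w, hθsymm (Y x) w] at hXY
  rw [hsymm hg (X x) w, hθsymm (X x) w] at hYX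
  rw [hbracket, fderiv_form_two_apply hβ hY hX]
  linear_combination hYX - hXY - fderiv_contact hβ hθ hg hY hYg w (X x)
    + fderiv_contact hβ hθ hf hX hXf w (Y x) + hdβXY - form_two_swap (β x) (Y x) (fderiv ℝ X x w)
    + θ x ![w] * hYg.self_of_nhds (X x) - θ x ![w] * hXf.self_of_nhds (Y x)

end Derivatives

end FormCalculus

/-! ### Differential forms in coordinates -/

section FormsInChart

variable {E : Type*} [NormedAddCommGroup E] [NormedSpace ℝ E]
  {M : Type*} [TopologicalSpace M] [ChartedSpace E M] {x₀ x : M}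

theorem dForm_one_eq_extDeriv (η : DForm E M 1) (u v : TangentSpace 𝓘(ℝ, E) x) :
    dForm η x ![u, v] = extDeriv (formInChart η x) (extChartAt 𝓘(ℝ, E) x x)
      ![chartDeriv x x u, chartDeriv x x v] :=
  congrArg (extDeriv (formInChart η x) _) (vec_two _)

theorem dForm_two_eq_extDeriv (η : DForm E M 2) (u v w : TangentSpace 𝓘(ℝ, E) x) :
    dForm η x ![u, v, w] = extDeriv (formInChart η x) (extChartAt 𝓘(ℝ, E) x x)
      ![chartDeriv x x u, chartDeriv x x v, chartDeriv x x w] :=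
  congrArg (extDeriv (formInChart η x) _) (vec_three _)

variable [IsManifold 𝓘(ℝ, E) ∞ M]

theorem formInChart_one_chartDeriv (η : DForm E M 1) (hx : x ∈ (extChartAt 𝓘(ℝ, E) x₀).source)
    (v : TangentSpace 𝓘(ℝ, E) x) :
    formInChart η x₀ (extChartAt 𝓘(ℝ, E) x₀ x) ![chartDeriv x₀ x v] = η x ![v] := by
  rw [← formInChart_chartDeriv hx, vec_one fun _ => chartDeriv x₀ x _]
  rfl

theorem formInChart_two_chartDeriv (η : DForm E M 2) (hx : x ∈ (extChartAt 𝓘(ℝ, E) x₀).source)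
    (v w : TangentSpace 𝓘(ℝ, E) x) :
    formInChart η x₀ (extChartAt 𝓘(ℝ, E) x₀ x) ![chartDeriv x₀ x v, chartDeriv x₀ x w] =
      η x ![v, w] := by
  rw [← formInChart_chartDeriv hx, vec_two fun _ => chartDeriv x₀ x _]
  rfl

theorem eventually_funInChart_form_one (η : DForm E M 1) (X : VField E M)
    (hx : x ∈ (extChartAt 𝓘(ℝ, E) x₀).source) :
    funInChart (fun x => η x ![X x]) x₀ =ᶠ[𝓝 (extChartAt 𝓘(ℝ, E) x₀ x)]
      fun y => formInChart η x₀ y ![vfInChart X x₀ y] := by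
  filter_upwards [eventually_target hx] with y hy
  have h := formInChart_one_chartDeriv η ((extChartAt 𝓘(ℝ, E) x₀).map_target hy) (X _)
  rw [chartDeriv_vfield ((extChartAt 𝓘(ℝ, E) x₀).map_target hy),
    (extChartAt 𝓘(ℝ, E) x₀).right_inv hy] at h
  exact h.symm

theorem eventually_funInChart_form_two (η : DForm E M 2) (X Y : VField E M)
    (hx : x ∈ (extChartAt 𝓘(ℝ, E) x₀).source) :
    funInChart (fun x => η x ![X x, Y x]) x₀ =ᶠ[𝓝 (extChartAt 𝓘(ℝ, E) x₀ x)]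
      fun y => formInChart η x₀ y ![vfInChart X x₀ y, vfInChart Y x₀ y] := by
  filter_upwards [eventually_target hx] with y hy
  have h := formInChart_two_chartDeriv η ((extChartAt 𝓘(ℝ, E) x₀).map_target hy) (X _) (Y _)
  rw [chartDeriv_vfield ((extChartAt 𝓘(ℝ, E) x₀).map_target hy),
    chartDeriv_vfield ((extChartAt 𝓘(ℝ, E) x₀).map_target hy),
    (extChartAt 𝓘(ℝ, E) x₀).right_inv hy] at h
  exact h.symm

variable [CompleteSpace E] {X Y : VField E M}

theorem SmoothFormNear.smoothFunAt_one {η : DForm E M 1} (hη : SmoothFormNear η x)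
    (hX : SmoothVFAt X x) : SmoothFunAt (E := E) (fun x => η x ![X x]) x := by
  have hx := mem_extChartAt_source (I := 𝓘(ℝ, E)) x
  have h := contDiffAt_form_apply (v := fun _ : Fin 1 => vfInChart X x) (hη.contDiffAt hx)
    fun _ => (smoothVFAt_iff hx).1 hX
  simp only [vec_one fun _ : Fin 1 => vfInChart X x _] at h
  exact (smoothFunAt_iff hx).2 (h.congr_of_eventuallyEq (eventually_funInChart_form_one η X hx))

theorem SmoothFormNear.smoothFunAt_two {η : DForm E M 2} (hη : SmoothFormNear η x)
    (hX : SmoothVFAt X x) (hY : SmoothVFAt Y x) :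
    SmoothFunAt (E := E) (fun x => η x ![X x, Y x]) x := by
  have hx := mem_extChartAt_source (I := 𝓘(ℝ, E)) x
  have h := contDiffAt_form_apply (v := ![vfInChart X x, vfInChart Y x]) (hη.contDiffAt hx)
    (Fin.forall_fin_two.2 ⟨(smoothVFAt_iff hx).1 hX, (smoothVFAt_iff hx).1 hY⟩)
  simp only [vec_two fun i => (![vfInChart X x, vfInChart Y x] : Fin 2 → E → E) i _] at h
  exact (smoothFunAt_iff hx).2 (h.congr_of_eventuallyEq (eventually_funInChart_form_two η X Y hx))

theorem dForm_one_apply {η : DForm E M 1} (hη : SmoothFormNear η x) (hX : SmoothVFAt X x)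
    (hY : SmoothVFAt Y x) :
    dForm η x ![X x, Y x] = dfun (fun x => η x ![Y x]) x (X x)
      - dfun (fun x => η x ![X x]) x (Y x)
      - η x ![VectorField.mlieBracket 𝓘(ℝ, E) X Y x] := by
  have hx := mem_extChartAt_source (I := 𝓘(ℝ, E)) x
  rw [dForm_one_eq_extDeriv, dfun_vfield_eq hx (hη.smoothFunAt_one hY),
    dfun_vfield_eq hx (hη.smoothFunAt_one hX), ← formInChart_one_chartDeriv η hx,
    chartDeriv_vfield hx, chartDeriv_vfield hx, chartDeriv_vfield hx,
    vfInChart_mlieBracket hx hX hY, (eventually_funInChart_form_one η X hx).fderiv_eq,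
    (eventually_funInChart_form_one η Y hx).fderiv_eq]
  exact extDeriv_form_one_apply ((hη.contDiffAt hx).differentiableAt (by simp))
    (((smoothVFAt_iff hx).1 hX).differentiableAt (by simp))
    (((smoothVFAt_iff hx).1 hY).differentiableAt (by simp))

end FormsInChart

/-! ### Hamiltonian vector fields -/

section Hamiltonian

variable {E : Type*} [NormedAddCommGroup E] [NormedSpace ℝ E]
  {M : Type*} [TopologicalSpace M] [ChartedSpace E M]

namespace LCS

variable (S : LCS E M) {f g : M → ℝ} {x₀ x : M} {y : E}

theorem smoothFormNear_form (x : M) : SmoothFormNear S.form x :=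
  ⟨Set.univ, isOpen_univ, trivial, S.smooth_form⟩

theorem smoothFormNear_lee (x : M) : SmoothFormNear S.lee x :=
  ⟨Set.univ, isOpen_univ, trivial, S.smooth_lee⟩

section Chart

variable [IsManifold 𝓘(ℝ, E) ∞ M]

theorem nondegenerate_inChart (hx : x ∈ (extChartAt 𝓘(ℝ, E) x₀).source) {v : E}
    (h : ∀ w, formInChart S.form x₀ (extChartAt 𝓘(ℝ, E) x₀ x) ![v, w] = 0) : v = 0 := by
  obtain ⟨u, rfl⟩ := (chartDeriv_isInvertible (E := E) hx).surjective v
  have hu : u = 0 := S.nondegenerate x u fun w =>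
    (formInChart_two_chartDeriv S.form hx u w).symm.trans (h _)
  rw [hu, map_zero]

theorem extDeriv_lee_inChart (x : M) :
    extDeriv (formInChart S.lee x) (extChartAt 𝓘(ℝ, E) x x) = 0 := by
  ext v
  choose u hu using fun i => (chartDeriv_isInvertible (E := E)
    (mem_extChartAt_source x)).surjective (v i)
  obtain rfl : (fun i => chartDeriv x x (u i)) = v := funext hu
  exact congrArg (fun η => η u) (S.closed_lee x)

theorem extDeriv_form_inChart (x : M) (u v w : E) :
    extDeriv (formInChart S.form x) (extChartAt 𝓘(ℝ, E) x x) ![u, v, w] =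
      formInChart S.lee x (extChartAt 𝓘(ℝ, E) x x) ![u] *
          formInChart S.form x (extChartAt 𝓘(ℝ, E) x x) ![v, w]
        - formInChart S.lee x (extChartAt 𝓘(ℝ, E) x x) ![v] *
          formInChart S.form x (extChartAt 𝓘(ℝ, E) x x) ![u, w]
        + formInChart S.lee x (extChartAt 𝓘(ℝ, E) x x) ![w] *
          formInChart S.form x (extChartAt 𝓘(ℝ, E) x x) ![u, v] := by
  have hx := mem_extChartAt_source (I := 𝓘(ℝ, E)) x
  have hsurj := (chartDeriv_isInvertible (E := E) hx).surjective
  obtain ⟨u, rfl⟩ := hsurj u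
  obtain ⟨v, rfl⟩ := hsurj v
  obtain ⟨w, rfl⟩ := hsurj w
  simp only [formInChart_one_chartDeriv _ hx, formInChart_two_chartDeriv _ hx]
  rw [← dForm_two_eq_extDeriv, S.d_form]

end Chart

variable [FiniteDimensional ℝ E]

theorem ham_unique {v : TangentSpace 𝓘(ℝ, E) x}
    (h : ∀ w, S.form x ![v, w] = dfun f x w - f x * S.lee x ![w]) : v = S.jacobi.ham f x := by
  refine (S.flatMap_bijective x).1 (ContinuousLinearMap.ext fun w => ?_)
  rw [flatMap_apply, flatMap_apply, h, ham_spec]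

theorem form_reeb (x : M) (w : TangentSpace 𝓘(ℝ, E) x) :
    S.form x ![S.jacobi.reeb x, w] = -S.lee x ![w] := by
  have h : S.flat x (S.jacobi.reeb x) =
      -(ContinuousAlternatingMap.ofSubsingleton ℝ _ ℝ (0 : Fin 1)).symm (S.lee x) := by
    simp [jacobi]
  rw [← flatMap_apply]
  exact (congrArg (fun α => α w) h).trans (congrArg (fun v => -S.lee x v) (vec_one fun _ => w))

theorem bracket_eq (f g : M → ℝ) (x : M) :
    S.jacobi.bracket f g x = S.form x ![S.jacobi.ham g x, S.jacobi.ham f x] := by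
  have lee_reeb : S.lee x ![S.jacobi.reeb x] = 0 := by
    linarith [S.form_reeb x (S.jacobi.reeb x),
      form_two_swap (S.form x) (S.jacobi.reeb x) (S.jacobi.reeb x)]
  have lee_ham : S.lee x ![S.jacobi.ham f x] = dfun f x (S.jacobi.reeb x) := by
    have h := S.ham_spec f x (S.jacobi.reeb x)
    rw [lee_reeb, form_two_swap, form_reeb] at h
    linarith
  rw [ham_spec, lee_ham]
  simp only [BivectorPair.bracket, BivectorPair.bivector, BivectorPair.ham, map_add, map_smul,
    smul_eq_mul]

variable [IsManifold 𝓘(ℝ, E) ∞ M]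

theorem eventually_ham_spec_inChart (hx : x ∈ (extChartAt 𝓘(ℝ, E) x₀).source)
    (hf : ∀ᶠ z in 𝓝 x, SmoothFunAt (E := E) f z) :
    ∀ᶠ y in 𝓝 (extChartAt 𝓘(ℝ, E) x₀ x), ∀ w,
      formInChart S.form x₀ y ![vfInChart (S.jacobi.ham f) x₀ y, w] =
        fderiv ℝ (funInChart f x₀) y w - funInChart f x₀ y * formInChart S.lee x₀ y ![w] := by
  filter_upwards [eventually_target hx, eventually_chart_symm hx hf] with y hy hfy w
  have hz := (extChartAt 𝓘(ℝ, E) x₀).map_target hy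
  obtain ⟨v, rfl⟩ := (chartDeriv_isInvertible (E := E) hz).surjective w
  have h := S.ham_spec f _ v
  rw [← formInChart_two_chartDeriv _ hz, ← formInChart_one_chartDeriv _ hz, chartDeriv_vfield hz,
    ← fderiv_funInChart_chartDeriv hz hfy, (extChartAt 𝓘(ℝ, E) x₀).right_inv hy] at h
  exact h

theorem smoothVFAt_ham (hf : ∀ᶠ z in 𝓝 x, SmoothFunAt (E := E) f z) :
    SmoothVFAt (S.jacobi.ham f) x := by
  have hx := mem_extChartAt_source (I := 𝓘(ℝ, E)) x
  have hfx := (smoothFunAt_iff hx).1 hf.self_of_nhds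
  refine (smoothVFAt_iff hx).2 (contDiffAt_of_contraction
    ((S.smoothFormNear_form x).contDiffAt hx) (fun v => S.nondegenerate_inChart hx) fun w => ?_)
  have hdf : ContDiffAt ℝ ∞ (fun y => fderiv ℝ (funInChart f x) y w) (extChartAt 𝓘(ℝ, E) x x) :=
    (ContinuousLinearMap.apply ℝ ℝ w).contDiff.contDiffAt.comp _ (hfx.fderiv_right (by simp))
  have hlee : ContDiffAt ℝ ∞ (fun y => formInChart S.lee x y ![w]) (extChartAt 𝓘(ℝ, E) x x) :=
    (ContinuousAlternatingMap.apply ℝ E ℝ ![w]).contDiff.contDiffAt.comp _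
      ((S.smoothFormNear_lee x).contDiffAt hx)
  exact (hdf.sub (hfx.mul hlee)).congr_of_eventuallyEq
    ((S.eventually_ham_spec_inChart hx hf).mono fun y hy => hy w)

theorem mlieBracket_ham (hf : ∀ᶠ z in 𝓝 x, SmoothFunAt (E := E) f z)
    (hg : ∀ᶠ z in 𝓝 x, SmoothFunAt (E := E) g z) :
    VectorField.mlieBracket 𝓘(ℝ, E) (S.jacobi.ham f) (S.jacobi.ham g) x =
      S.jacobi.ham (S.jacobi.bracket f g) x := by
  have hx := mem_extChartAt_source (I := 𝓘(ℝ, E)) x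
  have hXf := S.smoothVFAt_ham hf
  have hXg := S.smoothVFAt_ham hg
  have two_le : (2 : WithTop ℕ∞) ≤ ∞ := ENat.LEInfty.out
  have hbracket : S.jacobi.bracket f g =
      fun z => S.form z ![S.jacobi.ham g z, S.jacobi.ham f z] := funext (S.bracket_eq f g)
  have hsmooth : SmoothFunAt (E := E) (S.jacobi.bracket f g) x := by
    rw [hbracket]
    exact (S.smoothFormNear_form x).smoothFunAt_two hXg hXf
  refine S.ham_unique fun w => ?_
  have hcontact := lieBracket_contact
    (((S.smoothFormNear_form x).contDiffAt hx).differentiableAt (by simp))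
    (((S.smoothFormNear_lee x).contDiffAt hx).differentiableAt (by simp))
    (((smoothFunAt_iff hx).1 hf.self_of_nhds).of_le two_le)
    (((smoothFunAt_iff hx).1 hg.self_of_nhds).of_le two_le)
    (((smoothVFAt_iff hx).1 hXf).differentiableAt (by simp))
    (((smoothVFAt_iff hx).1 hXg).differentiableAt (by simp))
    (S.extDeriv_lee_inChart x) (S.extDeriv_form_inChart x)
    (S.eventually_ham_spec_inChart hx hf) (S.eventually_ham_spec_inChart hx hg) (chartDeriv x x w)
  rw [← vfInChart_mlieBracket hx hXf hXg,
    ← (eventually_funInChart_form_two S.form _ _ hx).fderiv_eq, ← hbracket,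
    fderiv_funInChart_chartDeriv hx hsmooth, ← chartDeriv_vfield hx, ← chartDeriv_vfield hx,
    ← chartDeriv_vfield hx, formInChart_two_chartDeriv _ hx, formInChart_two_chartDeriv _ hx,
    formInChart_one_chartDeriv _ hx, ← bracket_eq] at hcontact
  exact hcontact

end LCS

end Hamiltonian

/-! ### The frame of a Jacobi structure -/

section Frame

variable {E : Type*} [NormedAddCommGroup E] [NormedSpace ℝ E]
  {M : Type*} [TopologicalSpace M] [ChartedSpace E M]

/-- A frame `Y₀, …, Y_{m-1}` on the open set `V` such that `Y₀, …, Y_b` span an involutive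
distribution for each `b`. -/
structure TriangularFrame [IsManifold 𝓘(ℝ, E) ∞ M] {m : ℕ} (V : Set M) (Y : Fin m → VField E M) :
    Prop where
  isOpen : IsOpen V
  finrank_eq : Module.finrank ℝ E = m
  smooth : ∀ a, SmoothVFOn V (Y a)
  independent : ∀ x ∈ V, LinearIndependent ℝ (fun a => Y a x)
  bracket : ∀ x ∈ V, ∀ a b, a < b → VectorField.mlieBracket 𝓘(ℝ, E) (Y a) (Y b) x ∈
    Submodule.span ℝ ((fun c => Y c x) '' Set.Iic b)

theorem span_range_eq_top [FiniteDimensional ℝ E] {m : ℕ} (hE : Module.finrank ℝ E = m) {x : M}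
    {v : Fin m → TangentSpace 𝓘(ℝ, E) x} (hv : LinearIndependent ℝ v) :
    Submodule.span ℝ (Set.range v) = ⊤ :=
  have : FiniteDimensional ℝ (TangentSpace 𝓘(ℝ, E) x) := ‹FiniteDimensional ℝ E›
  hv.span_eq_top_of_card_eq_finrank' ((Fintype.card_fin m).trans hE.symm)

theorem snoc_vfield_apply {n : ℕ} (X : Fin n → VField E M) (R : VField E M) (x : M) :
    (fun a => (Fin.snoc (α := fun _ => VField E M) X R : Fin (n + 1) → VField E M) a x) =
      Fin.snoc (α := fun _ => TangentSpace 𝓘(ℝ, E) x) (fun k => X k x) (R x) := by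
  funext a
  refine Fin.lastCases ?_ (fun k => ?_) a <;> simp only [Fin.snoc_last, Fin.snoc_castSucc]

theorem snoc_vfield_image_Iic_castSucc {n : ℕ} (X : Fin n → VField E M) (R : VField E M) (j : Fin n)
    (x : M) :
    (fun a => (Fin.snoc (α := fun _ => VField E M) X R : Fin (n + 1) → VField E M) a x) ''
      Set.Iic j.castSucc = (fun k => X k x) '' Set.Iic j := by
  rw [← Fin.image_castSucc_Iic, Set.image_image]
  simp only [Fin.snoc_castSucc]

theorem BivectorPair.snoc_ham_cons (J : BivectorPair E M) {N : ℕ} (H : M → ℝ) (F : Fin N → M → ℝ)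
    (R : VField E M) :
    (Fin.snoc (α := fun _ => VField E M)
        (fun k : Fin (N + 1) => J.ham ((Fin.cons H F : Fin (N + 1) → M → ℝ) k)) R :
      Fin (N + 1 + 1) → VField E M) =
      Fin.cons (J.ham H) (Fin.snoc (α := fun _ => VField E M) (fun j => J.ham (F j)) R) := by
  rw [Fin.cons_snoc_eq_snoc_cons]
  congr 1
  funext k
  refine Fin.cases ?_ (fun j => ?_) k <;> rfl

variable [IsManifold 𝓘(ℝ, E) ∞ M]

theorem dfun_comp_pi {κ : Type*} [Fintype κ] [DecidableEq κ] {G : (κ → ℝ) → ℝ} {f : κ → M → ℝ}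
    {x : M} (hG : ContDiff ℝ ∞ G) (hf : ∀ k, SmoothFunAt (E := E) (f k) x) :
    dfun (E := E) (fun z => G fun k => f k z) x =
      ∑ k, fderiv ℝ G (fun k => f k x) (Pi.single k 1) • dfun (f k) x := by
  have hx := mem_extChartAt_source (I := 𝓘(ℝ, E)) x
  have hf' k := (smoothFunAt_iff hx).1 (hf k)
  have hGf : SmoothFunAt (E := E) (fun z => G fun k => f k z) x :=
    (smoothFunAt_iff hx).2 (hG.contDiffAt.comp _ (contDiffAt_pi.2 hf'))
  have hval : (fun k => funInChart (f k) x (extChartAt 𝓘(ℝ, E) x x)) = fun k => f k x :=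
    funext fun k => congrArg (f k) (extChartAt_to_inv x)
  have chain_rule : HasFDerivAt (funInChart (fun z => G fun k => f k z) x)
      ((fderiv ℝ G fun k => f k x).comp
        (.pi fun k => fderiv ℝ (funInChart (f k) x) (extChartAt 𝓘(ℝ, E) x x)))
      (extChartAt 𝓘(ℝ, E) x x) := by
    rw [← hval]
    exact (hG.differentiable (by simp)).differentiableAt.hasFDerivAt.comp _
      (hasFDerivAt_pi.2 fun k => ((hf' k).differentiableAt (by simp)).hasFDerivAt)
  ext v
  rw [← fderiv_funInChart_chartDeriv hx hGf, chain_rule.fderiv, sum_apply,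
    ContinuousLinearMap.comp_apply, pi_eq_sum_univ' (ContinuousLinearMap.pi _ _), map_sum]
  refine Finset.sum_congr rfl fun k _ => ?_
  rw [map_smul, smul_apply, ← fderiv_funInChart_chartDeriv hx (hf k), smul_eq_mul, smul_eq_mul,
    mul_comm]
  rfl

theorem BivectorPair.ham_comp (J : BivectorPair E M) {κ : Type*} [Fintype κ] [DecidableEq κ]
    {G : (κ → ℝ) → ℝ} {f : κ → M → ℝ} {x : M} (hG : ContDiff ℝ ∞ G)
    (hf : ∀ k, SmoothFunAt (E := E) (f k) x) :
    J.ham (fun z => G fun k => f k z) x =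
      (∑ k, fderiv ℝ G (fun k => f k x) (Pi.single k 1) • J.ham (f k) x) +
      (G (fun k => f k x) - ∑ k, f k x * fderiv ℝ G (fun k => f k x) (Pi.single k 1)) •
        J.reeb x := by
  simp only [BivectorPair.ham, dfun_comp_pi hG hf, map_sum, map_smul, smul_add,
    Finset.sum_add_distrib, sub_smul, Finset.sum_smul, smul_smul, mul_comm (f _ x)]
  abel

namespace IsJacobiCInfStructure

variable {N : ℕ} {H : M → ℝ} {F : Fin N → M → ℝ} {U : Set M} {x : M}

theorem smoothFunAt_cons {J : BivectorPair E M} (hF : IsJacobiCInfStructure J H F U)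
    (hH : SmoothFunOn (E := E) Set.univ H) (k : Fin (N + 1)) (x : M) :
    SmoothFunAt (E := E) ((Fin.cons H F : Fin (N + 1) → M → ℝ) k) x :=
  Fin.cases ((smoothFunOn_iff isOpen_univ).1 hH x trivial)
    (fun j => (smoothFunOn_iff isOpen_univ).1 (hF.smooth j) x trivial) k

variable [FiniteDimensional ℝ E] {S : LCS E M}

/-- `[X_{f_j}, X_{f_i}] = X_{G (f₀, …, f_j)}`, whose Reeb component is controlled by the Reeb
compatibility condition. -/
theorem mlieBracket_ham_mem_span (hF : IsJacobiCInfStructure S.jacobi H F U)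
    (hH : SmoothFunOn (E := E) Set.univ H) {i j : Fin (N + 1)} (hij : i < j) (hx : x ∈ U) :
    let f : Fin (N + 1) → M → ℝ := Fin.cons H F
    VectorField.mlieBracket 𝓘(ℝ, E) (S.jacobi.ham (f i)) (S.jacobi.ham (f j)) x ∈
      Submodule.span ℝ ((fun k => S.jacobi.ham (f k) x) '' Set.Iic j) := by
  intro f
  have hf := hF.smoothFunAt_cons hH
  have ham_mem (k : Fin (j.val + 1)) : S.jacobi.ham (f (Fin.castLE j.isLt k)) x ∈
      Submodule.span ℝ ((fun k => S.jacobi.ham (f k) x) '' Set.Iic j) :=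
    Submodule.subset_span ⟨_, Fin.le_def.2 (Nat.lt_succ_iff.1 k.isLt), rfl⟩
  obtain ⟨G, hG, bracket_eq, reeb_compat⟩ := hF.closure_reeb i j hij
  obtain ⟨W, -, hxW, c, -, hc⟩ := reeb_compat x hx
  rw [VectorField.mlieBracket_swap_apply, Submodule.neg_mem_iff,
    S.mlieBracket_ham (.of_forall (hf j)) (.of_forall (hf i)), funext bracket_eq,
    S.jacobi.ham_comp hG fun k => hf _ x, hc x hxW]
  exact add_mem (sum_mem fun k _ => Submodule.smul_mem _ _ (ham_mem k))
    (sum_mem fun k _ => Submodule.smul_mem _ _ (ham_mem k))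

theorem triangularFrame (hF : IsJacobiCInfStructure S.jacobi H F U)
    (hH : SmoothFunOn (E := E) Set.univ H) {V : Set M} (hV : IsOpen V) (hVU : V ⊆ U)
    {R : VField E M} (hR : SmoothVFOn V R)
    (hRs : ∀ x ∈ V, R x ∉ Submodule.span ℝ (Set.range fun k : Fin (N + 1) =>
      S.jacobi.ham ((Fin.cons H F : Fin (N + 1) → M → ℝ) k) x)) :
    TriangularFrame V (Fin.snoc (α := fun _ => VField E M)
      (fun k => S.jacobi.ham ((Fin.cons H F : Fin (N + 1) → M → ℝ) k)) R) := by
  have hindep : ∀ x ∈ V, LinearIndependent ℝ fun a => (Fin.snoc (α := fun _ => VField E M)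
      (fun k => S.jacobi.ham ((Fin.cons H F : Fin (N + 1) → M → ℝ) k)) R :
        Fin (N + 2) → VField E M) a x := fun x hx => by
    rw [snoc_vfield_apply]
    exact linearIndependent_finSnoc.2 ⟨hF.independent x (hVU hx), hRs x hx⟩
  refine ⟨hV, hF.card_eq, fun a => ?_, hindep, fun x hx a b => ?_⟩
  · refine Fin.lastCases (by rwa [Fin.snoc_last]) (fun k => ?_) a
    rw [Fin.snoc_castSucc]
    exact (smoothVFOn_iff hV).2 fun x _ => S.smoothVFAt_ham (.of_forall (hF.smoothFunAt_cons hH k))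
  · refine Fin.lastCases (fun _ => ?_)
      (fun j => Fin.lastCases (fun hab => ?_) (fun i hij => ?_) a) b
    · rw [← Fin.top_eq_last, Set.Iic_top, Set.image_univ,
        span_range_eq_top hF.card_eq (hindep x hx)]
      exact Submodule.mem_top
    · exact absurd hab (Fin.le_last _).not_gt
    · rw [snoc_vfield_image_Iic_castSucc, Fin.snoc_castSucc, Fin.snoc_castSucc]
      exact hF.mlieBracket_ham_mem_span hH (Fin.castSucc_lt_castSucc_iff.1 hij) (hVU hx)

end IsJacobiCInfStructure

end Frame

section FrameCoefficients

variable {E : Type*} [NormedAddCommGroup E] [NormedSpace ℝ E]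
  {M : Type*} [TopologicalSpace M] [ChartedSpace E M]

/-- The `a`-th coefficient of the vector field `Z` with respect to the frame `Y`; a junk value at
the points where `Y` is not a frame. -/
def frameCoeff {m : ℕ} (Y : Fin m → VField E M) (Z : VField E M) (a : Fin m) (x : M) : ℝ :=
  (frameMap (E := E) (fun a => Y a x)).inverse (Z x) a

variable [IsManifold 𝓘(ℝ, E) ∞ M]

theorem linearIndependent_vfInChart {κ : Type*} {Y : κ → VField E M} {x₀ : M} {y : E}
    (hy : y ∈ (extChartAt 𝓘(ℝ, E) x₀).target)
    (h : LinearIndependent ℝ (fun a => Y a ((extChartAt 𝓘(ℝ, E) x₀).symm y))) :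
    LinearIndependent ℝ (fun a => vfInChart (Y a) x₀ y) := by
  refine LinearIndependent.of_comp (chartSymmDeriv x₀ y).toLinearMap ?_
  have hY : (chartSymmDeriv x₀ y).toLinearMap ∘ (fun a => vfInChart (Y a) x₀ y) =
      fun a => Y a ((extChartAt 𝓘(ℝ, E) x₀).symm y) :=
    funext fun a => chartSymmDeriv_vfInChart hy (Y a)
  rwa [hY]

theorem SmoothVFAt.congr_of_eventuallyEq {X Y : VField E M} {x : M} (hX : SmoothVFAt X x)
    (h : Y =ᶠ[𝓝 x] X) : SmoothVFAt Y x :=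
  ContMDiffAt.congr_of_eventuallyEq hX
    (h.mono fun z hz => congrArg (fun v => (⟨z, v⟩ : TangentBundle 𝓘(ℝ, E) M)) hz)

theorem SmoothVFAt.sum_smul {κ : Type*} {s : Finset κ} {c : κ → M → ℝ} {Y : κ → VField E M} {x : M}
    (hc : ∀ k, SmoothFunAt (E := E) (c k) x) (hY : ∀ k, SmoothVFAt (Y k) x) :
    SmoothVFAt (fun z => ∑ k ∈ s, c k z • Y k z) x :=
  ContMDiffAt.sum_section (t := fun k z => c k z • Y k z) fun k _ =>
    ContMDiffAt.smul_section (hc k) (hY k)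

variable [CompleteSpace E]

theorem SmoothVFAt.mlieBracket {X Y : VField E M} {x : M} (hX : SmoothVFAt X x)
    (hY : SmoothVFAt Y x) : SmoothVFAt (VectorField.mlieBracket 𝓘(ℝ, E) X Y) x := by
  have : IsManifold 𝓘(ℝ, E) (((⊤ : ℕ∞) : WithTop ℕ∞) + 1) M := .of_le (n := ∞) (by simp)
  have : IsManifold 𝓘(ℝ, E) (minSmoothness ℝ 2) M := .of_le (n := ∞) <| by
    rw [minSmoothness_of_isRCLikeNormedField]; exact ENat.LEInfty.out
  exact ContMDiffAt.mlieBracket_vectorField (n := ⊤) (m := ⊤) hX hY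
    (by rw [minSmoothness_of_isRCLikeNormedField]; simp)

theorem mlieBracket_sum_smul_mem {κ : Type*} {s : Finset κ} {c : κ → M → ℝ} {Y : κ → VField E M}
    {X : VField E M} {x : M} {T : Submodule ℝ (TangentSpace 𝓘(ℝ, E) x)}
    (hc : ∀ k, SmoothFunAt (E := E) (c k) x) (hY : ∀ k, SmoothVFAt (Y k) x)
    (hYT : ∀ k, Y k x ∈ T) (hXT : ∀ k, VectorField.mlieBracket 𝓘(ℝ, E) X (Y k) x ∈ T) :
    VectorField.mlieBracket 𝓘(ℝ, E) X (fun z => ∑ k ∈ s, c k z • Y k z) x ∈ T := by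
  classical
  induction s using Finset.induction_on with
  | empty =>
    simp only [Finset.sum_empty]
    exact congrFun (VectorField.mlieBracket_zero_right (I := 𝓘(ℝ, E)) (W := X)) x ▸ T.zero_mem
  | insert k s hk ih =>
    simp only [Finset.sum_insert hk]
    have hcY : SmoothVFAt (c k • Y k) x := ContMDiffAt.smul_section (hc k) (hY k)
    have leibniz := VectorField.mlieBracket_smul_right (V := X)
      (ContMDiffAt.mdifferentiableAt (hc k) (by simp))
      (ContMDiffAt.mdifferentiableAt (hY k) (by simp))
    have additivity := VectorField.mlieBracket_add_right (V := X)
      (ContMDiffAt.mdifferentiableAt hcY (by simp))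
      (ContMDiffAt.mdifferentiableAt (SmoothVFAt.sum_smul (s := s) hc hY) (by simp))
    exact (additivity.trans (congrArg (· + _) leibniz)) ▸
      T.add_mem (T.add_mem (T.smul_mem _ (hYT k)) (T.smul_mem _ (hXT k))) ih

end FrameCoefficients

namespace TriangularFrame

variable {E : Type*} [NormedAddCommGroup E] [NormedSpace ℝ E]
  {M : Type*} [TopologicalSpace M] [ChartedSpace E M] [IsManifold 𝓘(ℝ, E) ∞ M]
  {m : ℕ} {V : Set M} {Y : Fin m → VField E M} {x : M}

theorem smoothVFAt (h : TriangularFrame V Y) (hx : x ∈ V) (a : Fin m) : SmoothVFAt (Y a) x :=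
  (smoothVFOn_iff h.isOpen).1 (h.smooth a) x hx

theorem bracket_mem (h : TriangularFrame V Y) (hx : x ∈ V) {a b d : Fin m} (ha : a ≤ d)
    (hb : b ≤ d) :
    VectorField.mlieBracket 𝓘(ℝ, E) (Y a) (Y b) x ∈
      Submodule.span ℝ ((fun c => Y c x) '' Set.Iic d) := by
  rcases lt_trichotomy a b with hab | rfl | hab
  · exact Submodule.span_mono (Set.image_mono (Set.Iic_subset_Iic.2 hb)) (h.bracket x hx a b hab)
  · rw [VectorField.mlieBracket_self]
    exact Submodule.zero_mem _
  · rw [VectorField.mlieBracket_swap_apply, Submodule.neg_mem_iff]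
    exact Submodule.span_mono (Set.image_mono (Set.Iic_subset_Iic.2 ha)) (h.bracket x hx b a hab)

variable [FiniteDimensional ℝ E] (h : TriangularFrame V Y)
include h

theorem frameMap_isInvertible (hx : x ∈ V) :
    (frameMap (E := E) (fun a => Y a x)).IsInvertible :=
  LCSInt.frameMap_isInvertible (h.independent x hx) (by rw [h.finrank_eq, Fintype.card_fin])

theorem frameMap_vfInChart_isInvertible {x₀ : M} {y : E} (hy : y ∈ (extChartAt 𝓘(ℝ, E) x₀).target)
    (hyV : (extChartAt 𝓘(ℝ, E) x₀).symm y ∈ V) :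
    (frameMap (fun a => vfInChart (Y a) x₀ y)).IsInvertible :=
  LCSInt.frameMap_isInvertible (linearIndependent_vfInChart hy (h.independent _ hyV))
    (by rw [h.finrank_eq, Fintype.card_fin])

theorem sum_frameCoeff (hx : x ∈ V) (Z : VField E M) : ∑ a, frameCoeff Y Z a x • Y a x = Z x :=
  (frameMap_apply (E := E) _ _).symm.trans ((h.frameMap_isInvertible hx).self_apply_inverse (Z x))

theorem frameCoeff_eq_zero (hx : x ∈ V) {Z : VField E M} {s : Set (Fin m)}
    (hZ : Z x ∈ Submodule.span ℝ ((fun a => Y a x) '' s)) {a : Fin m} (ha : a ∉ s) :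
    frameCoeff Y Z a x = 0 :=
  inverse_frameMap_of_mem_span (h.frameMap_isInvertible hx) hZ ha

theorem frameCoeff_chart_symm {x₀ : M} {y : E} (hy : y ∈ (extChartAt 𝓘(ℝ, E) x₀).target)
    (hyV : (extChartAt 𝓘(ℝ, E) x₀).symm y ∈ V) (Z : VField E M) (a : Fin m) :
    frameCoeff Y Z a ((extChartAt 𝓘(ℝ, E) x₀).symm y) =
      (frameMap (fun a => vfInChart (Y a) x₀ y)).inverse (vfInChart Z x₀ y) a := by
  have h_inv := h.frameMap_vfInChart_isInvertible hy hyV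
  refine congrFun (?_ : _ = (frameMap fun a => vfInChart (Y a) x₀ y).inverse _) a
  refine (h_inv.inverse_apply_eq.2 ?_).symm
  refine (chartSymmDeriv_isInvertible hy).injective ?_
  rw [frameMap_apply, map_sum, chartSymmDeriv_vfInChart hy]
  simp only [map_smul, chartSymmDeriv_vfInChart hy]
  exact (h.sum_frameCoeff hyV Z).symm

theorem smoothFunAt_frameCoeff (hx : x ∈ V) {Z : VField E M} (hZ : SmoothVFAt Z x) (a : Fin m) :
    SmoothFunAt (E := E) (frameCoeff Y Z a) x := by
  have hxs := mem_extChartAt_source (I := 𝓘(ℝ, E)) x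
  have smooth_inverse := contDiffAt_frameMap_inverse
    (fun a => (smoothVFAt_iff hxs).1 (h.smoothVFAt hx a))
    (h.frameMap_vfInChart_isInvertible ((extChartAt 𝓘(ℝ, E) x).map_source hxs)
      (by rwa [extChartAt_to_inv]))
  refine (smoothFunAt_iff hxs).2 ((contDiffAt_pi.1
    (smooth_inverse.clm_apply ((smoothVFAt_iff hxs).1 hZ)) a).congr_of_eventuallyEq ?_)
  filter_upwards [eventually_target hxs, eventually_chart_symm hxs (h.isOpen.mem_nhds hx)]
    with y hyt hyV
  exact h.frameCoeff_chart_symm hyt hyV Z a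

theorem inModuleOn {κ : Type*} [Fintype κ] {e : κ → Fin m} (he : Function.Injective e)
    {Z : VField E M} (hZ : SmoothVFOn V Z)
    (hZs : ∀ x ∈ V, Z x ∈ Submodule.span ℝ ((fun a => Y a x) '' Set.range e)) :
    InModuleOn V (fun k => Y (e k)) Z := by
  refine ⟨fun k => frameCoeff Y Z (e k), fun k => (smoothFunOn_iff h.isOpen).2 fun x hx =>
    h.smoothFunAt_frameCoeff hx ((smoothVFOn_iff h.isOpen).1 hZ x hx) _, fun x hx => ?_⟩
  rw [← h.sum_frameCoeff hx Z]
  refine (Fintype.sum_of_injective e he _ _ (fun a ha => ?_) fun k => rfl).symm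
  rw [h.frameCoeff_eq_zero hx (hZs x hx) ha, zero_smul]

theorem isCInfSymmetryOn {κ : Type*} [Fintype κ] {e : κ → Fin m} (he : Function.Injective e)
    {d : Fin m} (hed : Set.range e = Set.Iio d) :
    IsCInfSymmetryOn V (fun k => Y (e k)) (Y d) := by
  have lt_d (k : κ) : e k < d := hed.subset ⟨k, rfl⟩
  refine ⟨fun x hx hmem => ?_, fun Z ⟨c, hc, hZ⟩ => ?_⟩
  · refine (h.independent x hx).notMem_span_image (s := Set.range e) (x := d) (by simp [hed]) ?_
    rwa [← Set.range_comp]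
  have hc_at : ∀ x ∈ V, ∀ k, SmoothFunAt (E := E) (c k) x := fun x hx k =>
    (smoothFunOn_iff h.isOpen).1 (hc k) x hx
  have hZ_near : ∀ x ∈ V, Z =ᶠ[𝓝 x] fun z => ∑ k, c k z • Y (e k) z := fun x hx =>
    Filter.mem_of_superset (h.isOpen.mem_nhds hx) hZ
  have hZ_smooth : ∀ x ∈ V, SmoothVFAt Z x := fun x hx =>
    (SmoothVFAt.sum_smul (s := Finset.univ) (hc_at x hx) fun k =>
      h.smoothVFAt hx (e k)).congr_of_eventuallyEq (hZ_near x hx)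
  have hd_inj : Function.Injective (Sum.elim e fun _ : Unit => d) :=
    he.sumElim (Function.injective_of_subsingleton _) fun k _ => (lt_d k).ne
  have hd_range : Set.range (Sum.elim e fun _ : Unit => d) = Set.Iic d := by
    rw [Set.Sum.elim_range, hed, Set.range_const, Set.union_singleton, Set.Iio_insert]
  have hY_elim : (Sum.elim (fun k => Y (e k)) fun _ : Unit => Y d) =
      fun k => Y (Sum.elim e (fun _ => d) k) := (Sum.comp_elim Y e fun _ => d).symm
  rw [hY_elim]
  refine h.inModuleOn hd_inj ((smoothVFOn_iff h.isOpen).2 fun x hx =>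
    (h.smoothVFAt hx d).mlieBracket (hZ_smooth x hx)) fun x hx => ?_
  rw [hd_range, (Filter.EventuallyEq.refl _ (Y d)).mlieBracket_vectorField_eq (hZ_near x hx)]
  exact mlieBracket_sum_smul_mem (hc_at x hx) (fun k => h.smoothVFAt hx _)
    (fun k => Submodule.subset_span ⟨e k, (lt_d k).le, rfl⟩)
    fun k => h.bracket_mem hx le_rfl (lt_d k).le

omit h in
theorem isCInfStructureOn {r : ℕ} {Y : Fin (r + 1) → VField E M} (h : TriangularFrame V Y) :
    IsCInfStructureOn V (fun _ : Fin 1 => Y 0) (fun j : Fin r => Y j.succ) := by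
  refine ⟨by rw [h.finrank_eq, add_comm], fun _ => h.smooth 0, fun j => h.smooth _, fun x hx =>
    (h.independent x hx).comp (fun _ : Fin 1 => 0) (Function.injective_of_subsingleton _),
    fun j => ?_⟩
  have hY_elim : (Sum.elim (fun _ : Fin 1 => Y 0) fun i : {i // i < j} => Y i.1.succ) =
      fun k => Y (Sum.elim (fun _ => 0) (fun i => i.1.succ) k) :=
    (Sum.comp_elim Y (fun _ => 0) fun i : {i // i < j} => i.1.succ).symm
  rw [hY_elim]
  refine h.isCInfSymmetryOn ((Function.injective_of_subsingleton _).sumElim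
    ((Fin.succ_injective r).comp Subtype.val_injective) fun _ i => (Fin.succ_ne_zero i.1).symm) ?_
  ext a
  refine Fin.cases ?_ (fun i => ?_) a <;> simp [Fin.succ_ne_zero]

end TriangularFrame

/-! ### Pivots of covectors along an ordered family -/

section Pivot

variable {K T ι : Type*} [Field K] [AddCommGroup T] [Module K T] [LinearOrder ι]

/-- `a` is the pivot of the covector `α` along the ordered family `y`: the first index at which `α`
does not vanish. Covectors with distinct pivots form an echelon system. -/
structure IsPivot (y : ι → T) (a : ι) (α : T →ₗ[K] K) : Prop where
  eq_zero : ∀ l < a, α (y l) = 0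
  ne_zero : α (y a) ≠ 0

theorem mem_span_Iic_of_isPivot [Finite ι] {y : ι → T}
    (hy : Submodule.span K (Set.range y) = ⊤) {k : ι} {v : T}
    (hv : ∀ a, k < a → ∃ α : T →ₗ[K] K, IsPivot y a α ∧ α v = 0) :
    v ∈ Submodule.span K (y '' Set.Iic k) := by
  have := Fintype.ofFinite ι
  obtain ⟨c, rfl⟩ := (Submodule.mem_span_range_iff_exists_fun K).1
    (hy ▸ Submodule.mem_top : v ∈ Submodule.span K (Set.range y))
  have coeff_eq_zero : ∀ a, k < a → c a = 0 := by
    intro a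
    induction a using (wellFounded_gt (α := ι)).induction with
    | _ a ih =>
      intro ha
      obtain ⟨α, hα, hαv⟩ := hv a ha
      rw [map_sum, Fintype.sum_eq_single a, map_smul, smul_eq_mul] at hαv
      · exact (mul_eq_zero.1 hαv).resolve_right hα.ne_zero
      · intro b hb
        rw [map_smul]
        rcases lt_or_gt_of_ne hb with hb | hb
        · rw [hα.eq_zero b hb, smul_zero]
        · rw [ih b hb (ha.trans hb), zero_smul]
  refine sum_mem fun a _ => ?_
  rcases le_or_gt a k with ha | ha
  · exact Submodule.smul_mem _ _ (Submodule.subset_span ⟨a, ha, rfl⟩)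
  · rw [coeff_eq_zero a ha, zero_smul]
    exact Submodule.zero_mem _

theorem mem_span_Iic_of_isPivot_succ {N : ℕ} {y : Fin (N + 1) → T}
    (hy : Submodule.span K (Set.range y) = ⊤) {α : Fin N → T →ₗ[K] K} {k : Fin (N + 1)}
    (hα : ∀ j, k < j.succ → IsPivot y j.succ (α j)) {v : T}
    (hv : ∀ j, k < j.succ → α j v = 0) : v ∈ Submodule.span K (y '' Set.Iic k) :=
  mem_span_Iic_of_isPivot hy fun a ha => by
    obtain ⟨j, rfl⟩ := Fin.exists_succ_eq.2 (Fin.ne_zero_of_lt ha)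
    exact ⟨α j, hα j ha, hv j ha⟩

theorem exists_eq_mul_of_mem_span_Iic {y : ι → T} {a : ι} {v : T}
    (hv : v ∈ Submodule.span K (y '' Set.Iic a)) :
    ∃ c : K, ∀ α : T →ₗ[K] K, (∀ l < a, α (y l) = 0) → α v = c * α (y a) := by
  rw [← Set.Iio_insert, Set.image_insert_eq, Submodule.mem_span_insert] at hv
  obtain ⟨c, z, hz, rfl⟩ := hv
  refine ⟨c, fun α hα => ?_⟩
  have hαz : α z = 0 := LinearMap.eqOn_span (g := 0) (Set.forall_mem_image.2 hα) hz
  rw [map_add, map_smul, smul_eq_mul, hαz, add_zero]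

theorem linearIndependent_of_isPivot {κ : Type*} [LinearOrder κ] [Finite κ] {y : ι → T}
    {e : κ → ι} (he : StrictMono e) {α : κ → T →ₗ[K] K} (hα : ∀ k, IsPivot y (e k) (α k)) :
    LinearIndependent K α := by
  have := Fintype.ofFinite κ
  rw [Fintype.linearIndependent_iff]
  intro c hc k
  induction k using (wellFounded_lt (α := κ)).induction with
  | _ k ih =>
    have hck := LinearMap.congr_fun hc (y (e k))
    rw [LinearMap.sum_apply, Fintype.sum_eq_single k] at hck
    · exact (mul_eq_zero.1 hck).resolve_right (hα k).ne_zero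
    · intro j hj
      rw [LinearMap.smul_apply]
      rcases lt_or_gt_of_ne hj with hj | hj
      · rw [ih j hj, zero_smul]
      · rw [(hα j).eq_zero _ (he hj), smul_zero]

end Pivot

section Covector

variable {T : Type*} [AddCommGroup T] [Module ℝ T] [TopologicalSpace T]

/-- The linear functional underlying an alternating one-form. -/
def covector : T [⋀^Fin 1]→L[ℝ] ℝ →ₗ[ℝ] T →ₗ[ℝ] ℝ where
  toFun η := (η.toContinuousLinearMap ![0] 0).toLinearMap
  map_add' _ _ := rfl
  map_smul' _ _ := rfl

theorem covector_apply (η : T [⋀^Fin 1]→L[ℝ] ℝ) (v : T) : covector η v = η ![v] :=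
  congrArg η (vec_one (Function.update ![0] 0 v))

theorem two_form_eq_zero_of_mem_span {σ : T [⋀^Fin 2]→L[ℝ] ℝ} {s : Set T}
    (h : ∀ a ∈ s, ∀ b ∈ s, σ ![a, b] = 0) {u v : T} (hu : u ∈ Submodule.span ℝ s)
    (hv : v ∈ Submodule.span ℝ s) : σ ![u, v] = 0 := by
  have left_slot (a b : T) : (σ.toContinuousLinearMap ![0, b] 0).toLinearMap a = σ ![a, b] :=
    congrArg σ (update_zero_vec_two 0 b a)
  have right_slot (a b : T) : (σ.toContinuousLinearMap ![a, 0] 1).toLinearMap b = σ ![a, b] :=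
    congrArg σ (update_one_vec_two a 0 b)
  rw [← left_slot]
  refine LinearMap.eqOn_span (g := 0) (fun a ha => ?_) hu
  rw [left_slot, ← right_slot]
  exact LinearMap.eqOn_span (g := 0) (fun b hb => (right_slot a b).trans (h a ha b hb)) hv

end Covector

/-! ### The Pfaffian forms of a triangular frame -/

section PfaffForm

variable {E : Type*} [NormedAddCommGroup E] [NormedSpace ℝ E]
  {M : Type*} [TopologicalSpace M] [ChartedSpace E M]
  {N : ℕ} {Ω : DForm E M (N + 1)} {Y : Fin (N + 1) → VField E M}

theorem pfaffForm_apply (Ω : DForm E M (N + 1)) (Y : Fin (N + 1) → VField E M)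
    (i : Fin (N + 1)) (x : M) (v : TangentSpace 𝓘(ℝ, E) x) :
    pfaffForm Ω Y i x ![v] = Ω x
      (Fin.snoc (α := fun _ => TangentSpace 𝓘(ℝ, E) x) (fun j => Y (i.succAbove j) x) v) :=
  congrArg (Ω x) (Fin.update_snoc_last _ _ _)

theorem pfaffForm_frame_of_ne {i l : Fin (N + 1)} (hl : l ≠ i) (x : M) :
    pfaffForm Ω Y i x ![Y l x] = 0 := by
  obtain ⟨j, rfl⟩ := Fin.exists_succAbove_eq hl
  rw [pfaffForm_apply]
  refine (Ω x).map_eq_zero_of_eq _ (i := j.castSucc) (j := Fin.last N) ?_ (Fin.castSucc_ne_last j)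
  rw [Fin.snoc_castSucc, Fin.snoc_last]

theorem pfaffForm_frame_self_ne_zero (i : Fin (N + 1)) {x : M}
    (hE : Module.finrank ℝ E = N + 1) (hY : LinearIndependent ℝ (fun a => Y a x)) (hΩ : Ω x ≠ 0) :
    pfaffForm Ω Y i x ![Y i x] ≠ 0 := by
  let e : Fin (N + 1) → Fin (N + 1) := Fin.snoc (α := fun _ => Fin (N + 1)) i.succAbove i
  have e_injective : Function.Injective e := Fin.snoc_injective_iff.2
    ⟨Fin.succAbove_right_injective, fun ⟨j, hj⟩ => Fin.succAbove_ne i j hj⟩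
  let b := basisOfLinearIndependentOfCardEqFinrank (hY.comp e e_injective)
    (by rw [Fintype.card_fin]; exact hE.symm)
  have b_eq_snoc : ⇑b = Fin.snoc (α := fun _ => TangentSpace 𝓘(ℝ, E) x)
      (fun j => Y (i.succAbove j) x) (Y i x) := by
    rw [coe_basisOfLinearIndependentOfCardEqFinrank]
    funext a
    refine Fin.lastCases ?_ (fun j => ?_) a <;> simp [e]
  rw [pfaffForm_apply, ← b_eq_snoc]
  exact fun hb => hΩ (ContinuousAlternatingMap.toAlternatingMap_injective
    (((Ω x).toAlternatingMap.map_basis_eq_zero_iff b).1 hb))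

theorem isPivot_pfaffForm (i : Fin (N + 1)) {x : M} (hE : Module.finrank ℝ E = N + 1)
    (hY : LinearIndependent ℝ (fun a => Y a x)) (hΩ : Ω x ≠ 0) :
    IsPivot (fun a => Y a x) i (covector (pfaffForm Ω Y i x)) where
  eq_zero l hl := (covector_apply _ _).trans (pfaffForm_frame_of_ne hl.ne x)
  ne_zero := by
    rw [covector_apply]
    exact pfaffForm_frame_self_ne_zero i hE hY hΩ

variable [IsManifold 𝓘(ℝ, E) ∞ M]

theorem formInChart_pfaffForm (Ω : DForm E M (N + 1)) (Y : Fin (N + 1) → VField E M)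
    (i : Fin (N + 1)) {x₀ : M} {y : E} (hy : y ∈ (extChartAt 𝓘(ℝ, E) x₀).target) (v : Fin 1 → E) :
    formInChart (pfaffForm Ω Y i) x₀ y v = formInChart Ω x₀ y (fun a =>
      Fin.snoc (α := fun _ => E) (fun j => vfInChart (Y (i.succAbove j)) x₀ y) (v 0) a) := by
  rw [formInChart_apply, vec_one fun i => chartSymmDeriv x₀ y (v i), pfaffForm_apply,
    formInChart_apply]
  congr 1
  funext a
  refine Fin.lastCases ?_ (fun j => ?_) a
  · simp only [Fin.snoc_last]
  · simp only [Fin.snoc_castSucc, chartSymmDeriv_vfInChart hy]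

theorem smoothFormOn_pfaffForm [FiniteDimensional ℝ E] {V : Set M} (hV : IsOpen V)
    (hY : ∀ a, SmoothVFOn V (Y a)) (hΩ : SmoothFormOn V Ω) (i : Fin (N + 1)) :
    SmoothFormOn V (pfaffForm Ω Y i) := by
  refine (smoothFormOn_iff hV).2 fun x₀ y hy hyV => contDiffAt_form_of_apply fun v => ?_
  have smooth_chart (a : Fin (N + 1)) : ContDiffAt ℝ ∞ (vfInChart (Y a) x₀) y := by
    have hx := (extChartAt 𝓘(ℝ, E) x₀).map_target hy
    have hYx := (smoothVFAt_iff hx).1 ((smoothVFOn_iff hV).1 (hY a) _ hyV)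
    rwa [(extChartAt 𝓘(ℝ, E) x₀).right_inv hy] at hYx
  have smooth_contraction : ContDiffAt ℝ ∞ (fun z => formInChart Ω x₀ z (fun a =>
      Fin.snoc (α := fun _ => E → E) (fun j => vfInChart (Y (i.succAbove j)) x₀)
        (fun _ => v 0) a z)) y := by
    refine contDiffAt_form_apply (hΩ.contDiffAt hV hy hyV) fun a => ?_
    refine Fin.lastCases ?_ (fun j => ?_) a
    · simpa only [Fin.snoc_last] using contDiffAt_const
    · simpa only [Fin.snoc_castSucc] using smooth_chart _
  refine smooth_contraction.congr_of_eventuallyEq ?_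
  filter_upwards [(isOpen_extChartAt_target x₀).mem_nhds hy] with z hz
  rw [formInChart_pfaffForm Ω Y i hz]
  congr 1
  funext a
  refine Fin.lastCases ?_ (fun j => ?_) a <;> simp only [Fin.snoc_last, Fin.snoc_castSucc]

end PfaffForm

namespace TriangularFrame

variable {E : Type*} [NormedAddCommGroup E] [NormedSpace ℝ E] [FiniteDimensional ℝ E]
  {M : Type*} [TopologicalSpace M] [ChartedSpace E M] [IsManifold 𝓘(ℝ, E) ∞ M]
  {N : ℕ} {V W : Set M} {Y : Fin (N + 1) → VField E M} {Ω : DForm E M (N + 1)} {x : M}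
  (h : TriangularFrame V Y) (hΩ : SmoothFormOn V Ω) (hΩ0 : ∀ x ∈ V, Ω x ≠ 0)
  {I : Fin N → M → ℝ} {i : Fin N}
include h

theorem span_eq_top (hx : x ∈ V) : Submodule.span ℝ (Set.range fun a => Y a x) = ⊤ :=
  span_range_eq_top h.finrank_eq (h.independent x hx)

theorem mem_span_of_isPivot_dfun (hx : x ∈ V)
    (hI : ∀ j, i < j → IsPivot (fun a => Y a x) j.succ (dfun (E := E) (I j) x).toLinearMap)
    {v : TangentSpace 𝓘(ℝ, E) x} (hv : ∀ j, i < j → dfun (I j) x v = 0) :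
    v ∈ Submodule.span ℝ ((fun a => Y a x) '' Set.Iic i.succ) :=
  mem_span_Iic_of_isPivot_succ (α := fun j => (dfun (E := E) (I j) x).toLinearMap)
    (h.span_eq_top hx) (fun j hj => hI j (Fin.succ_lt_succ_iff.1 hj))
    fun j hj => hv j (Fin.succ_lt_succ_iff.1 hj)

section DForm

include hΩ

theorem dForm_pfaffForm_eq_zero (hx : x ∈ V) {u v : TangentSpace 𝓘(ℝ, E) x}
    (hu : u ∈ Submodule.span ℝ ((fun a => Y a x) '' Set.Iic i.castSucc))
    (hv : v ∈ Submodule.span ℝ ((fun a => Y a x) '' Set.Iic i.castSucc)) :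
    dForm (pfaffForm Ω Y i.succ) x ![u, v] = 0 := by
  have ne_of_mem (c) (hc : c ∈ Set.Iic i.castSucc) : c ≠ i.succ :=
    (lt_of_le_of_lt hc Fin.castSucc_lt_succ).ne
  have dfun_eq_zero (c) (hc : c ∈ Set.Iic i.castSucc) :
      dfun (E := E) (fun x => pfaffForm Ω Y i.succ x ![Y c x]) x = 0 := by
    rw [funext fun z => pfaffForm_frame_of_ne (Ω := Ω) (Y := Y) (ne_of_mem c hc) z]
    exact mfderiv_const
  refine two_form_eq_zero_of_mem_span ?_ hu hv
  rintro _ ⟨a, ha, rfl⟩ _ ⟨b, hb, rfl⟩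
  have bracket_term : covector (pfaffForm Ω Y i.succ x)
      (VectorField.mlieBracket 𝓘(ℝ, E) (Y a) (Y b) x) = 0 :=
    LinearMap.eqOn_span (g := 0) (Set.forall_mem_image.2 fun c hc =>
      (covector_apply _ _).trans (pfaffForm_frame_of_ne (ne_of_mem c hc) x))
      (h.bracket_mem hx ha hb)
  rw [dForm_one_apply ⟨V, h.isOpen, hx, smoothFormOn_pfaffForm h.isOpen h.smooth hΩ _⟩
    (h.smoothVFAt hx a) (h.smoothVFAt hx b), dfun_eq_zero a ha, dfun_eq_zero b hb,
    ← covector_apply (pfaffForm Ω Y i.succ x), bracket_term]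
  simp only [zero_apply, sub_zero]

end DForm

include hΩ0

omit [FiniteDimensional ℝ E] in
theorem isPivot_pfaffForm (hx : x ∈ V) (a : Fin (N + 1)) :
    IsPivot (fun a => Y a x) a (covector (pfaffForm Ω Y a x)) :=
  LCSInt.isPivot_pfaffForm a h.finrank_eq (h.independent x hx) (hΩ0 x hx)

theorem mem_span_of_pfaffForm (hx : x ∈ V) {k : Fin (N + 1)} {v : TangentSpace 𝓘(ℝ, E) x}
    (hv : ∀ j : Fin N, k < j.succ → pfaffForm Ω Y j.succ x ![v] = 0) :
    v ∈ Submodule.span ℝ ((fun a => Y a x) '' Set.Iic k) :=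
  mem_span_Iic_of_isPivot_succ (h.span_eq_top hx) (fun j _ => h.isPivot_pfaffForm hΩ0 hx j.succ)
    fun j hj => (covector_apply _ _).trans (hv j hj)

theorem pfaffForm_annihilator (hx : x ∈ V) (v : TangentSpace 𝓘(ℝ, E) x) :
    (∀ i : Fin N, pfaffForm Ω Y i.succ x ![v] = 0) ↔ v ∈ Submodule.span ℝ {Y 0 x} := by
  refine ⟨fun hv => ?_, fun hv i => ?_⟩
  · have hmem := h.mem_span_of_pfaffForm hΩ0 hx (k := ⊥) fun j _ => hv j
    rwa [Set.Iic_bot, Set.image_singleton] at hmem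
  · obtain ⟨c, rfl⟩ := Submodule.mem_span_singleton.1 hv
    rw [← covector_apply, map_smul, (h.isPivot_pfaffForm hΩ0 hx _).eq_zero _ i.succ_pos, smul_zero]

include hΩ in
theorem completelyIntegrableOn :
    CompletelyIntegrableOn V (fun i : Fin N => pfaffForm Ω Y i.succ) where
  smooth i := smoothFormOn_pfaffForm h.isOpen h.smooth hΩ _
  independent x hx := LinearIndependent.of_comp covector <|
    linearIndependent_of_isPivot Fin.strictMono_succ fun i => h.isPivot_pfaffForm hΩ0 hx i.succ
  d_eq_zero_mod i x hx u v hu hiu hv hiv := by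
    have mem_span (w : TangentSpace 𝓘(ℝ, E) x)
        (hw : KerAbove (fun i : Fin N => pfaffForm Ω Y i.succ) i x w)
        (hiw : pfaffForm Ω Y i.succ x ![w] = 0) :
        w ∈ Submodule.span ℝ ((fun a => Y a x) '' Set.Iic i.castSucc) := by
      refine h.mem_span_of_pfaffForm hΩ0 hx fun j hj => ?_
      rcases (Fin.castSucc_lt_succ_iff.1 hj).lt_or_eq with hj | rfl
      · exact hw j hj
      · exact hiw
    exact h.dForm_pfaffForm_eq_zero hΩ hx (mem_span u hu hiu) (mem_span v hv hiv)

theorem isPivot_dfun (hWV : W ⊆ V)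
    (hI : ∀ j, i ≤ j → SolvesPfaffOn W (fun i : Fin N => pfaffForm Ω Y i.succ) I j) (hx : x ∈ W) :
    IsPivot (fun a => Y a x) i.succ (dfun (E := E) (I i) x).toLinearMap := by
  induction i using (wellFounded_gt (α := Fin N)).induction with
  | _ i ih =>
    have pivot_above (j) (hj : i < j) := ih j hj fun k hk => hI k (hj.le.trans hk)
    have dfun_above (l) (hl : l ≤ i.succ) (j) (hj : i < j) : dfun (I j) x (Y l x) = 0 :=
      (pivot_above j hj).eq_zero l (hl.trans_lt (Fin.succ_lt_succ_iff.2 hj))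
    have dfun_below (l) (hl : l < i.succ) : dfun (I i) x (Y l x) = 0 := by
      have hwedge := (hI i le_rfl).wedge_eq_zero x hx (Y i.succ x) (Y l x) (dfun_above _ le_rfl)
        (dfun_above l hl.le)
      simp only [pfaffForm_frame_of_ne (Ω := Ω) (Y := Y) hl.ne, zero_mul, sub_zero,
        ← covector_apply] at hwedge
      exact (mul_eq_zero.1 hwedge).resolve_left (h.isPivot_pfaffForm hΩ0 (hWV hx) _).ne_zero
    refine ⟨dfun_below, fun dfun_self => ?_⟩
    obtain ⟨u, hu, hu_ne⟩ := (hI i le_rfl).regular x hx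
    refine hu_ne (LinearMap.eqOn_span (f := (dfun (E := E) (I i) x).toLinearMap) (g := 0) ?_
      (h.mem_span_of_isPivot_dfun (hWV hx) pivot_above hu))
    rintro _ ⟨l, hl, rfl⟩
    rcases (Set.mem_Iic.1 hl).lt_or_eq with hl | rfl
    · exact dfun_below l hl
    · exact dfun_self

theorem solvesPfaffOn_of_isPivot_dfun (hWV : W ⊆ V)
    (hI : ∀ j, i < j → SolvesPfaffOn W (fun i : Fin N => pfaffForm Ω Y i.succ) I j)
    (hs : SmoothFunOn (E := E) W (I i))
    (hp : ∀ x ∈ W, IsPivot (fun a => Y a x) i.succ (dfun (E := E) (I i) x).toLinearMap) :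
    SolvesPfaffOn W (fun i : Fin N => pfaffForm Ω Y i.succ) I i := by
  have pivot_above (x) (hx : x ∈ W) (j) (hj : i < j) :=
    h.isPivot_dfun hΩ0 hWV (fun k hk => hI k (hj.trans_le hk)) hx
  refine ⟨hs, fun x hx u v hu hv => ?_, fun x hx => ⟨Y i.succ x, fun j hj =>
    (pivot_above x hx j hj).eq_zero _ (Fin.succ_lt_succ_iff.2 hj), (hp x hx).ne_zero⟩⟩
  obtain ⟨c, hc⟩ := exists_eq_mul_of_mem_span_Iic
    (h.mem_span_of_isPivot_dfun (hWV hx) (pivot_above x hx) hu)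
  obtain ⟨d, hd⟩ := exists_eq_mul_of_mem_span_Iic
    (h.mem_span_of_isPivot_dfun (hWV hx) (pivot_above x hx) hv)
  have η_pivot := (h.isPivot_pfaffForm hΩ0 (hWV hx) i.succ).eq_zero
  have hcη := hc _ η_pivot
  have hdη := hd _ η_pivot
  have hcI : dfun (I i) x u = c * dfun (I i) x (Y i.succ x) := hc _ (hp x hx).eq_zero
  have hdI : dfun (I i) x v = d * dfun (I i) x (Y i.succ x) := hd _ (hp x hx).eq_zero
  rw [covector_apply] at hcη hdη
  rw [hcη, hdη, hcI, hdI]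
  ring

end TriangularFrame

/-! ### Solving the Pfaffian equations -/

section Step

variable {E : Type*} [NormedAddCommGroup E] [NormedSpace ℝ E]
  {M : Type*} [TopologicalSpace M] [ChartedSpace E M]

theorem eventually_nhds_chart {x₀ x : M} (hx : x ∈ (extChartAt 𝓘(ℝ, E) x₀).source) {W : Set M}
    (hW : W ∈ 𝓝 x) {P : E → Prop}
    (hP : ∀ z ∈ (extChartAt 𝓘(ℝ, E) x₀).source, z ∈ W → P (extChartAt 𝓘(ℝ, E) x₀ z)) :
    ∀ᶠ y in 𝓝 (extChartAt 𝓘(ℝ, E) x₀ x), P y := by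
  filter_upwards [eventually_target hx, eventually_chart_symm hx hW] with y hyt hyW
  simpa only [(extChartAt 𝓘(ℝ, E) x₀).right_inv hyt] using
    hP _ ((extChartAt 𝓘(ℝ, E) x₀).map_target hyt) hyW

theorem vfInChart_mem_span {κ : Type*} {Y : κ → VField E M} {Z : VField E M} {x₀ : M} {y : E}
    {s : Set κ} (h : Z ((extChartAt 𝓘(ℝ, E) x₀).symm y) ∈
      Submodule.span ℝ ((fun a => Y a ((extChartAt 𝓘(ℝ, E) x₀).symm y)) '' s)) :
    vfInChart Z x₀ y ∈ Submodule.span ℝ ((fun a => vfInChart (Y a) x₀ y) '' s) := by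
  have hmap := Submodule.mem_map_of_mem (f := (chartSymmDeriv x₀ y).inverse.toLinearMap) h
  rw [Submodule.map_span, Set.image_image] at hmap
  exact hmap

section SolvesPfaffOn

variable {r : ℕ} {W W' : Set M} {η : Fin r → DForm E M 1} {I I' : Fin r → M → ℝ} {i : Fin r}

theorem SolvesPfaffOn.mono (h : SolvesPfaffOn W η I i) (hW : W' ⊆ W) : SolvesPfaffOn W' η I i :=
  ⟨ContMDiffOn.mono h.smooth hW, fun x hx => h.wedge_eq_zero x (hW hx),
    fun x hx => h.regular x (hW hx)⟩

theorem SolvesPfaffOn.congr (h : SolvesPfaffOn W η I i) (hI : ∀ j, i ≤ j → I' j = I j) :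
    SolvesPfaffOn W η I' i := by
  have hIi := hI i le_rfl
  have ker_iff : ∀ (x : M) (u : TangentSpace 𝓘(ℝ, E) x),
      (∀ j, i < j → dfun (I' j) x u = 0) ↔ ∀ j, i < j → dfun (I j) x u = 0 := fun x u =>
    forall₂_congr fun j hj => by rw [hI j hj.le]
  refine ⟨hIi ▸ h.smooth, fun x hx u v hu hv =>
    hIi ▸ h.wedge_eq_zero x hx u v ((ker_iff x u).1 hu) ((ker_iff x v).1 hv), fun x hx => ?_⟩
  obtain ⟨u, hu, hu_ne⟩ := h.regular x hx
  exact ⟨u, (ker_iff x u).2 hu, hIi ▸ hu_ne⟩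

end SolvesPfaffOn

variable [IsManifold 𝓘(ℝ, E) ∞ M]

theorem smoothFunAt_comp_chart {x₀ x : M} (hx : x ∈ (extChartAt 𝓘(ℝ, E) x₀).source) {g : E → ℝ}
    (hg : ContDiffAt ℝ ∞ g (extChartAt 𝓘(ℝ, E) x₀ x)) :
    SmoothFunAt (E := E) (fun z => g (extChartAt 𝓘(ℝ, E) x₀ z)) x :=
  hg.contMDiffAt.comp x (contMDiffAt_chart hx)

theorem dfun_comp_chart_vfield {x₀ x : M} (hx : x ∈ (extChartAt 𝓘(ℝ, E) x₀).source) {g : E → ℝ}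
    (hg : ContDiffAt ℝ ∞ g (extChartAt 𝓘(ℝ, E) x₀ x)) (X : VField E M) :
    dfun (fun z => g (extChartAt 𝓘(ℝ, E) x₀ z)) x (X x) =
      fderiv ℝ g (extChartAt 𝓘(ℝ, E) x₀ x) (vfInChart X x₀ (extChartAt 𝓘(ℝ, E) x₀ x)) := by
  have hg_chart : funInChart (fun z => g (extChartAt 𝓘(ℝ, E) x₀ z)) x₀
      =ᶠ[𝓝 (extChartAt 𝓘(ℝ, E) x₀ x)] g := by
    filter_upwards [eventually_target hx] with y hy
    exact congrArg g ((extChartAt 𝓘(ℝ, E) x₀).right_inv hy)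
  rw [dfun_vfield_eq hx (smoothFunAt_comp_chart hx hg), hg_chart.fderiv_eq]

end Step

namespace TriangularFrame

variable {E : Type*} [NormedAddCommGroup E] [NormedSpace ℝ E] [FiniteDimensional ℝ E]
  {M : Type*} [TopologicalSpace M] [ChartedSpace E M] [IsManifold 𝓘(ℝ, E) ∞ M]
  {N : ℕ} {V W : Set M} {Y : Fin (N + 1) → VField E M} {Ω : DForm E M (N + 1)} {p : M}
  (h : TriangularFrame V Y)
include h

theorem eventually_contDiffAt_vfInChart (hp : p ∈ V) :
    ∀ᶠ y in 𝓝 (extChartAt 𝓘(ℝ, E) p p), ∀ a, ContDiffAt ℝ ∞ (vfInChart (Y a) p) y :=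
  eventually_nhds_chart (mem_extChartAt_source p) (h.isOpen.mem_nhds hp) fun _ hzs hzV a =>
    (smoothVFAt_iff hzs).1 (h.smoothVFAt hzV a)

omit [FiniteDimensional ℝ E] in
theorem linearIndependent_vfInChart_self (hp : p ∈ V) :
    LinearIndependent ℝ (fun a => vfInChart (Y a) p (extChartAt 𝓘(ℝ, E) p p)) :=
  linearIndependent_vfInChart (mem_extChartAt_target p)
    (h.independent _ (by rwa [extChartAt_to_inv]))

theorem lieBracket_vfInChart_mem_span {z : M} (hzs : z ∈ (extChartAt 𝓘(ℝ, E) p).source)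
    (hzV : z ∈ V) {a b c : Fin (N + 1)} (ha : a ≤ c) (hb : b ≤ c) :
    VectorField.lieBracket ℝ (vfInChart (Y a) p) (vfInChart (Y b) p) (extChartAt 𝓘(ℝ, E) p z) ∈
      Submodule.span ℝ
        ((fun a => vfInChart (Y a) p (extChartAt 𝓘(ℝ, E) p z)) '' Set.Iic c) := by
  rw [← vfInChart_mlieBracket hzs (h.smoothVFAt hzV a) (h.smoothVFAt hzV b)]
  refine vfInChart_mem_span ?_
  rw [(extChartAt 𝓘(ℝ, E) p).left_inv hzs]
  exact h.bracket_mem hzV ha hb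

theorem exists_first_integral_inChart (hp : p ∈ V) (i : Fin N) :
    ∃ g : E → ℝ, ∀ᶠ y in 𝓝 (extChartAt 𝓘(ℝ, E) p p), ContDiffAt ℝ ∞ g y ∧
      (∀ l < i.succ, fderiv ℝ g y (vfInChart (Y l) p y) = 0) ∧
      fderiv ℝ g y (vfInChart (Y i.succ) p y) ≠ 0 := by
  have smooth_near := h.eventually_contDiffAt_vfInChart hp
  have indep := h.linearIndependent_vfInChart_self hp
  have range_eq (y : E) : Set.range (fun a : Set.Iio i.succ => vfInChart (Y a) p y) =
      (fun a => vfInChart (Y a) p y) '' Set.Iic i.castSucc := by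
    rw [← Set.image_eq_range (fun a => vfInChart (Y a) p y)]
    exact congrArg _ (Set.ext fun a => Fin.le_castSucc_iff.symm)
  obtain ⟨g, hg, hg_one⟩ := exists_first_integral
    (Y := fun (a : Set.Iio i.succ) => vfInChart (Y a) p)
    (v := vfInChart (Y i.succ) p (extChartAt 𝓘(ℝ, E) p p))
    (fun a => smooth_near.mono fun y hy => hy a) (indep.comp _ Subtype.val_injective)
    (eventually_nhds_chart (mem_extChartAt_source p) (h.isOpen.mem_nhds hp)
      fun z hzs hzV a b => range_eq _ ▸ h.lieBracket_vfInChart_mem_span hzs hzV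
        (Fin.le_castSucc_iff.2 a.2) (Fin.le_castSucc_iff.2 b.2))
    (by rw [range_eq]; exact indep.notMem_span_image (Set.notMem_Iic.2 Fin.castSucc_lt_succ))
  have transverse : ∀ᶠ y in 𝓝 (extChartAt 𝓘(ℝ, E) p p),
      fderiv ℝ g y (vfInChart (Y i.succ) p y) ≠ 0 := by
    refine (((hg.self_of_nhds.1.fderiv_right (m := 0) (by simp)).continuousAt.clm_apply
      (smooth_near.self_of_nhds i.succ).continuousAt).eventually_ne ?_)
    rw [hg_one]
    exact one_ne_zero
  exact ⟨g, hg.mp (transverse.mono fun y hy ⟨hgy, hgY⟩ => ⟨hgy, fun l hl => hgY ⟨l, hl⟩, hy⟩)⟩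

theorem exists_isPivot_dfun (hW : IsOpen W) (hWV : W ⊆ V) (i : Fin N) (hp : p ∈ W) :
    ∃ W' : Set M, IsOpen W' ∧ W' ⊆ W ∧ p ∈ W' ∧ ∃ g : M → ℝ, SmoothFunOn (E := E) W' g ∧
      ∀ x ∈ W', IsPivot (fun a => Y a x) i.succ (dfun (E := E) g x).toLinearMap := by
  obtain ⟨g, hg⟩ := h.exists_first_integral_inChart (hWV hp) i
  obtain ⟨W', hW', hW'_open, hpW'⟩ := eventually_nhds_iff.1
    ((eventually_of_chart (mem_extChartAt_source p) hg).and (hW.mem_nhds hp))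
  refine ⟨W', hW'_open, fun z hz => (hW' z hz).2, hpW', fun x => g (extChartAt 𝓘(ℝ, E) p x),
    (smoothFunOn_iff hW'_open).2 fun z hz => ?_, fun z hz => ?_⟩
  all_goals obtain ⟨⟨hzs, hgz, hg_zero, hg_ne⟩, -⟩ := hW' z hz
  · exact smoothFunAt_comp_chart hzs hgz
  · refine ⟨fun l hl => ?_, ?_⟩
    · exact (dfun_comp_chart_vfield hzs hgz _).trans (hg_zero l hl)
    · exact (dfun_comp_chart_vfield hzs hgz _).trans_ne hg_ne

theorem exists_solution (hΩ0 : ∀ x ∈ V, Ω x ≠ 0) (i : Fin N) (hW : IsOpen W) (hWV : W ⊆ V)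
    {I : Fin N → M → ℝ}
    (hI : ∀ j, i < j → SolvesPfaffOn W (fun i : Fin N => pfaffForm Ω Y i.succ) I j)
    (hp : p ∈ W) :
    ∃ W' : Set M, IsOpen W' ∧ W' ⊆ W ∧ p ∈ W' ∧ ∃ g : M → ℝ,
      SolvesPfaffOn W' (fun i : Fin N => pfaffForm Ω Y i.succ) (Function.update I i g) i := by
  obtain ⟨W', hW'_open, hW'W, hpW', g, hg, hg_pivot⟩ := h.exists_isPivot_dfun hW hWV i hp
  refine ⟨W', hW'_open, hW'W, hpW', g, h.solvesPfaffOn_of_isPivot_dfun hΩ0 (hW'W.trans hWV)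
    (fun j hj => ((hI j hj).mono hW'W).congr fun k hk => ?_) ?_ ?_⟩
  · exact Function.update_of_ne (hj.trans_le hk).ne' _ _
  · rwa [Function.update_self]
  · rwa [Function.update_self]

end TriangularFrame

/-! ### Orbits as level sets -/

section OrbitBox

variable {E : Type*} [NormedAddCommGroup E] [NormedSpace ℝ E]
  {M : Type*} [TopologicalSpace M] [ChartedSpace E M] [IsManifold 𝓘(ℝ, E) ∞ M] {X : VField E M}

theorem isMIntegralCurveOn_chart_symm {x₀ : M} {γ : ℝ → E} {s : Set ℝ}
    (hγs : ∀ t ∈ s, γ t ∈ (extChartAt 𝓘(ℝ, E) x₀).target)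
    (hγ : ∀ t ∈ s, HasDerivAt γ (vfInChart X x₀ (γ t)) t) :
    IsMIntegralCurveOn (I := 𝓘(ℝ, E)) (fun t => (extChartAt 𝓘(ℝ, E) x₀).symm (γ t)) X s := by
  intro t ht
  have hsymm : HasMFDerivAt 𝓘(ℝ, E) 𝓘(ℝ, E) (extChartAt 𝓘(ℝ, E) x₀).symm (γ t)
      (chartSymmDeriv x₀ (γ t)) :=
    ((contMDiffAt_chart_symm (hγs t ht)).mdifferentiableAt (by simp)).hasMFDerivAt
  have hcomp := (hsymm.comp t (hγ t ht).hasFDerivAt.hasMFDerivAt).hasMFDerivWithinAt (s := s)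
  refine hcomp.congr_mfderiv (ContinuousLinearMap.ext_ring ?_)
  have hvelocity : ContinuousLinearMap.toSpanSingleton ℝ (vfInChart X x₀ (γ t)) 1 =
      vfInChart X x₀ (γ t) := ContinuousLinearMap.toSpanSingleton_apply_one _ _
  refine ((congrArg (chartSymmDeriv x₀ (γ t)) hvelocity).trans
    (chartSymmDeriv_vfInChart (hγs t ht) X)).trans ?_
  exact (one_smul ℝ _).symm

omit [IsManifold 𝓘(ℝ, E) ∞ M] in
theorem chart_symm_image_levelSet {ι : Type*} {J : ι → M → ℝ} {x₀ q : M}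
    (hq : q ∈ (extChartAt 𝓘(ℝ, E) x₀).source) {O : Set E}
    (hO : O ⊆ (extChartAt 𝓘(ℝ, E) x₀).target) :
    (extChartAt 𝓘(ℝ, E) x₀).symm '' {y ∈ O | ∀ i, funInChart (J i) x₀ y =
      funInChart (J i) x₀ (extChartAt 𝓘(ℝ, E) x₀ q)} =
    {x ∈ (extChartAt 𝓘(ℝ, E) x₀).source ∩ extChartAt 𝓘(ℝ, E) x₀ ⁻¹' O | ∀ i, J i x = J i q} := by
  rw [PartialEquiv.symm_image_eq_source_inter_preimage _ ((Set.sep_subset _ _).trans hO)]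
  ext x
  simp only [Set.mem_inter_iff, Set.mem_preimage, Set.mem_ofPred_eq, and_assoc]
  refine and_congr_right fun hx => and_congr_right fun _ => ?_
  simp only [funInChart, (extChartAt 𝓘(ℝ, E) x₀).left_inv hx,
    (extChartAt 𝓘(ℝ, E) x₀).left_inv hq]

variable [FiniteDimensional ℝ E]

theorem exists_orbit_nhds {ι : Type*} [Finite ι] {J : ι → M → ℝ} {W : Set M} {p : M}
    (hW : IsOpen W) (hp : p ∈ W) (hX : ∀ x ∈ W, SmoothVFAt X x)
    (hX0 : vfInChart X p (extChartAt 𝓘(ℝ, E) p p) ≠ 0)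
    (hJ : ∀ x ∈ W, ∀ i, SmoothFunAt (E := E) (J i) x)
    (hJX : ∀ x ∈ W, ∀ i, dfun (J i) x (X x) = 0)
    (hker : ∀ v, (∀ i, fderiv ℝ (funInChart (J i) p) (extChartAt 𝓘(ℝ, E) p p) v = 0) →
      v ∈ Submodule.span ℝ {vfInChart X p (extChartAt 𝓘(ℝ, E) p p)}) :
    ∃ W' : Set M, IsOpen W' ∧ W' ⊆ W ∧ p ∈ W' ∧
      ∀ q ∈ W', ∃ (γ : ℝ → M) (a b : ℝ), a < 0 ∧ 0 < b ∧ γ 0 = q ∧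
        IsMIntegralCurveOn (I := 𝓘(ℝ, E)) γ X (Set.Ioo a b) ∧
        γ '' Set.Ioo a b = {x ∈ W' | ∀ i, J i x = J i q} := by
  have hps := mem_extChartAt_source (I := 𝓘(ℝ, E)) p
  have hWp := hW.mem_nhds hp
  have hboxes := exists_orbit_box (X := vfInChart X p) (J := fun i => funInChart (J i) p)
    (eventually_nhds_chart hps hWp fun z hzs hzW => (smoothVFAt_iff hzs).1 (hX z hzW)) hX0
    (fun i => ((smoothFunAt_iff hps).1 (hJ p hp i)).of_le (by simp))
    (eventually_nhds_chart hps hWp fun z hzs hzW i =>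
      (dfun_vfield_eq hzs (hJ z hzW i) X).symm.trans (hJX z hzW i)) hker
    ((eventually_target hps).and (eventually_chart_symm hps hWp))
  obtain ⟨O, hO, hOW, hpO, horbit⟩ := hboxes
  refine ⟨(extChartAt 𝓘(ℝ, E) p).source ∩ extChartAt 𝓘(ℝ, E) p ⁻¹' O,
    isOpen_extChartAt_preimage' p hO, fun x ⟨hxs, hxO⟩ => ?_, ⟨hps, hpO⟩, fun q ⟨hqs, hqO⟩ => ?_⟩
  · exact (extChartAt 𝓘(ℝ, E) p).left_inv hxs ▸ (hOW hxO).2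
  obtain ⟨γ, a, b, ha, hb, hγ0, hγ, hγO⟩ := horbit _ hqO
  have hγ_target (t) (ht : t ∈ Set.Ioo a b) : γ t ∈ (extChartAt 𝓘(ℝ, E) p).target :=
    (hOW (hγO.subset (Set.mem_image_of_mem γ ht)).1).1
  refine ⟨fun t => (extChartAt 𝓘(ℝ, E) p).symm (γ t), a, b, ha, hb, ?_,
    isMIntegralCurveOn_chart_symm hγ_target hγ, ?_⟩
  · exact (congrArg _ hγ0).trans ((extChartAt 𝓘(ℝ, E) p).left_inv hqs)
  · rw [← Set.image_image (extChartAt 𝓘(ℝ, E) p).symm γ, hγO]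
    exact chart_symm_image_levelSet hqs fun y hy => (hOW hy).1

end OrbitBox

namespace TriangularFrame

variable {E : Type*} [NormedAddCommGroup E] [NormedSpace ℝ E] [FiniteDimensional ℝ E]
  {M : Type*} [TopologicalSpace M] [ChartedSpace E M] [IsManifold 𝓘(ℝ, E) ∞ M]
  {N : ℕ} {V W : Set M} {Y : Fin (N + 1) → VField E M} {Ω : DForm E M (N + 1)}
  {I : Fin N → M → ℝ} {x p : M} (h : TriangularFrame V Y)
include h

theorem mem_span_vfInChart_of_isPivot_dfun (hp : p ∈ V)
    (hI : ∀ i, SmoothFunAt (E := E) (I i) p)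
    (hpivot : ∀ i, IsPivot (fun a => Y a p) i.succ (dfun (E := E) (I i) p).toLinearMap) {v : E}
    (hv : ∀ i, fderiv ℝ (funInChart (I i) p) (extChartAt 𝓘(ℝ, E) p p) v = 0) :
    v ∈ Submodule.span ℝ {vfInChart (Y 0) p (extChartAt 𝓘(ℝ, E) p p)} := by
  have hps := mem_extChartAt_source (I := 𝓘(ℝ, E)) p
  have dfun_eq (i) (a) : dfun (I i) p (Y a p) =
      fderiv ℝ (funInChart (I i) p) (extChartAt 𝓘(ℝ, E) p p)
        (vfInChart (Y a) p (extChartAt 𝓘(ℝ, E) p p)) := dfun_vfield_eq hps (hI i) (Y a)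
  have hmem := mem_span_Iic_of_isPivot_succ (k := 0)
    (α := fun i => (fderiv ℝ (funInChart (I i) p) (extChartAt 𝓘(ℝ, E) p p)).toLinearMap)
    ((h.linearIndependent_vfInChart_self hp).span_eq_top_of_card_eq_finrank'
      ((Fintype.card_fin _).trans h.finrank_eq.symm))
    (fun i _ => ⟨fun l hl => (dfun_eq i l).symm.trans ((hpivot i).eq_zero l hl),
      (dfun_eq i i.succ).symm.trans_ne (hpivot i).ne_zero⟩)
    (fun i _ => hv i)
  rwa [← bot_eq_zero, Set.Iic_bot, Set.image_singleton] at hmem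

section Solutions

variable (hΩ0 : ∀ x ∈ V, Ω x ≠ 0) (hWV : W ⊆ V)
  (hI : ∀ i, SolvesPfaffOn W (fun i : Fin N => pfaffForm Ω Y i.succ) I i)
include hΩ0 hWV hI

theorem linearIndependent_dfun (hx : x ∈ W) :
    LinearIndependent ℝ (fun i => dfun (E := E) (I i) x) :=
  LinearIndependent.of_comp (ContinuousLinearMap.coeLM ℝ)
    (linearIndependent_of_isPivot Fin.strictMono_succ fun _ =>
      h.isPivot_dfun hΩ0 hWV (fun j _ => hI j) hx)

theorem dfun_zero_eq_zero (hx : x ∈ W) (i : Fin N) : dfun (I i) x (Y 0 x) = 0 :=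
  (h.isPivot_dfun hΩ0 hWV (fun j _ => hI j) hx).eq_zero 0 i.succ_pos

theorem exists_orbit_nhds (hW : IsOpen W) (hp : p ∈ W) :
    ∃ W' : Set M, IsOpen W' ∧ W' ⊆ W ∧ p ∈ W' ∧
      ∀ q ∈ W', ∃ (γ : ℝ → M) (a b : ℝ), a < 0 ∧ 0 < b ∧ γ 0 = q ∧
        IsMIntegralCurveOn (I := 𝓘(ℝ, E)) γ (Y 0) (Set.Ioo a b) ∧
        γ '' Set.Ioo a b = {x ∈ W' | ∀ i, I i x = I i q} := by
  have smooth_I (x) (hx : x ∈ W) (i) : SmoothFunAt (E := E) (I i) x :=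
    (smoothFunOn_iff hW).1 (hI i).smooth x hx
  exact LCSInt.exists_orbit_nhds hW hp (fun x hx => h.smoothVFAt (hWV hx) 0)
    ((h.linearIndependent_vfInChart_self (hWV hp)).ne_zero 0) smooth_I
    (fun x hx => h.dfun_zero_eq_zero hΩ0 hWV hI hx)
    fun v => h.mem_span_vfInChart_of_isPivot_dfun (hWV hp) (smooth_I p hp)
      fun i => h.isPivot_dfun hΩ0 hWV (fun j _ => hI j) hp

end Solutions

theorem integratedByPfaff (hΩ : SmoothFormOn V Ω) (hΩ0 : ∀ x ∈ V, Ω x ≠ 0) :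
    IntegratedByPfaff V (Y 0) (fun i : Fin N => pfaffForm Ω Y i.succ) where
  annihilator _ hx v := h.pfaffForm_annihilator hΩ0 hx v
  integrable := h.completelyIntegrableOn hΩ hΩ0
  step i _ hW hWV _ hI _ hp := h.exists_solution hΩ0 i hW hWV hI hp
  orbits _ hW hWV _ hI :=
    ⟨fun _ hx => h.linearIndependent_dfun hΩ0 hWV hI hx,
      fun _ hx => h.dfun_zero_eq_zero hΩ0 hWV hI hx,
      fun _ hp => h.exists_orbit_nhds hΩ0 hWV hI hW hp⟩

end TriangularFrame

/-! ### Local frames and volume forms -/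

section Existence

variable {E : Type*} [NormedAddCommGroup E] [NormedSpace ℝ E]
  {M : Type*} [TopologicalSpace M] [ChartedSpace E M] {m : ℕ}

theorem exists_alternatingMap_apply_ne_zero [FiniteDimensional ℝ E]
    (hE : Module.finrank ℝ E = m) : ∃ (D : E [⋀^Fin m]→L[ℝ] ℝ) (b : Fin m → E), D b ≠ 0 := by
  let b := Module.finBasisOfFinrankEq ℝ E hE
  refine ⟨{ b.det with cont := ?_ }, b, b.det_self.trans_ne one_ne_zero⟩
  change Continuous fun v => b.det v
  simp only [b.det_apply]
  exact .matrix_det (continuous_matrix fun i j =>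
    (b.coord i).continuous_of_finiteDimensional.comp (continuous_apply j))

theorem exists_notMem_span_range (hE : m < Module.finrank ℝ E) (y : Fin m → E) :
    ∃ w, w ∉ Submodule.span ℝ (Set.range y) := by
  by_contra! hspan
  have hcard := finrank_range_le_card (R := ℝ) y
  rw [Set.finrank, Submodule.eq_top_iff'.2 hspan, finrank_top, Fintype.card_fin] at hcard
  exact hcard.not_gt hE

theorem eventually_notMem_span_range {X : Type*} [TopologicalSpace X] {x₀ : X} {y : Fin m → X → E}
    {w : X → E} (hy : ∀ k, ContinuousAt (y k) x₀) (hw : ContinuousAt w x₀)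
    (hind : LinearIndependent ℝ (fun k => y k x₀))
    (hmem : w x₀ ∉ Submodule.span ℝ (Set.range fun k => y k x₀)) :
    ∀ᶠ x in 𝓝 x₀, w x ∉ Submodule.span ℝ (Set.range fun k => y k x) := by
  have hopen := isOpen_setOfPred_linearIndependent (𝕜 := ℝ) (E := E) (ι := Fin (m + 1))
  have hcont : ContinuousAt
      (fun x => (Fin.snoc (α := fun _ => E) (fun k => y k x) (w x) : Fin (m + 1) → E)) x₀ :=
    continuousAt_pi.2 fun a => by
      refine Fin.lastCases ?_ (fun k => ?_) a
      · simpa only [Fin.snoc_last] using hw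
      · simpa only [Fin.snoc_castSucc] using hy k
  exact (hcont.eventually (hopen.mem_nhds (linearIndependent_finSnoc.2 ⟨hind, hmem⟩))).mono
    fun x hx => (linearIndependent_finSnoc.1 hx).2

/-- The differential form with constant coefficients `D` in the preferred chart at `p`. -/
def formOfChart (D : E [⋀^Fin m]→L[ℝ] ℝ) (p : M) : DForm E M m := fun x =>
  D.compContinuousLinearMap (chartDeriv p x)

variable [IsManifold 𝓘(ℝ, E) ∞ M]

theorem formOfChart_ne_zero {D : E [⋀^Fin m]→L[ℝ] ℝ} {b : Fin m → E} (hD : D b ≠ 0) {p x : M}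
    (hx : x ∈ (extChartAt 𝓘(ℝ, E) p).source) : formOfChart D p x ≠ 0 := by
  refine fun hzero => hD ?_
  have hval : formOfChart D p x (fun i => (chartDeriv p x).inverse (b i)) = 0 := by
    rw [hzero]
    rfl
  exact (congrArg D (funext fun i =>
    ((chartDeriv_isInvertible hx).self_apply_inverse (b i)).symm)).trans hval

theorem smoothFormOn_formOfChart [FiniteDimensional ℝ E] (D : E [⋀^Fin m]→L[ℝ] ℝ) (p : M) :
    SmoothFormOn (extChartAt 𝓘(ℝ, E) p).source (formOfChart D p) := by
  refine (smoothFormOn_iff (isOpen_extChartAt_source p)).2 fun x₀ y hy hyp =>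
    contDiffAt_form_of_apply fun v => ?_
  let transition : E → E := extChartAt 𝓘(ℝ, E) p ∘ (extChartAt 𝓘(ℝ, E) x₀).symm
  have smooth_transition : ContDiffAt ℝ ∞ transition y := contMDiffAt_iff_contDiffAt.1
    ((contMDiffAt_chart hyp).comp y (contMDiffAt_chart_symm hy))
  have smooth_apply : ContDiffAt ℝ ∞ (fun z => D fun i => fderiv ℝ transition z (v i)) y :=
    contDiffAt_form_apply (β := fun _ => D) contDiffAt_const fun i =>
      (smooth_transition.fderiv_right (m := ∞) (by simp)).clm_apply contDiffAt_const
  refine smooth_apply.congr_of_eventuallyEq ?_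
  filter_upwards [(isOpen_extChartAt_target x₀).mem_nhds hy,
    (continuousAt_extChartAt_symm'' hy).eventually
      ((isOpen_extChartAt_source (I := 𝓘(ℝ, E)) p).mem_nhds hyp)] with z hzt hzs
  have hchain : mfderiv 𝓘(ℝ, E) 𝓘(ℝ, E) transition z = _ := mfderiv_comp z
    ((contMDiffAt_chart hzs).mdifferentiableAt (by simp))
    ((contMDiffAt_chart_symm hzt).mdifferentiableAt (by simp))
  rw [mfderiv_eq_fderiv] at hchain
  rw [hchain]
  rfl

variable [FiniteDimensional ℝ E]

theorem exists_transverse_vfield (hE : m < Module.finrank ℝ E) {Y : Fin m → VField E M} {p : M}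
    (hY : ∀ k, SmoothVFAt (Y k) p) (hp : LinearIndependent ℝ (fun k => Y k p)) :
    ∃ R : VField E M, ∀ᶠ x in 𝓝 p, SmoothVFAt R x ∧
      R x ∉ Submodule.span ℝ (Set.range fun k => Y k x) := by
  have hps := mem_extChartAt_source (I := 𝓘(ℝ, E)) p
  obtain ⟨w, hw⟩ :=
    exists_notMem_span_range hE fun k => vfInChart (Y k) p (extChartAt 𝓘(ℝ, E) p p)
  have transverse_near := eventually_notMem_span_range (y := fun k => vfInChart (Y k) p)
    (w := fun _ => w) (fun k => ((smoothVFAt_iff hps).1 (hY k)).continuousAt) continuousAt_const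
    (linearIndependent_vfInChart (mem_extChartAt_target p) (by rwa [extChartAt_to_inv])) hw
  refine ⟨vfOfChart p fun _ => w, ?_⟩
  filter_upwards [eventually_of_chart hps transverse_near] with x ⟨hxs, hxw⟩
  refine ⟨smoothVFAt_vfOfChart hxs contDiffAt_const, fun hmem => hxw ?_⟩
  have hmem_chart := vfInChart_mem_span (Y := Y) (Z := vfOfChart p fun _ => w) (x₀ := p)
    (y := extChartAt 𝓘(ℝ, E) p x) (s := Set.univ)
    (by rwa [(extChartAt 𝓘(ℝ, E) p).left_inv hxs, Set.image_univ])
  rwa [vfInChart_vfOfChart ((extChartAt 𝓘(ℝ, E) p).map_source hxs), Set.image_univ] at hmem_chart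

theorem LCS.exists_frame_and_volume (S : LCS E M) {N : ℕ} {H : M → ℝ}
    (hH : SmoothFunOn (E := E) Set.univ H) {F : Fin N → M → ℝ} {U : Set M}
    (hF : IsJacobiCInfStructure S.jacobi H F U) {p : M} (hp : p ∈ U) :
    ∃ V : Set M, IsOpen V ∧ V ⊆ U ∧ p ∈ V ∧
      (∃ R : VField E M, SmoothVFOn V R ∧ ∀ x ∈ V, R x ∉ Submodule.span ℝ
        (Set.range fun k : Fin (N + 1) =>
          S.jacobi.ham ((Fin.cons H F : Fin (N + 1) → M → ℝ) k) x)) ∧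
      ∃ Ω : DForm E M (N + 1 + 1), SmoothFormOn V Ω ∧ ∀ x ∈ V, Ω x ≠ 0 := by
  obtain ⟨R, hR⟩ := exists_transverse_vfield (hF.card_eq ▸ Nat.lt_succ_self _)
    (fun k => S.smoothVFAt_ham (.of_forall (hF.smoothFunAt_cons hH k))) (hF.independent p hp)
  obtain ⟨D, b, hD⟩ := exists_alternatingMap_apply_ne_zero hF.card_eq
  obtain ⟨V, hV, hVo, hpV⟩ := eventually_nhds_iff.1 (hR.and ((hF.isOpen.eventually_mem hp).and
    ((isOpen_extChartAt_source (I := 𝓘(ℝ, E)) p).eventually_mem (mem_extChartAt_source p))))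
  exact ⟨V, hVo, fun x hx => (hV x hx).2.1, hpV,
    ⟨R, (smoothVFOn_iff hVo).2 fun x hx => (hV x hx).1.1, fun x hx => (hV x hx).1.2⟩,
    formOfChart D p, fun x₀ => (smoothFormOn_formOfChart D p x₀).mono fun y hy =>
      ⟨hy.1, (hV _ hy.2).2.2⟩, fun x hx => formOfChart_ne_zero hD (hV x hx).2.2⟩

end Existence

end LCSInt

end

theorem mainTheorem5_general
    {E : Type*} [NormedAddCommGroup E] [NormedSpace ℝ E] [FiniteDimensional ℝ E]
    {M : Type*} [TopologicalSpace M] [ChartedSpace E M] [IsManifold 𝓘(ℝ, E) ∞ M]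
    {N : ℕ} (S : LCSInt.LCS E M)
    {H : M → ℝ} (hH : LCSInt.SmoothFunOn (E := E) Set.univ H)
    {F : Fin N → M → ℝ} {U : Set M} (hF : LCSInt.IsJacobiCInfStructure S.jacobi H F U) :
    (∀ p ∈ U, ∃ V : Set M, IsOpen V ∧ V ⊆ U ∧ p ∈ V ∧
      (∃ R : LCSInt.VField E M, LCSInt.SmoothVFOn V R ∧
        ∀ x ∈ V, R x ∉ Submodule.span ℝ
          (Set.range fun k : Fin (N + 1) =>
            S.jacobi.ham ((Fin.cons H F : Fin (N + 1) → M → ℝ) k) x)) ∧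
      ∃ Ω : LCSInt.DForm E M (N + 1 + 1),
        LCSInt.SmoothFormOn V Ω ∧ ∀ x ∈ V, Ω x ≠ 0) ∧
    ∀ V : Set M, IsOpen V → V ⊆ U →
      ∀ R : LCSInt.VField E M, LCSInt.SmoothVFOn V R →
        (∀ x ∈ V, R x ∉ Submodule.span ℝ
          (Set.range fun k : Fin (N + 1) =>
            S.jacobi.ham ((Fin.cons H F : Fin (N + 1) → M → ℝ) k) x)) →
        LCSInt.IsCInfStructureOn V (fun _ : Fin 1 => S.jacobi.ham H)
          (Fin.snoc (α := fun _ => LCSInt.VField E M) (fun j => S.jacobi.ham (F j)) R) ∧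
        ∀ Ω : LCSInt.DForm E M (N + 1 + 1),
          LCSInt.SmoothFormOn V Ω → (∀ x ∈ V, Ω x ≠ 0) →
          LCSInt.IntegratedByPfaff V (S.jacobi.ham H)
            (fun i : Fin (N + 1) => LCSInt.pfaffForm Ω
              (Fin.cons (S.jacobi.ham H)
                (Fin.snoc (α := fun _ => LCSInt.VField E M) (fun j => S.jacobi.ham (F j)) R))
              i.succ) := by
  refine ⟨fun p hp => S.exists_frame_and_volume hH hF hp, fun V hV hVU R hR hR_span => ?_⟩
  have hframe := hF.triangularFrame hH hV hVU hR hR_span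
  rw [S.jacobi.snoc_ham_cons] at hframe
  exact ⟨hframe.isCInfStructureOn, fun Ω hΩ hΩ0 => hframe.integratedByPfaff hΩ hΩ0⟩

theorem mainTheorem5
    {E : Type*} [NormedAddCommGroup E] [NormedSpace ℝ E] [FiniteDimensional ℝ E]
    {M : Type*} [TopologicalSpace M] [ChartedSpace E M] [IsManifold 𝓘(ℝ, E) ∞ M]
    [T2Space M] [SecondCountableTopology M]
    (n : ℕ) (hn : 1 ≤ n) (hE : Module.finrank ℝ E = 2 * n)
    (S : LCSInt.LCS E M)
    (H : M → ℝ) (hH : LCSInt.SmoothFunOn (E := E) Set.univ H)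
    (F : Fin (2 * n - 2) → M → ℝ) (U : Set M)
    (hF : LCSInt.IsJacobiCInfStructure S.jacobi H F U) :
    -- local frames `X_H, X_{f₁}, …, X_{f_{2n-2}}, R` and volume forms exist on `U`
    (∀ p ∈ U, ∃ V : Set M, IsOpen V ∧ V ⊆ U ∧ p ∈ V ∧
      (∃ R : LCSInt.VField E M, LCSInt.SmoothVFOn V R ∧
        ∀ x ∈ V, R x ∉ Submodule.span ℝ
          (Set.range fun k : Fin (2 * n - 2 + 1) =>
            S.jacobi.ham ((Fin.cons H F : Fin (2 * n - 2 + 1) → M → ℝ) k) x)) ∧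
      ∃ Ω : LCSInt.DForm E M (2 * n - 2 + 1 + 1),
        LCSInt.SmoothFormOn V Ω ∧ ∀ x ∈ V, Ω x ≠ 0) ∧
    -- and for all of them the dynamics is integrated by `2n - 1` Pfaffian equations
    ∀ V : Set M, IsOpen V → V ⊆ U →
      ∀ R : LCSInt.VField E M, LCSInt.SmoothVFOn V R →
        (∀ x ∈ V, R x ∉ Submodule.span ℝ
          (Set.range fun k : Fin (2 * n - 2 + 1) =>
            S.jacobi.ham ((Fin.cons H F : Fin (2 * n - 2 + 1) → M → ℝ) k) x)) →
        LCSInt.IsCInfStructureOn V (fun _ : Fin 1 => S.jacobi.ham H)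
          (Fin.snoc (α := fun _ => LCSInt.VField E M) (fun j => S.jacobi.ham (F j)) R) ∧
        ∀ Ω : LCSInt.DForm E M (2 * n - 2 + 1 + 1),
          LCSInt.SmoothFormOn V Ω → (∀ x ∈ V, Ω x ≠ 0) →
          LCSInt.IntegratedByPfaff V (S.jacobi.ham H)
            (fun i : Fin (2 * n - 2 + 1) => LCSInt.pfaffForm Ω
              (Fin.cons (S.jacobi.ham H)
                (Fin.snoc (α := fun _ => LCSInt.VField E M) (fun j => S.jacobi.ham (F j)) R))
              i.succ) :=
  mainTheorem5_general S hH hF
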